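/- **Setting.** A parity game with $d$ priorities on a finite nonempty vertex set $V$, $|V|=n$, has an edge relation in which every vertex has a successor, a partition $V=V_{\mathcal E}\cup V_{\mathcal O}$ between the players, and a priority $\alpha(v)\in C=\{0,\dots,d-1\}$ for every vertex. Player $\mathcal E$ wins a play iff the highest priority occurring infinitely often is even, otherwise $\mathcal O$ wins; the winning set of a player consists of the vertices from which that player has a memoryless strategy that wins against all memoryless strategies of the opponent. A set-based symbolic algorithm knows $n$ and $d$, computes freely on non-symbolic data, and accesses the game only through set variables, initially holding $V,V_{\mathcal E},V_{\mathcal O}$ and $V_c=\alpha^{-1}(c)$ $(c\in C)$, on which it performs one-step operations $\mathrm{Pre}(S)=\{v: v \text{ has a successor in } S\}$ and basic set operations $\cup,\cap,\setminus,\subseteq,=$. Its symbolic space is its number of set variables. Write $\mathrm{CP}(S)$ for the set of vertices of $\mathcal E$ with a successor in $S$ and vertices of $\mathcal O$ with all successors in $S$; it is computed by two $\mathrm{Pre}$ operations and basic set operations. **Ordered progress measure.** Let $k=\lfloor\log_2 n\rfloor+1$. Order $C\cup\{\_\}$ by $\_$ first, then the odd priorities in descending order, then the even ones in ascending order. $\mathcal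 W$ consists of the tuples $b_1\dots b_k\in (C\cup\{\_\})^k$ whose non-blank entries do not increase from left to right, ordered lexicographically, together with a greatest element $\top$; its least element is $\min=\_\dots\_$. For a tuple $b$ and $c\in C$ let $\mathrm{up}(b,c)=\top$ if $c$ and all $b_i$ are even priorities. Otherwise let $i$ be the leftmost position such that $b_i$ is a priority $<c$, or $c$ is even, $b_i$ is not an even priority and all $b_j$, $j>i$, are even priorities; $\mathrm{up}(b,c)$ results from $b$ by setting $b_i:=c$ and $b_j:=\_$ for $j>i$ (and is $b$ if there is no such $i$). Let $\mathrm{up}(\top,c)=\top$ and $\mathrm{lift}(r,c)=\min\{\mathrm{up}(r',c): r'\succeq r\}$. For $f:V\to\mathcal W$ let $\mathrm{best}(f,v)$ be the maximum ($v\in V_{\mathcal E}$) or minimum ($v\in V_{\mathcal O}$) of $f$ over the successors of $v$; the operator $\mathrm{Lift}(\cdot,v)$ replaces $f(v)$ by $\mathrm{lift}(\mathrm{best}(f,v),\alpha(v))$. The ordered progress measure is the least simultaneous fixed point of all $\mathrm{Lift}(\cdot,v)$. **Algorithm.** A ranking function $f$ is stored in the sets $C^i_x=\{v: f(v)\neq\top,\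 f(v)_i=x\}$ $(1\le i\le k,\ x\in C\cup\{\_\})$ and $C_\top=\{v:f(v)=\top\}$; initially all ranks are $\min$. - *getSet*$(r)$ rebuilds $S_{\succeq r}=\{v:f(v)\succeq r\}$ as $C_\top$ for $r=\top$, and for $r=b_1\dots b_k$ as $C_\top\cup\bigcup_{i=0}^{k-1}\bigl(\bigcap_{j\le i}C^j_{b_j}\cap\bigcup_{x\succ b_{i+1}}C^{i+1}_x\bigr)\cup\bigcap_{j\le k}C^j_{b_j}$. - *update*$(r,S)$ removes $\Delta=S\setminus S_{\succeq r}$ from all $C^i_x$ and adds $\Delta$ to $C_\top$ if $r=\top$, and to all $C^i_{r_i}$ otherwise. The non-symbolic data are a set $T\subseteq\mathcal W$ of keys, initially $\{\min,\top\}$, and a list of active ranks, initially only $\min$. With $\mathrm{rep}(r)$ the least key $\succeq r$ ($\top$ if there is none), $\mathrm{next}(r)$ is the least key $\succ\mathrm{rep}(r)$ ($\top$ if there is none) and $\mathrm{prev}(r)$ the largest key $\prec\mathrm{rep}(r)$ ($\min$ if there is none). Activating $r$ puts $r$ into $T$ and, if it is not there, at the end of the active list; removing $r$ deletes it from both. While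 the active list is nonempty, take its first element $r$ off it, compute $S_{\succeq r}$ and $P=\mathrm{CP}(S_{\succeq r})$, and for every $c\in C$ do the following. Put $r'=r_{old}=\mathrm{lift}(r,c)$, compute $S:=S_{\succeq r'}$ and $S_{old}:=S\cup(P\cap V_c)$. While $P\cap V_c\not\subseteq S$: put $S:=S\cup (P\cap V_c)$; if $r'=\top$ or $S\supsetneq S_{\succeq \mathrm{next}(r')}$, activate $r'$; if $S=S_{\succeq\mathrm{prev}(r')}\cup(P\cap V_c)$, remove $\mathrm{prev}(r')$; put $r':=\mathrm{prev}(r')$ and $S:=S_{\succeq r'}$. Afterwards perform *update*$(r_{old},S_{old})$. When no rank is active, return $S_{\succeq\top}$. **Theorem.** There is an absolute constant $K$ such that for every $d$ and every parity game with $d$ priorities and $n\ge1$ vertices the algorithm terminates, the returned set is the winning set of $\mathcal E$ and its complement is the winning set of $\mathcal O$, the final sets $C^i_x$, $C_\top$ encode the ordered progress measure, and the algorithm uses at most $K\,n|\mathcal W|$ one-step operations; moreover, if $n\ge2$, it uses at most $K\,d^2n|\mathcal W|\log_2 n$ basic set operations and symbolic space at most $K\,d\log_2 n$ (input sets included). 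-/

import Mathlib

namespace SymbolicParity

/-! ## Parity games -/

/-- The two players: `even` is the player who wins when the highest priority occurring infinitely
often is even. -/
inductive Player
  | even
  | odd
deriving DecidableEq

/-- The opponent of a player. -/
def Player.other : Player → Player
  | .even => .odd
  | .odd => .even

/-- A priority is good for a player if it has the parity of that player. -/
def Player.Likes : Player → ℕ → Prop
  | .even, c => Even c
  | .odd, c => Odd c

/-- A parity game on the vertex set `V` with priorities `0, …, d - 1`. Every vertex belongs to
exactly one player and has an outgoing edge. -/
structure ParityGame (V : Type*) (d : ℕ) where
  edge : V → V → Prop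
  owner : V → Player
  prio : V → Fin d
  total : ∀ v, ∃ w, edge v w

namespace ParityGame

variable {V : Type*} {d : ℕ} (G : ParityGame V d)

/-- The predecessor operation: all vertices with some successor in `S`. -/
def pre (S : Set V) : Set V := {v | ∃ w, G.edge v w ∧ w ∈ S}

/-- Memoryless strategies of player `z`: the choice at the vertices of `z` follows an edge
(the values at the other vertices are never used). -/
def IsStrategy (z : Player) (σ : V → V) : Prop := ∀ v, G.owner v = z → G.edge v (σ v)

/-- The next vertex when player `z` uses `σ` and the opponent uses `τ`. -/
def next (z : Player) (σ τ : V → V) (v : V) : V := if G.owner v = z then σ v else τ v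

/-- The play from `s` when player `z` uses `σ` and the opponent uses `τ`. -/
def play (z : Player) (σ τ : V → V) (s : V) (i : ℕ) : V := (G.next z σ τ)^[i] s

/-- Player `z` wins the play `ρ`: the highest priority occurring infinitely often is of the
parity of `z`. -/
def WinsPlay (z : Player) (ρ : ℕ → V) : Prop :=
  ∃ c : ℕ, IsGreatest {c' : ℕ | ∃ᶠ i in Filter.atTop, (G.prio (ρ i) : ℕ) = c'} c ∧ z.Likes c

/-- The winning set of player `z`. -/
def winningSet (z : Player) : Set V :=
  {s | ∃ σ, G.IsStrategy z σ ∧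
    ∀ τ, G.IsStrategy z.other τ → G.WinsPlay z (G.play z σ τ s)}

end ParityGame

/-! ## The ordered progress measure

The rank set consists of tuples over the priorities extended by a blank, together with a greatest
element `⊤`. Coordinate `0` is the most significant one. -/

/-- An entry of a tuple: a blank or a priority. -/
inductive Entry (d : ℕ)
  | blank
  | col (c : Fin d)
deriving DecidableEq

namespace Entry

variable {d : ℕ}

/-- The order of the entries is read off from this key: the blank comes first, then the odd
priorities in descending order, then the even priorities in ascending order. -/
def key : Entry d → ℤ
  | blank => -(d : ℤ) - 1
  | col c => if Even (c : ℕ) then (c : ℤ) else -(c : ℤ)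

theorem key_injective : Function.Injective (key (d := d)) := by
  rintro (_ | a) (_ | b) h
  · rfl
  · exfalso
    have := b.2
    simp only [key] at h
    split_ifs at h <;> omega
  · exfalso
    have := a.2
    simp only [key] at h
    split_ifs at h <;> omega
  · congr 1
    apply Fin.ext
    simp only [key] at h
    by_cases ha : Even (a : ℕ) <;> by_cases hb : Even (b : ℕ) <;>
      simp only [ha, hb, if_true, if_false] at h <;> grind

instance : LinearOrder (Entry d) := LinearOrder.lift' key key_injective

theorem le_iff_key {x y : Entry d} : x ≤ y ↔ key x ≤ key y := Iff.rfl

theorem blank_le (x : Entry d) : blank ≤ x := by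
  rw [le_iff_key]
  rcases x with _ | c
  · exact le_rfl
  · have := c.2
    simp only [key]
    split_ifs <;> omega

instance : OrderBot (Entry d) where
  bot := blank
  bot_le := blank_le

/-- All entries. -/
def all (d : ℕ) : List (Entry d) := blank :: (List.finRange d).map col

instance : Fintype (Entry d) where
  elems := (all d).toFinset
  complete x := by
    rcases x with _ | c <;> simp [all]

/-- The entry is an even priority. -/
def IsEven : Entry d → Prop
  | blank => False
  | col c => Even (c : ℕ)

/-- The entry is a priority below `c` (in the usual order of the natural numbers). -/
def IsBelow (c : Fin d) : Entry d → Prop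
  | blank => False
  | col x => x < c

end Entry

/-- The priorities in the tuple do not increase from left to right (blanks are ignored). -/
def Nonincreasing {k d : ℕ} (b : Fin k → Entry d) : Prop :=
  ∀ i j, i < j → ∀ x y, b i = .col x → b j = .col y → y ≤ x

/-- Tuples of length `k`, ordered lexicographically. -/
def Tuple (k d : ℕ) : Type := {b : Lex (Fin k → Entry d) // Nonincreasing (ofLex b)}

namespace Tuple

variable {k d : ℕ}

noncomputable instance : LinearOrder (Tuple k d) :=
  inferInstanceAs (LinearOrder {b : Lex (Fin k → Entry d) // Nonincreasing (ofLex b)})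

/-- The coordinates of a tuple. -/
def get (b : Tuple k d) (i : Fin k) : Entry d := ofLex b.1 i

/-- A tuple from its coordinates. -/
def mk (b : Fin k → Entry d) (h : Nonincreasing b) : Tuple k d := ⟨toLex b, h⟩

noncomputable instance : OrderBot (Tuple k d) where
  bot := mk (fun _ => .blank) (fun _ _ _ _ _ h => by cases h)
  bot_le b := (bot_le : (⊥ : Lex (Fin k → Entry d)) ≤ b.1)

instance : Finite (Tuple k d) :=
  haveI : Finite (Lex (Fin k → Entry d)) := inferInstanceAs (Finite (Fin k → Entry d))
  inferInstanceAs (Finite {b : Lex (Fin k → Entry d) // Nonincreasing (ofLex b)})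

noncomputable instance : Fintype (Tuple k d) := Fintype.ofFinite _

end Tuple

/-- The rank set: tuples and the greatest element `⊤`; the least element `⊥` is the all-blank
tuple. -/
abbrev Rank (k d : ℕ) : Type := WithTop (Tuple k d)

/-- The number of coordinates for games with `n` vertices: the least `k` with `n < 2 ^ k`
(for positive `n`). -/
def width (n : ℕ) : ℕ := Nat.log 2 n + 1

section Lift

variable {k d : ℕ}

/-- Coordinate `i` may be overwritten by the priority `c`: either its entry is a smaller priority,
or `c` is even, the entry is not an even priority, and all less significant entries are even
priorities. -/
def Replaceable (b : Fin k → Entry d) (c : Fin d) (i : Fin k) : Prop :=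
  (b i).IsBelow c ∨ (Even (c : ℕ) ∧ ¬ (b i).IsEven ∧ ∀ j, i < j → (b j).IsEven)

/-- Write `c` at coordinate `i` and erase all less significant coordinates. -/
def overwrite (b : Fin k → Entry d) (c : Fin d) (i : Fin k) : Fin k → Entry d :=
  fun j => if j < i then b j else if j = i then .col c else .blank

/-- Coordinate `i` is the most significant one that may be overwritten by `c`. -/
def IsSlot (b : Fin k → Entry d) (c : Fin d) (i : Fin k) : Prop :=
  Replaceable b c i ∧ ∀ j, j < i → ¬ Replaceable b c j

theorem nonincreasing_overwrite {b : Fin k → Entry d} (hb : Nonincreasing b) {c : Fin d}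
    {i : Fin k} (hi : IsSlot b c i) : Nonincreasing (overwrite b c i) := by
  intro p q hpq x y hx hy
  by_cases hq : q < i
  · have hp : p < i := lt_trans hpq hq
    simp only [overwrite, hp, hq, if_true] at hx hy
    exact hb p q hpq x y hx hy
  · by_cases hqi : q = i
    · subst hqi
      simp only [overwrite, hpq, if_true, lt_irrefl, if_false] at hx hy
      have h := hi.2 p hpq
      have hxc : ¬ x < c := fun hlt => h (Or.inl (by simpa [hx, Entry.IsBelow] using hlt))
      cases hy
      exact not_lt.mp hxc
    · simp [overwrite, hq, hqi] at hy

open Classical in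
/-- The basic update of a tuple by a priority `c`. If `c` and all entries are even, the result is
`⊤`. Otherwise `c` is written to the most significant coordinate that may be overwritten, if there
is one. -/
noncomputable def updTuple (b : Tuple k d) (c : Fin d) : Rank k d :=
  if Even (c : ℕ) ∧ ∀ i, (b.get i).IsEven then ⊤
  else if h : ∃ i, IsSlot b.get c i then
    ((Tuple.mk (overwrite b.get c h.choose)
      (nonincreasing_overwrite b.2 h.choose_spec) : Tuple k d) : Rank k d)
  else (b : Rank k d)

/-- The basic update of a rank by a priority; `⊤` stays `⊤`. -/
noncomputable def upd (r : Rank k d) (c : Fin d) : Rank k d :=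
  match r with
  | ⊤ => ⊤
  | (b : Tuple k d) => updTuple b c

/-- The `lift` function: the antagonistic update, that is, the least basic update of a rank that is
at least `r`. -/
noncomputable def lift (r : Rank k d) (c : Fin d) : Rank k d :=
  (Finset.univ.filter (fun q : Rank k d => r ≤ q)).inf (fun q => upd q c)

end Lift

namespace ParityGame

variable {V : Type*} {d : ℕ} (G : ParityGame V d)

open Classical in
/-- The best rank among the successors: the maximum for player `even`, the minimum for `odd`. -/
noncomputable def best [Fintype V] {k : ℕ} (f : V → Rank k d) (v : V) : Rank k d :=
  if G.owner v = .even then (Finset.univ.filter (G.edge v)).sup f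
  else (Finset.univ.filter (G.edge v)).inf f

open Classical in
/-- The `Lift(·, v)` operator on ranking functions. -/
noncomputable def liftAt [Fintype V] {k : ℕ} (f : V → Rank k d) (v : V) : V → Rank k d :=
  Function.update f v (lift (G.best f v) (G.prio v))

/-- `f` is the least simultaneous fixed point of all operators `Lift(·, v)`. -/
def IsProgressMeasure [Fintype V] {k : ℕ} (f : V → Rank k d) : Prop :=
  IsLeast {g : V → Rank k d | ∀ v, G.liftAt g v = g} f

end ParityGame

/-! ## Set-based symbolic algorithms

A program works on a non-symbolic store of type `σ` and on registers of type `R`, each of which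
holds one set of vertices. The non-symbolic store is manipulated freely; the registers are accessed
only through basic set operations and the predecessor operation. The program itself never mentions
the game. Registers are addressed through the store. -/

/-- The basic set operations with a set as result. -/
inductive SetOp
  | union
  | inter
  | diff

/-- The basic set operations with a truth value as result. -/
inductive SetTest
  | subset
  | eq

/-- The meaning of the set operations. -/
def SetOp.eval {V : Type*} : SetOp → Set V → Set V → Set V
  | union, A, B => A ∪ B
  | inter, A, B => A ∩ B
  | diff, A, B => A \ B

/-- The meaning of the tests. -/
def SetTest.eval {V : Type*} : SetTest → Set V → Set V → Prop
  | subset, A, B => A ⊆ B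
  | eq, A, B => A = B

/-- Symbolic programs. -/
inductive Prog (σ R : Type)
  | skip
  | seq (p q : Prog σ R)
  /-- change the non-symbolic store -/
  | assign (f : σ → σ)
  /-- `dst := op a b` -/
  | setOp (op : SetOp) (dst a b : σ → R)
  /-- `dst := Pre a` -/
  | pre (dst a : σ → R)
  /-- compare two registers and put the answer into the non-symbolic store -/
  | test (t : SetTest) (a b : σ → R) (f : σ → Bool → σ)
  | cond (c : σ → Bool) (p q : Prog σ R)
  | loop (c : σ → Bool) (p : Prog σ R)

open Classical in
/-- Big-step semantics. `Exec Pre p x y m b` says that the program `p`, started in the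
configuration `x`, terminates in the configuration `y` after exactly `m` one-step operations and
`b` basic set operations. -/
inductive Exec {V : Type*} {σ R : Type} [DecidableEq R] (Pre : Set V → Set V) :
    Prog σ R → σ × (R → Set V) → σ × (R → Set V) → ℕ → ℕ → Prop
  | skip (x) : Exec Pre .skip x x 0 0
  | seq {p q x y z m m' b b'} : Exec Pre p x y m b → Exec Pre q y z m' b' →
      Exec Pre (.seq p q) x z (m + m') (b + b')
  | assign (f s M) : Exec Pre (.assign f) (s, M) (f s, M) 0 0
  | setOp (op dst u v s M) : Exec Pre (.setOp op dst u v) (s, M)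
      (s, Function.update M (dst s) (op.eval (M (u s)) (M (v s)))) 0 1
  | pre (dst u s M) : Exec Pre (.pre dst u) (s, M)
      (s, Function.update M (dst s) (Pre (M (u s)))) 1 0
  | test (t u v f s M) : Exec Pre (.test t u v f) (s, M)
      (f s (decide (t.eval (M (u s)) (M (v s)))), M) 0 1
  | condTrue {c p q x y m b} : c x.1 = true → Exec Pre p x y m b →
      Exec Pre (.cond c p q) x y m b
  | condFalse {c p q x y m b} : c x.1 = false → Exec Pre q x y m b →
      Exec Pre (.cond c p q) x y m b
  | loopDone {c p x} : c x.1 = false → Exec Pre (.loop c p) x x 0 0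
  | loopStep {c p x y z m m' b b'} : c x.1 = true → Exec Pre p x y m b →
      Exec Pre (.loop c p) y z m' b' → Exec Pre (.loop c p) x z (m + m') (b + b')

/-- A program has at most one run from a given configuration, so the final configuration and the
numbers of operations are determined by the program and its input. -/
theorem Exec.unique {V : Type*} {σ R : Type} [DecidableEq R] {Pre : Set V → Set V}
    {p : Prog σ R} {x y z : σ × (R → Set V)} {m b m' b' : ℕ}
    (h : Exec Pre p x y m b) (h' : Exec Pre p x z m' b') : y = z ∧ m = m' ∧ b = b' := by
  induction h generalizing z m' b' with
  | skip => cases h'; simp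
  | seq _ _ i1 i2 =>
    cases h' with
    | seq a b => obtain ⟨rfl, rfl, rfl⟩ := i1 a; obtain ⟨rfl, rfl, rfl⟩ := i2 b; simp
  | assign => cases h'; simp
  | setOp => cases h'; simp
  | pre => cases h'; simp
  | test => cases h'; simp
  | condTrue h _ i =>
    cases h' with
    | condTrue _ a => exact i a
    | condFalse q _ => simp_all
  | condFalse h _ i =>
    cases h' with
    | condTrue q a => simp_all
    | condFalse _ a => exact i a
  | loopDone h =>
    cases h' with
    | loopDone => simp
    | loopStep q => simp_all
  | loopStep h _ _ i1 i2 =>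
    cases h' with
    | loopDone => simp_all
    | loopStep q a b => obtain ⟨rfl, rfl, rfl⟩ := i1 a; obtain ⟨rfl, rfl, rfl⟩ := i2 b; simp

namespace Prog

variable {σ R : Type}

/-- Run a list of programs one after another. -/
def block : List (Prog σ R) → Prog σ R
  | [] => skip
  | p :: ps => seq p (block ps)

/-- Run `p i` for all `i` in a list. -/
def forEach {ι : Type} (l : List ι) (p : ι → Prog σ R) : Prog σ R := block (l.map p)

def union (dst a b : R) : Prog σ R := setOp .union (fun _ => dst) (fun _ => a) (fun _ => b)

def inter (dst a b : R) : Prog σ R := setOp .inter (fun _ => dst) (fun _ => a) (fun _ => b)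

def diff (dst a b : R) : Prog σ R := setOp .diff (fun _ => dst) (fun _ => a) (fun _ => b)

end Prog

/-! ## The algorithm -/

/-- The set registers. The first four kinds hold the input: the set of all vertices, the vertices of
the two players, and the vertices of each priority. -/
inductive Reg (k d : ℕ)
  | vert
  | vEven
  | vOdd
  | vPrio (c : Fin d)
  /-- the vertices whose rank is a tuple with entry `x` at coordinate `i` -/
  | C (i : Fin k) (x : Entry d)
  /-- the vertices of rank `⊤` -/
  | Ctop
  /-- the set `S_{⪰ r}` or `S_{⪰ r'}` the algorithm works with -/
  | S
  /-- the controllable predecessors -/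
  | P
  /-- the controllable predecessors of the current priority -/
  | Pc
  | Snext
  | Sprev
  | Sold
  /-- the difference set of an update -/
  | D
  /-- auxiliary sets -/
  | T
  | U
  | A
deriving DecidableEq

/-- The registers, listed. -/
def Reg.equivSum (k d : ℕ) : Reg k d ≃ Fin 14 ⊕ Fin d ⊕ (Fin k × Entry d) where
  toFun
    | vert => .inl 0
    | vEven => .inl 1
    | vOdd => .inl 2
    | vPrio c => .inr (.inl c)
    | C i x => .inr (.inr (i, x))
    | Ctop => .inl 3
    | S => .inl 4
    | P => .inl 5
    | Pc => .inl 6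
    | Snext => .inl 7
    | Sprev => .inl 8
    | Sold => .inl 9
    | D => .inl 10
    | T => .inl 11
    | U => .inl 12
    | A => .inl 13
  invFun
    | .inl 0 => vert
    | .inl 1 => vEven
    | .inl 2 => vOdd
    | .inr (.inl c) => vPrio c
    | .inr (.inr (i, x)) => C i x
    | .inl 3 => Ctop
    | .inl 4 => S
    | .inl 5 => P
    | .inl 6 => Pc
    | .inl 7 => Snext
    | .inl 8 => Sprev
    | .inl 9 => Sold
    | .inl 10 => D
    | .inl 11 => T
    | .inl 12 => U
    | .inl 13 => A
  left_inv := by rintro (_ | _) <;> rfl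
  right_inv := by
    rintro (i | c | ⟨i, x⟩)
    · fin_cases i <;> rfl
    · rfl
    · rfl

instance (k d : ℕ) : Fintype (Reg k d) := Fintype.ofEquiv _ (Reg.equivSum k d).symm

/-- The non-symbolic store: the search tree of the data structure (as the finite set of its keys),
the list of active ranks, the variables `r`, `r'` and `rold`, and answers of tests. -/
structure Store (k d : ℕ) where
  tree : Finset (Rank k d)
  active : List (Rank k d)
  cur : Rank k d
  tgt : Rank k d
  old : Rank k d
  sub : Bool
  eq : Bool

namespace Store

variable {k d : ℕ}

/-- The stored key that represents `r`: the least one that is at least `r`. -/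
noncomputable def rep (s : Store k d) (r : Rank k d) : Rank k d :=
  (s.tree.filter (fun q => r ≤ q)).inf id

/-- The successor of the representative of `r` in the tree (`⊤` if there is none). -/
noncomputable def getNext (s : Store k d) (r : Rank k d) : Rank k d :=
  (s.tree.filter (fun q => s.rep r < q)).inf id

/-- The predecessor of the representative of `r` in the tree (`⊥` if there is none). -/
noncomputable def getPrevious (s : Store k d) (r : Rank k d) : Rank k d :=
  (s.tree.filter (fun q => q < s.rep r)).sup id

/-- Put `r` into the tree and mark it as active. -/
noncomputable def activate (r : Rank k d) (s : Store k d) : Store k d :=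
  { s with
    tree := insert r s.tree
    active := if r ∈ s.active then s.active else s.active ++ [r] }

/-- Mark `r` as inactive. -/
noncomputable def deactivate (r : Rank k d) (s : Store k d) : Store k d :=
  { s with active := s.active.filter (fun q => q ≠ r) }

/-- Remove `r` from the tree and mark it as inactive. -/
noncomputable def removeSet (r : Rank k d) (s : Store k d) : Store k d :=
  { s.deactivate r with tree := s.tree.erase r }

/-- Take the first active rank as the new current rank. -/
def popActive (s : Store k d) : Store k d :=
  match s.active with
  | [] => s
  | r :: rs => { s with cur := r, active := rs }

/-- The initial tree and active list. -/
noncomputable def reset (s : Store k d) : Store k d :=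
  { s with tree := {⊥, ⊤}, active := [⊥] }

end Store

/-- Coordinate `i` of a rank (only used for ranks other than `⊤`). -/
def Rank.coord {k d : ℕ} (r : Rank k d) (i : Fin k) : Entry d :=
  match r with
  | ⊤ => .blank
  | (b : Tuple k d) => b.get i

section Algorithm

open Prog

variable (k d : ℕ)

/-- The programs of the algorithm. -/
abbrev OPMProg : Type := Prog (Store k d) (Reg k d)

variable {k d}

/-- `dst := S_{⪰ r}` for the rank `r` given by `e`, rebuilt from the sets of the encoding:
`S_{⪰ ⊤}` is the set of the vertices of rank `⊤`, and for a tuple `b` it is the union of that set,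
of `⋂ j < i, C j (b j) ∩ ⋃ x > b i, C i x` for all `i`, and of `⋂ j, C j (b j)`. -/
noncomputable def getSet (dst : Reg k d) (e : Store k d → Rank k d) : OPMProg k d :=
  cond (fun s => decide (e s = ⊤))
    (union dst .Ctop .Ctop)
    (block [
      union dst .Ctop .Ctop,
      union .T .vert .vert,
      forEach (List.finRange k) fun i => block [
        diff .U .vert .vert,
        forEach (Entry.all d) fun x =>
          cond (fun s => decide ((e s).coord i < x)) (union .U .U (.C i x)) skip,
        inter .U .T .U,
        union dst dst .U,
        setOp .inter (fun _ => .T) (fun _ => .T) (fun s => .C i ((e s).coord i))],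
      union dst dst .T])

/-- Update `S_{⪰ r}`, for the rank `r` given by `e`, to the set in the register `src`: the new
vertices lose their old rank and get the rank `r`. -/
noncomputable def updateSet (src : Reg k d) (e : Store k d → Rank k d) : OPMProg k d :=
  block [
    getSet .A e,
    diff .D src .A,
    forEach (List.finRange k) fun i => forEach (Entry.all d) fun x =>
      diff (.C i x) (.C i x) .D,
    cond (fun s => decide (e s = ⊤))
      (union .Ctop .Ctop .D)
      (forEach (List.finRange k) fun i =>
        setOp .union (fun s => .C i ((e s).coord i)) (fun s => .C i ((e s).coord i))
          (fun _ => .D))]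

/-- `P := CP(S)` for player `even`: the vertices of `even` with a successor in `S` and the vertices
of `odd` with all successors in `S`. -/
def controllablePre : OPMProg k d :=
  block [
    pre (fun _ => .A) (fun _ => .S),
    inter .P .vEven .A,
    diff .A .vert .S,
    pre (fun _ => .A) (fun _ => .A),
    diff .A .vOdd .A,
    union .P .P .A]

/-- Put the answer of `Pc ⊆ S` into the store. -/
def testCovered : OPMProg k d :=
  test .subset (fun _ => .Pc) (fun _ => .S) (fun s a => { s with sub := a })

/-- All vertices get the all-blank tuple, and only the least rank is active. -/
noncomputable def setupRanks : OPMProg k d :=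
  block [
    forEach (List.finRange k) fun i => forEach (Entry.all d) fun x =>
      if x = .blank then union (.C i x) .vert .vert else diff (.C i x) .vert .vert,
    diff .Ctop .vert .vert,
    assign Store.reset]

/-- The body of the inner while-loop. -/
noncomputable def innerStep : OPMProg k d :=
  block [
    union .S .S .Pc,
    getSet .Snext (fun s => s.getNext s.tgt),
    test .subset (fun _ => .Snext) (fun _ => .S) (fun s a => { s with sub := a }),
    test .eq (fun _ => .Snext) (fun _ => .S) (fun s a => { s with eq := a }),
    assign (fun s => if s.tgt = ⊤ ∨ (s.sub = true ∧ s.eq = false) then s.activate s.tgt else s),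
    getSet .Sprev (fun s => s.getPrevious s.tgt),
    union .A .Sprev .Pc,
    test .eq (fun _ => .S) (fun _ => .A) (fun s a => { s with eq := a }),
    assign (fun s => if s.eq = true then s.removeSet (s.getPrevious s.tgt) else s),
    assign (fun s => { s with tgt := s.getPrevious s.tgt }),
    getSet .S Store.tgt,
    testCovered]

/-- The body of the for-loop over the priorities. -/
noncomputable def processPriority (c : Fin d) : OPMProg k d :=
  block [
    assign (fun s => { s with tgt := lift s.cur c }),
    getSet .S Store.tgt,
    assign (fun s => { s with old := s.tgt }),
    inter .Pc .P (.vPrio c),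
    union .Sold .S .Pc,
    testCovered,
    loop (fun s => !s.sub) innerStep,
    updateSet .Sold Store.old]

/-- The algorithm with `k` coordinates and `d` priorities. The result is in the register `S`. -/
noncomputable def reducedSpaceOPM (k d : ℕ) : OPMProg k d :=
  block [
    setupRanks,
    loop (fun s => !s.active.isEmpty) (block [
      assign Store.popActive,
      getSet .S Store.cur,
      assign (fun s => s.deactivate s.cur),
      controllablePre,
      forEach (List.finRange d) processPriority]),
    getSet .S (fun _ => ⊤)]

end Algorithm

/-- The input registers hold the vertex set, the vertices of the two players and the vertices of
each priority of the game `G`; the contents of the other registers are arbitrary. -/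
structure HoldsInput {V : Type*} {k d : ℕ} (G : ParityGame V d) (M : Reg k d → Set V) : Prop where
  vert : M .vert = Set.univ
  vEven : M .vEven = {v | G.owner v = .even}
  vOdd : M .vOdd = {v | G.owner v = .odd}
  vPrio : ∀ c, M (.vPrio c) = {v | G.prio v = c}

/-- The sets of the encoding represent the ranking function `f`. -/
structure Encodes {V : Type*} {k d : ℕ} (M : Reg k d → Set V) (f : V → Rank k d) : Prop where
  coord : ∀ i x, M (.C i x) = {v | ∃ b : Tuple k d, f v = b ∧ b.get i = x}
  top : M .Ctop = {v | f v = ⊤}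

end SymbolicParity

namespace SymbolicParity

open Filter

/-! The proof has two halves: what the least ranking function not increased by any lift ("prefixed",
`IsPrefixed`) means for the game, and why the algorithm computes it within the stated bounds.

Meaning. Memoryless determinacy (`splits_of_isArena`, by attractors and induction on the arena)
makes the two winning sets complementary dominions. If `f` is prefixed and `f v ≠ ⊤`, then `odd` can
always move to a successor attaining `best`. If an even priority were the highest recurring one, the
ranks truncated at it would eventually never increase and would drop at each of its occurrences,
which is impossible for finitely many ranks (`not_winsPlay_even`). So `⊤` covers the winning set of
`even`. Conversely, on the winning set of `odd` rank a vertex by the largest result of reading, by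
basic updates, the priorities of a path from its last vertex back to this vertex, where the path
follows the winning strategy of `odd`. A reading that reaches `⊤` contains `2 ^ k` positions such
that between any two of them the greatest priority is even (`exists_evenGaps`). As `n < 2 ^ k`, two
of these carry the same vertex and close a cycle won by `even`, contrary to the choice of the
strategy. This ranking is therefore prefixed and below `⊤` on that set (`exists_isPrefixed`), and
the least prefixed function lies below it.

Computation. The outer loop maintains (`OuterInv`): the current `f` is below every prefixed
function, every attained rank is a key, and every key is active or closed, that is, all consequences
of its upper set have been drawn. The inner loop moves the target down through the keys until all
vertices to be raised are already above it. It activates the targets it passes, since their upper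
sets may grow, and it deletes only keys that no vertex will have as its rank. With no active rank
left, closedness at the key `best f v` for every `v` says that `f` is prefixed.

Costs. Let the potential be the sum of the heights of all ranks, at most `n * |W|`. Each inner
iteration passes a rank that some vertex to be raised had not reached; these ranks are distinct, so
they are paid for by the growth of the potential (`potential_add_missing_le`). Each inner iteration
lengthens the active list by at most one, hence the length of the list minus the potential drops in
every outer iteration. This gives at most `1 + n * |W|` outer iterations with two `Pre` operations
each and at most `n * |W|` inner iterations altogether, while rebuilding or updating a set takes a
number of basic operations of order `k * d`. -/

theorem Player.other_other (z : Player) : z.other.other = z := by cases z <;> rfl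

theorem Player.other_ne (z : Player) : z.other ≠ z := by cases z <;> simp [Player.other]

theorem Player.eq_other_of_ne {y z : Player} (h : y ≠ z) : y = z.other := by
  cases y <;> cases z <;> simp_all [Player.other]

theorem Player.likes_other_iff {z : Player} {c : ℕ} : z.other.Likes c ↔ ¬ z.Likes c := by
  cases z <;> simp [Player.other, Player.Likes]

theorem Player.exists_likes (c : ℕ) : ∃ z : Player, z.Likes c := by
  rcases Nat.even_or_odd c with h | h
  · exact ⟨.even, h⟩
  · exact ⟨.odd, h⟩

/-! ### Memoryless determinacy of finite parity games. -/

namespace ParityGame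

variable {V : Type*} {d : ℕ} {G : ParityGame V d}

/-- Winning a play depends only on its tail. -/
theorem winsPlay_of_shift {z : Player} {ρ : ℕ → V} (N : ℕ)
    (h : G.WinsPlay z fun i => ρ (i + N)) : G.WinsPlay z ρ := by
  have key : ∀ P : V → Prop, (∃ᶠ i in atTop, P (ρ (i + N))) ↔ ∃ᶠ i in atTop, P (ρ i) := by
    intro P
    conv_rhs => rw [← map_add_atTop_eq_nat N, frequently_map]
  obtain ⟨c, hc, hz⟩ := h
  refine ⟨c, ?_, hz⟩
  have : {c' : ℕ | ∃ᶠ i in atTop, (G.prio (ρ (i + N)) : ℕ) = c'} =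
      {c' : ℕ | ∃ᶠ i in atTop, (G.prio (ρ i) : ℕ) = c'} := by
    ext c'
    exact key fun v => (G.prio v : ℕ) = c'
  rwa [this] at hc

theorem not_winsPlay_other {z : Player} {ρ : ℕ → V} (h : G.WinsPlay z ρ) :
    ¬ G.WinsPlay z.other ρ := by
  rintro ⟨c, hc, hz⟩
  obtain ⟨c', hc', hz'⟩ := h
  rw [hc.unique hc'] at hz
  exact Player.likes_other_iff.mp hz hz'

/-- The infinite play `ρ` follows edges and the strategy `σ` of player `z`. -/
structure Follows (G : ParityGame V d) (z : Player) (σ : V → V) (ρ : ℕ → V) : Prop where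
  edge : ∀ i, G.edge (ρ i) (ρ (i + 1))
  strat : ∀ i, G.owner (ρ i) = z → ρ (i + 1) = σ (ρ i)

theorem Follows.shift {z : Player} {σ : V → V} {ρ : ℕ → V} (h : G.Follows z σ ρ) (N : ℕ) :
    G.Follows z σ fun i => ρ (i + N) :=
  ⟨fun i => by have := h.edge (i + N); rwa [add_right_comm] at this,
   fun i hi => by have := h.strat (i + N) hi; rwa [add_right_comm] at this⟩

/-- With the memoryless strategy `σ`, player `z` keeps all plays of the arena `A` from `W` in `W`
and wins them. -/
structure DominionWith (G : ParityGame V d) (z : Player) (A W : Set V) (σ : V → V) : Prop where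
  own : ∀ v ∈ W, G.owner v = z → G.edge v (σ v) ∧ σ v ∈ W
  opp : ∀ v ∈ W, G.owner v ≠ z → ∀ w ∈ A, G.edge v w → w ∈ W
  wins : ∀ ρ : ℕ → V, (∀ i, ρ i ∈ W) → G.Follows z σ ρ → G.WinsPlay z ρ

/-- A dominion of player `z` in the arena `A`. -/
def IsDominion (G : ParityGame V d) (z : Player) (A W : Set V) : Prop :=
  W ⊆ A ∧ ∃ σ, G.DominionWith z A W σ

/-- Every vertex of `A` has a successor in `A`. -/
def IsArena (G : ParityGame V d) (A : Set V) : Prop := ∀ v ∈ A, ∃ w ∈ A, G.edge v w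

/-- The arena `A` splits into dominions of the two players. -/
def Splits (G : ParityGame V d) (z : Player) (A : Set V) : Prop :=
  ∃ W W', G.IsDominion z A W ∧ G.IsDominion z.other A W' ∧ W ∪ W' = A

theorem Splits.symm {z : Player} {A : Set V} (h : G.Splits z.other A) : G.Splits z A := by
  obtain ⟨W, W', h, h', hu⟩ := h
  rw [Player.other_other] at h'
  exact ⟨W', W, h', h, by rw [Set.union_comm, hu]⟩

open Classical in
/-- A dominion can be extended by a vertex from which the player can force the play into it. -/
theorem IsDominion.insert {z : Player} {A W : Set V} (h : G.IsDominion z A W) {v : V}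
    (hv : v ∈ A) (hvW : v ∉ W)
    (hf : (G.owner v = z ∧ ∃ w ∈ W, G.edge v w) ∨
      (G.owner v ≠ z ∧ ∀ w ∈ A, G.edge v w → w ∈ W)) :
    G.IsDominion z A (insert v W) := by
  obtain ⟨hWA, σ, hσ⟩ := h
  obtain ⟨w₀, hw₀⟩ : ∃ w₀, G.owner v = z → w₀ ∈ W ∧ G.edge v w₀ := by
    rcases hf with ⟨_, w, hw, he⟩ | ⟨ho, _⟩
    · exact ⟨w, fun _ => ⟨hw, he⟩⟩
    · exact ⟨v, fun h => absurd h ho⟩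
  have hne : ∀ u ∈ W, u ≠ v := fun u hu e => hvW (e ▸ hu)
  have hstay : ∀ ρ : ℕ → V, (∀ i, ρ i ∈ A) → G.Follows z (Function.update σ v w₀) ρ →
      ∀ i, ρ i ∈ W → ρ (i + 1) ∈ W := by
    intro ρ hρ hf i hi
    by_cases ho : G.owner (ρ i) = z
    · rw [hf.strat i ho, Function.update_of_ne (hne _ hi)]
      exact (hσ.own _ hi ho).2
    · exact hσ.opp _ hi ho _ (hρ _) (hf.edge i)
  refine ⟨Set.insert_subset hv hWA, Function.update σ v w₀, ?_, ?_, ?_⟩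
  · rintro u (rfl | hu) ho
    · rw [Function.update_self]
      exact ⟨(hw₀ ho).2, Or.inr (hw₀ ho).1⟩
    · rw [Function.update_of_ne (hne u hu)]
      exact ⟨(hσ.own u hu ho).1, Or.inr (hσ.own u hu ho).2⟩
  · rintro u (rfl | hu) ho w hw he
    · rcases hf with ⟨h, _⟩ | ⟨_, h⟩
      · exact absurd h ho
      · exact Or.inr (h w hw he)
    · exact Or.inr (hσ.opp u hu ho w hw he)
  · intro ρ hρ hfol
    have hρA : ∀ i, ρ i ∈ A := fun i => Set.insert_subset hv hWA (hρ i)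
    have h1 : ρ 1 ∈ W := by
      rcases hρ 0 with h0 | h0
      · by_cases ho : G.owner (ρ 0) = z
        · rw [hfol.strat 0 ho, h0, Function.update_self]
          exact (hw₀ (h0 ▸ ho)).1
        · rcases hf with ⟨h, _⟩ | ⟨_, h⟩
          · exact absurd h (h0 ▸ ho)
          · exact h _ (hρA 1) (h0 ▸ hfol.edge 0)
      · exact hstay ρ hρA hfol 0 h0
    have hall : ∀ i, ρ (i + 1) ∈ W := by
      intro i
      induction i with
      | zero => exact h1
      | succ i ih => exact hstay ρ hρA hfol _ ih
    refine winsPlay_of_shift 1 (hσ.wins _ hall ⟨(hfol.shift 1).edge, fun i hi => ?_⟩)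
    have := (hfol.shift 1).strat i hi
    rwa [Function.update_of_ne (hne _ (hall i))] at this

open Classical in
/-- A dominion of the arena without a given dominion can be added to the latter. -/
theorem IsDominion.union {z : Player} {A W W' : Set V} (h : G.IsDominion z A W)
    (h' : G.IsDominion z (A \ W) W') : G.IsDominion z A (W ∪ W') := by
  obtain ⟨hWA, σ, hσ⟩ := h
  obtain ⟨hWA', σ', hσ'⟩ := h'
  have hd : ∀ v ∈ W', v ∉ W := fun v hv => (hWA' hv).2
  refine ⟨Set.union_subset hWA (hWA'.trans Set.sdiff_subset),
    fun v => if v ∈ W then σ v else σ' v, ?_, ?_, ?_⟩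
  · rintro v (hv | hv) ho
    · rw [if_pos hv]
      exact ⟨(hσ.own v hv ho).1, Or.inl (hσ.own v hv ho).2⟩
    · rw [if_neg (hd v hv)]
      exact ⟨(hσ'.own v hv ho).1, Or.inr (hσ'.own v hv ho).2⟩
  · rintro v (hv | hv) ho w hw he
    · exact Or.inl (hσ.opp v hv ho w hw he)
    · by_cases hwW : w ∈ W
      · exact Or.inl hwW
      · exact Or.inr (hσ'.opp v hv ho w ⟨hw, hwW⟩ he)
  · intro ρ hρ hfol
    have hρA : ∀ i, ρ i ∈ A := fun i => (Set.union_subset hWA (hWA'.trans Set.sdiff_subset)) (hρ i)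
    -- A play that meets `W` stays there and is won by `σ`; a play that never does lives in `W'` and
    -- follows `σ'`.
    by_cases hex : ∃ N, ρ N ∈ W
    · obtain ⟨N, hN⟩ := hex
      have hall : ∀ i, ρ (i + N) ∈ W := by
        intro i
        induction i with
        | zero => simpa using hN
        | succ i ih =>
          rw [add_right_comm]
          by_cases ho : G.owner (ρ (i + N)) = z
          · rw [hfol.strat _ ho, if_pos ih]
            exact (hσ.own _ ih ho).2
          · exact hσ.opp _ ih ho _ (hρA _) (hfol.edge _)
      refine winsPlay_of_shift N (hσ.wins _ hall ⟨(hfol.shift N).edge, fun i hi => ?_⟩)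
      have := (hfol.shift N).strat i hi
      rwa [if_pos (hall i)] at this
    · push Not at hex
      refine hσ'.wins ρ (fun i => (hρ i).resolve_left (hex i)) ⟨hfol.edge, fun i hi => ?_⟩
      have := hfol.strat i hi
      rwa [if_neg (hex i)] at this

theorem isDominion_empty (z : Player) (A : Set V) : G.IsDominion z A ∅ :=
  ⟨Set.empty_subset _, id, fun _ h => h.elim, fun _ h => h.elim, fun _ h => (h 0).elim⟩

/-- If the largest dominion of player `z` is not empty, then the arena can be split by splitting the
rest of it. -/
theorem splits_of_maximal_isDominion {z : Player} {A W : Set V} (hA : G.IsArena A)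
    (hW : Maximal (G.IsDominion z A) W) (ih : G.IsArena (A \ W) → G.Splits z (A \ W)) :
    G.Splits z A := by
  have hnot : ∀ v ∈ A, v ∉ W → ¬ ((G.owner v = z ∧ ∃ w ∈ W, G.edge v w) ∨
      (G.owner v ≠ z ∧ ∀ w ∈ A, G.edge v w → w ∈ W)) := fun v hv hvW hf =>
    hvW (hW.le_of_ge (hW.prop.insert hv hvW hf) (Set.subset_insert v W) (Set.mem_insert v W))
  have hown : ∀ v ∈ A, v ∉ W → G.owner v = z → ∀ w, G.edge v w → w ∉ W :=
    fun v hv hvW ho w he hw => hnot v hv hvW (Or.inl ⟨ho, w, hw, he⟩)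
  obtain ⟨U, U', hU, hU', hUU⟩ := ih fun v ⟨hv, hvW⟩ => by
    by_cases ho : G.owner v = z
    · obtain ⟨w, hw, he⟩ := hA v hv
      exact ⟨w, ⟨hw, hown v hv hvW ho w he⟩, he⟩
    · by_contra! hc
      refine hnot v hv hvW (Or.inr ⟨ho, fun w hw he => ?_⟩)
      by_contra hwW
      exact hc w ⟨hw, hwW⟩ he
  -- By maximality `W` absorbs `U`, although the two are disjoint; so `U` is empty and the opponent
  -- owns the whole rest.
  have hsub : U ⊆ W := fun v hv =>
    hW.le_of_ge (hW.prop.union hU) Set.subset_union_left (Or.inr hv)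
  have hU'eq : U' = A \ W := by
    rw [← hUU]
    refine (Set.union_eq_right.mpr fun v hv => ?_).symm
    exact absurd (hsub hv) (hU.1 hv).2
  subst hU'eq
  refine ⟨W, A \ W, hW.prop, ?_, by simpa using hW.prop.1⟩
  obtain ⟨_, σ, hσ⟩ := hU'
  refine ⟨Set.sdiff_subset, σ, hσ.own, fun v hv ho w hw he => ?_, hσ.wins⟩
  have : G.owner v = z := by
    rw [Player.eq_other_of_ne ho, Player.other_other]
  exact ⟨hw, hown v hv.1 hv.2 this w he⟩

/-- From every vertex of `Y` player `z` can force a visit to `X ⊆ Y` with the strategy `σ`; the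
number of remaining steps decreases along `rk`. -/
structure AttractsWith (G : ParityGame V d) (z : Player) (A X Y : Set V) (σ : V → V)
    (rk : V → ℕ) : Prop where
  own : ∀ v ∈ Y, v ∉ X → G.owner v = z → G.edge v (σ v) ∧ σ v ∈ Y ∧ rk (σ v) < rk v
  opp : ∀ v ∈ Y, v ∉ X → G.owner v ≠ z → ∀ w ∈ A, G.edge v w → w ∈ Y ∧ rk w < rk v

open Classical in
/-- The attractor of a set. -/
theorem exists_attractor [Finite V] (G : ParityGame V d) (z : Player) {A X : Set V} (hX : X ⊆ A) :
    ∃ Y σ rk, X ⊆ Y ∧ Y ⊆ A ∧ G.AttractsWith z A X Y σ rk ∧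
      (∀ v ∈ A, v ∉ Y → G.owner v = z → ∀ w ∈ Y, ¬ G.edge v w) ∧
      (∀ v ∈ A, v ∉ Y → G.owner v ≠ z → ∃ w ∈ A, w ∉ Y ∧ G.edge v w) := by
  -- A maximal set with an attracting strategy replaces the usual construction in stages: any vertex
  -- that can be forced into it could be added.
  obtain ⟨Y, ⟨hXY, hYA, σ, rk, hY⟩, hmax⟩ :=
    (Set.toFinite {Y | X ⊆ Y ∧ Y ⊆ A ∧ ∃ σ rk, G.AttractsWith z A X Y σ rk}).exists_maximal
      ⟨X, subset_rfl, hX, id, fun _ => 0, fun v h h' => absurd h h', fun v h h' => absurd h h'⟩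
  have hnot : ∀ v ∈ A, v ∉ Y → ¬ ((G.owner v = z ∧ ∃ w ∈ Y, G.edge v w) ∨
      (G.owner v ≠ z ∧ ∀ w ∈ A, G.edge v w → w ∈ Y)) := by
    intro v hv hvY hf
    obtain ⟨w₀, hw₀⟩ : ∃ w₀, G.owner v = z → w₀ ∈ Y ∧ G.edge v w₀ := by
      rcases hf with ⟨_, w, hw, he⟩ | ⟨ho, _⟩
      · exact ⟨w, fun _ => ⟨hw, he⟩⟩
      · exact ⟨v, fun h => absurd h ho⟩
    have hne : ∀ u ∈ Y, u ≠ v := fun u hu e => hvY (e ▸ hu)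
    -- The added vertex gets the value `m + 1`, above all existing ones, so every step from it into
    -- `Y` decreases the rank.
    obtain ⟨m, hm⟩ := (Set.toFinite (Set.range rk)).bddAbove
    have hm : ∀ u, rk u < m + 1 := fun u => Nat.lt_succ_of_le (hm ⟨u, rfl⟩)
    refine hvY (hmax (y := insert v Y) ⟨hXY.trans (Set.subset_insert v Y),
      Set.insert_subset hv hYA, Function.update σ v w₀, Function.update rk v (m + 1), ?_, ?_⟩
      (Set.subset_insert v Y) (Set.mem_insert v Y))
    · rintro u (rfl | hu) huX ho
      · have h := hw₀ ho
        rw [Function.update_self, Function.update_self, Function.update_of_ne (hne _ h.1)]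
        exact ⟨h.2, Or.inr h.1, hm _⟩
      · have h := hY.own u hu huX ho
        rw [Function.update_of_ne (hne u hu), Function.update_of_ne (hne u hu),
          Function.update_of_ne (hne _ h.2.1)]
        exact ⟨h.1, Or.inr h.2.1, h.2.2⟩
    · rintro u (rfl | hu) huX ho w hw he
      · have h : w ∈ Y := by
          rcases hf with ⟨h, _⟩ | ⟨_, h⟩
          · exact absurd h ho
          · exact h w hw he
        rw [Function.update_self, Function.update_of_ne (hne _ h)]
        exact ⟨Or.inr h, hm _⟩
      · have h := hY.opp u hu huX ho w hw he
        rw [Function.update_of_ne (hne u hu), Function.update_of_ne (hne _ h.1)]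
        exact ⟨Or.inr h.1, h.2⟩
  refine ⟨Y, σ, rk, hXY, hYA, hY, fun v hv hvY ho w hw he =>
    hnot v hv hvY (Or.inl ⟨ho, w, hw, he⟩), fun v hv hvY ho => ?_⟩
  by_contra! hc
  refine hnot v hv hvY (Or.inr ⟨ho, fun w hw he => ?_⟩)
  by_contra hwY
  exact hc w hw hwY he

open Classical in
/-- If the highest priority of an arena is good for `z` and the opponent has no dominion, then `z`
wins everywhere. -/
theorem isDominion_self [Finite V] {z : Player} {A : Set V} (hA : G.IsArena A) {p : ℕ}
    (hp : ∀ v ∈ A, (G.prio v : ℕ) ≤ p) (hpz : z.Likes p) (hpA : ∃ v ∈ A, (G.prio v : ℕ) = p)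
    (hno : ∀ W, G.IsDominion z.other A W → W = ∅)
    (ih : ∀ B, B ⊂ A → G.IsArena B → G.Splits z B) : G.IsDominion z A A := by
  obtain ⟨Y, τ, rk, hXY, hYA, hY, hYown, hYopp⟩ :=
    exists_attractor G z (A := A) (X := {v ∈ A | (G.prio v : ℕ) = p}) (Set.sep_subset _ _)
  set X := {v ∈ A | (G.prio v : ℕ) = p} with hXdef
  have hB : G.IsArena (A \ Y) := by
    rintro v ⟨hv, hvY⟩
    by_cases ho : G.owner v = z
    · obtain ⟨w, hw, he⟩ := hA v hv
      exact ⟨w, ⟨hw, fun hwY => hYown v hv hvY ho w hwY he⟩, he⟩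
    · obtain ⟨w, hw, hwY, he⟩ := hYopp v hv hvY ho
      exact ⟨w, ⟨hw, hwY⟩, he⟩
  obtain ⟨U, U', hU, ⟨hU'B, σ', hσ'⟩, hUU⟩ := ih (A \ Y) (by
    obtain ⟨v, hv, hvp⟩ := hpA
    exact ⟨Set.sdiff_subset, fun h => (h hv).2 (hXY ⟨hv, hvp⟩)⟩) hB
  -- Vertices of `z` outside of the attractor have no edge into it, so a dominion of the opponent in
  -- `A \ Y` is one in `A`.
  have hU' : U' = ∅ := hno U' ⟨hU'B.trans Set.sdiff_subset, σ', hσ'.own, fun v hv ho w hw he => by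
    have : G.owner v = z := by rw [Player.eq_other_of_ne ho, Player.other_other]
    exact hσ'.opp v hv ho w
      ⟨hw, fun hwY => hYown v (hU'B hv).1 (hU'B hv).2 this w hwY he⟩ he, hσ'.wins⟩
  rw [hU', Set.union_empty] at hUU
  subst hUU
  obtain ⟨_, σ, hσ⟩ := hU
  have hch : ∀ v, ∃ w, v ∈ A → w ∈ A ∧ G.edge v w := fun v => by
    by_cases hv : v ∈ A
    · obtain ⟨w, hw⟩ := hA v hv
      exact ⟨w, fun _ => hw⟩
    · exact ⟨v, fun h => absurd h hv⟩
  choose κ hκ using hch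
  refine ⟨subset_rfl, fun v => if v ∈ X then κ v else if v ∈ Y then τ v else σ v, ?_,
    fun v _ _ w hw _ => hw, ?_⟩
  · intro v hv ho
    by_cases hvX : v ∈ X
    · rw [if_pos hvX]
      exact ⟨(hκ v hv).2, (hκ v hv).1⟩
    · by_cases hvY : v ∈ Y
      · rw [if_neg hvX, if_pos hvY]
        exact ⟨(hY.own v hvY hvX ho).1, hYA (hY.own v hvY hvX ho).2.1⟩
      · rw [if_neg hvX, if_neg hvY]
        exact ⟨(hσ.own v ⟨hv, hvY⟩ ho).1, (hσ.own v ⟨hv, hvY⟩ ho).2.1⟩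
  · intro ρ hρ hfol
    by_cases hinf : ∃ᶠ i in atTop, ρ i ∈ X
    · refine ⟨p, ⟨hinf.mono fun i hi => hi.2, fun c hc => ?_⟩, hpz⟩
      obtain ⟨i, hi⟩ := hc.exists
      exact hi ▸ hp _ (hρ i)
    · rw [not_frequently, eventually_atTop] at hinf
      obtain ⟨N, hN⟩ := hinf
      -- Inside `Y` the attracting strategy would lower `rk` at every step until `X` is visited,
      -- which no longer happens after `N`.
      have hNY : ∀ i ≥ N, ρ i ∉ Y := by
        have : ∀ m i, N ≤ i → rk (ρ i) = m → ρ i ∉ Y := by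
          intro m
          induction m using Nat.strong_induction_on with
          | _ m ihm =>
            intro i hi hm hiY
            have hstep : ρ (i + 1) ∈ Y ∧ rk (ρ (i + 1)) < rk (ρ i) := by
              by_cases ho : G.owner (ρ i) = z
              · have := hfol.strat i ho
                rw [if_neg (hN i hi), if_pos hiY] at this
                rw [this]
                exact (hY.own _ hiY (hN i hi) ho).2
              · exact hY.opp _ hiY (hN i hi) ho _ (hρ _) (hfol.edge i)
            exact ihm _ (hm ▸ hstep.2) (i + 1) (by omega) rfl hstep.1
        exact fun i hi => this _ i hi rfl
      have hall : ∀ i, ρ (i + N) ∉ Y := fun i => hNY _ (by omega)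
      refine winsPlay_of_shift N (hσ.wins _ (fun i => ⟨hρ _, hall i⟩)
        ⟨(hfol.shift N).edge, fun i hi => ?_⟩)
      have := (hfol.shift N).strat i hi
      rwa [if_neg (fun h => hall i (hXY h)), if_neg (hall i)] at this

/-- Memoryless determinacy of finite parity games. -/
theorem splits_of_isArena [Finite V] (G : ParityGame V d) (z : Player) (A : Set V)
    (hA : G.IsArena A) : G.Splits z A := by
  induction hm : A.ncard using Nat.strong_induction_on generalizing A z with
  | _ m ih =>
    have ih : ∀ z B, B ⊂ A → G.IsArena B → G.Splits z B := fun z B hBA hB =>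
      ih _ (hm ▸ Set.ncard_lt_ncard hBA) z B hB rfl
    by_cases hne : ∃ z W, G.IsDominion z A W ∧ W ≠ ∅
    · have key : ∀ z, (∃ W, G.IsDominion z A W ∧ W ≠ ∅) → G.Splits z A := by
        rintro z ⟨W', hW', hne⟩
        obtain ⟨W, hWW, hW⟩ :=
          (Set.toFinite {W | G.IsDominion z A W}).exists_le_maximal hW'
        obtain ⟨v, hv⟩ := Set.nonempty_iff_ne_empty.mpr hne
        exact splits_of_maximal_isDominion hA hW
          (ih z _ ⟨Set.sdiff_subset, fun h => (h (hW'.1 hv)).2 (hWW hv)⟩)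
      obtain ⟨y, hy⟩ := hne
      by_cases hyz : y = z
      · exact hyz ▸ key y hy
      · exact Splits.symm (Player.eq_other_of_ne hyz ▸ key y hy)
    · push Not at hne
      rcases A.eq_empty_or_nonempty with rfl | hAne
      · exact ⟨∅, ∅, isDominion_empty _ _, isDominion_empty _ _, Set.union_empty _⟩
      -- If neither player had a nonempty dominion, the player who likes the highest priority of `A`
      -- would win on all of `A`, a contradiction.
      · obtain ⟨u, hu, hmax⟩ := Set.exists_max_image A (fun v => (G.prio v : ℕ))
          (Set.toFinite A) hAne
        obtain ⟨y, hy⟩ := Player.exists_likes (G.prio u)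
        have := hne y A (isDominion_self hA hmax hy ⟨u, hu, rfl⟩ (hne _) (ih y))
        exact absurd this hAne.ne_empty

/-- A dominion strategy beats every play that respects it, in particular those of memoryless
opponents. Outside of `W` any legal move completes it to a strategy on all of `V`. -/
theorem dominion_subset_winningSet {z : Player} {W : Set V}
    (h : G.IsDominion z Set.univ W) : W ⊆ G.winningSet z := by
  classical
  obtain ⟨_, σ, hσ⟩ := h
  choose κ hκ using G.total
  intro s hs
  refine ⟨fun v => if v ∈ W then σ v else κ v, fun v hv => ?_, fun τ hτ => ?_⟩
  · by_cases hvW : v ∈ W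
    · simpa [hvW] using (hσ.own v hvW hv).1
    · simpa [hvW] using hκ v
  · set ρ := G.play z (fun v => if v ∈ W then σ v else κ v) τ s with hρdef
    have hstep : ∀ i, ρ (i + 1) = G.next z (fun v => if v ∈ W then σ v else κ v) τ (ρ i) :=
      fun i => Function.iterate_succ_apply' _ _ _
    have hedge : ∀ v, v ∈ W → G.owner v ≠ z → G.edge v (τ v) := fun v _ ho =>
      hτ v (Player.eq_other_of_ne ho)
    have hall : ∀ i, ρ i ∈ W := by
      intro i
      induction i with
      | zero => exact hs
      | succ i ih =>
        rw [hstep]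
        by_cases ho : G.owner (ρ i) = z
        · simpa [next, ho, ih] using (hσ.own _ ih ho).2
        · simpa [next, ho] using hσ.opp _ ih ho _ trivial (hedge _ ih ho)
    refine hσ.wins ρ hall ⟨fun i => ?_, fun i ho => ?_⟩
    · rw [hstep]
      by_cases ho : G.owner (ρ i) = z
      · simpa [next, ho, hall i] using (hσ.own _ (hall i) ho).1
      · simpa [next, ho] using hedge _ (hall i) ho
    · rw [hstep]
      simp [next, ho, hall i]

theorem play_other {z : Player} {σ τ : V → V} (s : V) :
    G.play z.other τ σ s = G.play z σ τ s := by
  have : G.next z.other τ σ = G.next z σ τ := by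
    funext v
    by_cases ho : G.owner v = z
    · have h : G.owner v ≠ z.other := fun h => Player.other_ne z (h.symm.trans ho)
      rw [next, next, if_neg h, if_pos ho]
    · have h : G.owner v = z.other := Player.eq_other_of_ne ho
      rw [next, next, if_pos h, if_neg ho]
  funext i
  simp [play, this]

/-- Two memoryless strategies determine a single play, and its highest recurring priority has only
one parity. -/
theorem disjoint_winningSet (G : ParityGame V d) (z : Player) :
    Disjoint (G.winningSet z) (G.winningSet z.other) := by
  rw [Set.disjoint_left]
  rintro s ⟨σ, hσ, hw⟩ ⟨τ, hτ, hw'⟩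
  refine not_winsPlay_other (hw τ hτ) ?_
  rw [← play_other]
  exact hw' σ (by rwa [Player.other_other])

/-- The winning sets of the two players are complementary dominions. -/
theorem winningSet_isDominion [Finite V] (G : ParityGame V d) :
    G.IsDominion .even Set.univ (G.winningSet .even) ∧
    G.IsDominion .odd Set.univ (G.winningSet .odd) ∧
    (G.winningSet .even)ᶜ = G.winningSet .odd := by
  obtain ⟨W, W', hW, hW', hu⟩ := splits_of_isArena G .even Set.univ
    (fun v _ => by obtain ⟨w, hw⟩ := G.total v; exact ⟨w, trivial, hw⟩)
  have hd := G.disjoint_winningSet .even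
  have h1 := dominion_subset_winningSet hW
  have h2 := dominion_subset_winningSet hW'
  rw [Set.disjoint_left] at hd
  have e1 : W = G.winningSet .even := h1.antisymm fun v hv =>
    (hu.ge (Set.mem_univ v)).resolve_right fun hv' => hd hv (h2 hv')
  have e2 : W' = G.winningSet .odd := h2.antisymm fun v hv =>
    (hu.ge (Set.mem_univ v)).resolve_left fun hv' => hd (h1 hv') hv
  rw [← e1, ← e2]
  refine ⟨hW, hW', Set.ext fun v => ⟨fun hv => (hu.ge (Set.mem_univ v)).resolve_left hv,
    fun hv hv' => ?_⟩⟩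
  exact hd (h1 hv') (h2 hv)

end ParityGame

/-! ## Ranks and the lift function -/

section Ranks

variable {k d : ℕ}

theorem Entry.lt_iff_key {x y : Entry d} : x < y ↔ key x < key y := Iff.rfl

theorem Tuple.lt_iff {a b : Tuple k d} :
    a < b ↔ ∃ i, (∀ j < i, a.get j = b.get j) ∧ a.get i < b.get i := Iff.rfl

theorem Tuple.ext_get {a b : Tuple k d} (h : ∀ i, a.get i = b.get i) : a = b :=
  Subtype.ext (funext h)

theorem Tuple.get_bot (i : Fin k) : (⊥ : Tuple k d).get i = .blank := rfl

theorem updTuple_eq_top {b : Tuple k d} {c : Fin d}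
    (h : Even (c : ℕ) ∧ ∀ i, (b.get i).IsEven) : updTuple b c = ⊤ := if_pos h

theorem updTuple_slot {b : Tuple k d} {c : Fin d} (h : ¬ (Even (c : ℕ) ∧ ∀ i, (b.get i).IsEven))
    (hs : ∃ i, IsSlot b.get c i) :
    ∃ (i : Fin k) (t : Tuple k d), IsSlot b.get c i ∧ t.get = overwrite b.get c i ∧
      updTuple b c = t := by
  refine ⟨hs.choose, Tuple.mk _ (nonincreasing_overwrite b.2 hs.choose_spec), hs.choose_spec,
    rfl, ?_⟩
  rw [updTuple, if_neg h, dif_pos hs]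
  rfl

theorem updTuple_no_slot {b : Tuple k d} {c : Fin d}
    (h : ¬ (Even (c : ℕ) ∧ ∀ i, (b.get i).IsEven)) (hs : ¬ ∃ i, IsSlot b.get c i) :
    updTuple b c = b := by
  rw [updTuple, if_neg h, dif_neg hs]

theorem exists_isSlot {b : Fin k → Entry d} {c : Fin d} {i : Fin k} (h : Replaceable b c i) :
    ∃ j, IsSlot b c j := by
  classical
  induction i using WellFoundedLT.induction with
  | _ i ih =>
    by_cases hj : ∃ j < i, Replaceable b c j
    · obtain ⟨j, hji, hj⟩ := hj
      exact ih j hji hj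
    · push Not at hj
      exact ⟨i, h, hj⟩

/-- The least significant entry that is not even is replaceable: all entries after it are even. -/
theorem exists_isSlot_of_even {b : Fin k → Entry d} {c : Fin d} (hc : Even (c : ℕ))
    (h : ∃ i, ¬ (b i).IsEven) : ∃ j, IsSlot b c j := by
  classical
  obtain ⟨i, hi, hmax⟩ := Set.exists_max_image {i | ¬ (b i).IsEven} id (Set.toFinite _) h
  refine exists_isSlot (i := i) (Or.inr ⟨hc, hi, fun j hj => ?_⟩)
  by_contra hne
  exact absurd (hmax j hne) (not_le.mpr hj)

theorem lift_mono {r r' : Rank k d} (h : r ≤ r') (c : Fin d) : lift r c ≤ lift r' c :=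
  Finset.inf_mono fun q hq => by
    simp only [Finset.mem_filter, Finset.mem_univ, true_and] at hq ⊢
    exact h.trans hq

theorem lift_le_upd (r : Rank k d) (c : Fin d) : lift r c ≤ upd r c :=
  Finset.inf_le (by simp)

theorem exists_lift_eq (r : Rank k d) (c : Fin d) : ∃ q, r ≤ q ∧ lift r c = upd q c := by
  obtain ⟨q, hq, h⟩ := Finset.exists_mem_eq_inf
    (Finset.univ.filter (fun q : Rank k d => r ≤ q)) ⟨r, by simp⟩ (fun q => upd q c)
  exact ⟨q, by simpa using hq, h⟩

/-! ### Progress along even priorities -/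

open Classical in
/-- The keys of the entries, where the entries below `c` are identified and everything after the
first of them is erased. -/
noncomputable def truncate (c : Fin d) (b : Fin k → Entry d) (i : Fin k) : ℤ :=
  if ∃ j ≤ i, (b j).IsBelow c then 0 else (b i).key

theorem truncate_congr {c : Fin d} {b b' : Fin k → Entry d} {m : Fin k}
    (h : ∀ j ≤ m, b j = b' j) : truncate c b m = truncate c b' m := by
  by_cases he : ∃ j ≤ m, (b j).IsBelow c
  · obtain ⟨j, hj, hb⟩ := he
    rw [truncate, truncate, if_pos ⟨j, hj, hb⟩, if_pos ⟨j, hj, h j hj ▸ hb⟩]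
  · rw [truncate, truncate, if_neg he, if_neg, h m le_rfl]
    rintro ⟨j, hj, hb⟩
    exact he ⟨j, hj, h j hj ▸ hb⟩

theorem truncate_of_isBelow {c : Fin d} {b : Fin k → Entry d} {i : Fin k}
    (hi : (b i).IsBelow c) : truncate c b i = 0 := if_pos ⟨i, le_rfl, hi⟩

theorem truncate_of_not_isBelow {c : Fin d} {b : Fin k → Entry d} {i : Fin k}
    (h : ∀ j < i, ¬ (b j).IsBelow c) (hi : ¬ (b i).IsBelow c) : truncate c b i = (b i).key := by
  refine if_neg ?_
  rintro ⟨j, hj, hb⟩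
  rcases hj.eq_or_lt with rfl | hj
  · exact hi hb
  · exact h j hj hb

/-- From the first entry below `c` on, the truncation is constantly 0, so it forgets which entry
that was and what follows. -/
theorem truncate_eq_of_isBelow {c : Fin d} {b b' : Fin k → Entry d} {i : Fin k}
    (h : ∀ j < i, b j = b' j) (hi : (b i).IsBelow c) (hi' : (b' i).IsBelow c) :
    truncate c b = truncate c b' := by
  funext m
  by_cases hm : m < i
  · exact truncate_congr fun j hj => h j (hj.trans_lt hm)
  · rw [truncate, truncate, if_pos ⟨i, not_lt.mp hm, hi⟩, if_pos ⟨i, not_lt.mp hm, hi'⟩]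

/-- The keys of priorities below `c` lie strictly between `-c` and `c`, while those of all other
entries, blanks included, do not. This is why replacing the former by 0 respects the order. -/
theorem Entry.key_of_isBelow {c : Fin d} {x : Entry d} (h : x.IsBelow c) :
    -(c : ℤ) < x.key ∧ x.key < c := by
  rcases x with _ | x
  · exact h.elim
  · have h : (x : ℕ) < c := h
    simp only [key]
    split_ifs <;> omega

theorem Entry.key_of_not_isBelow {c : Fin d} {x : Entry d} (h : ¬ x.IsBelow c) :
    x.key ≤ -(c : ℤ) ∨ (c : ℤ) ≤ x.key := by
  rcases x with _ | x
  · have := c.2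
    simp only [key]
    omega
  · have h : ¬ (x : ℕ) < c := h
    simp only [key]
    split_ifs <;> omega

theorem Entry.key_neg {x : Entry d} (h : ¬ x.IsEven) : x.key < 0 := by
  rcases x with _ | x
  · simp only [key]
    omega
  · have h : ¬ Even (x : ℕ) := h
    simp only [key, if_neg h]
    grind

theorem Entry.key_col_even {c : Fin d} (h : Even (c : ℕ)) : (col c).key = c := if_pos h

/-- If the tuples agree before `i` and the entry grows at `i`, then the truncation does not
decrease; it grows if one of the entries is not below `c`. -/
theorem truncate_le_of_lt {c : Fin d} {b b' : Fin k → Entry d} {i : Fin k}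
    (h : ∀ j < i, b j = b' j) (hi : b i < b' i) :
    toLex (truncate c b) ≤ toLex (truncate c b') := by
  by_cases hex : ∃ j < i, (b j).IsBelow c
  · obtain ⟨j, hj, hb⟩ := hex
    exact (congrArg toLex (truncate_eq_of_isBelow (fun m hm => h m (hm.trans hj)) hb
      (h j hj ▸ hb))).le
  by_cases hboth : (b i).IsBelow c ∧ (b' i).IsBelow c
  · exact (congrArg toLex (truncate_eq_of_isBelow h hboth.1 hboth.2)).le
  refine le_of_lt ⟨i, fun j hj => ?_, ?_⟩
  · exact truncate_congr fun m hm => h m (hm.trans_lt hj)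
  · have hn : ∀ j < i, ¬ (b j).IsBelow c := fun j hj hb => hex ⟨j, hj, hb⟩
    have hn' : ∀ j < i, ¬ (b' j).IsBelow c := fun j hj => h j hj ▸ hn j hj
    rw [Entry.lt_iff_key] at hi
    change truncate c b i < truncate c b' i
    by_cases h1 : (b i).IsBelow c
    · have h2 : ¬ (b' i).IsBelow c := fun h2 => hboth ⟨h1, h2⟩
      rw [truncate_of_isBelow h1, truncate_of_not_isBelow hn' h2]
      have := Entry.key_of_isBelow h1
      have := Entry.key_of_not_isBelow h2
      omega
    · rw [truncate_of_not_isBelow hn h1]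
      by_cases h2 : (b' i).IsBelow c
      · rw [truncate_of_isBelow h2]
        have := Entry.key_of_not_isBelow h1
        have := Entry.key_of_isBelow h2
        omega
      · rwa [truncate_of_not_isBelow hn' h2]

/-- At `i` the larger entry retains its key. The smaller one retains its smaller key or becomes 0,
and 0 lies in the gap between `-c` and `c` that the larger key avoids. -/
theorem truncate_lt_of_not_isBelow {c : Fin d} {b b' : Fin k → Entry d} {i : Fin k}
    (h : ∀ j < i, b j = b' j) (hj : ∀ j < i, ¬ (b j).IsBelow c)
    (hi : b i < b' i) (hb' : ¬ (b' i).IsBelow c) :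
    toLex (truncate c b) < toLex (truncate c b') := by
  refine lt_of_le_of_ne (truncate_le_of_lt h hi) fun he => ?_
  have he : truncate c b i = truncate c b' i := congrFun (toLex.injective he) i
  have hn' : ∀ j < i, ¬ (b' j).IsBelow c := fun m hm => h m hm ▸ hj m hm
  rw [truncate_of_not_isBelow hn' hb'] at he
  rw [Entry.lt_iff_key] at hi
  have := Entry.key_of_not_isBelow hb'
  by_cases h1 : (b i).IsBelow c
  · have := Entry.key_of_isBelow h1
    rw [truncate_of_isBelow h1] at he
    omega
  · rw [truncate_of_not_isBelow hj h1] at he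
    omega

theorem overwrite_of_lt {b : Fin k → Entry d} {c : Fin d} {i j : Fin k} (h : j < i) :
    overwrite b c i j = b j := if_pos h

theorem overwrite_self (b : Fin k → Entry d) (c : Fin d) (i : Fin k) :
    overwrite b c i i = .col c := by simp [overwrite]

theorem overwrite_of_gt {b : Fin k → Entry d} {c : Fin d} {i j : Fin k} (h : i < j) :
    overwrite b c i j = .blank := by simp [overwrite, h.not_gt, h.ne']

/-- The truncation of ranks. -/
noncomputable def truncateRank (c : Fin d) (r : Rank k d) : WithTop (Lex (Fin k → ℤ)) :=
  WithTop.map (fun b : Tuple k d => toLex (truncate c b.get)) r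

theorem truncateRank_mono (c : Fin d) : Monotone (truncateRank (k := k) c) := by
  refine Monotone.withTop_map fun a b hab => ?_
  rcases hab.eq_or_lt with rfl | hab
  · exact le_rfl
  · obtain ⟨i, h, hi⟩ := Tuple.lt_iff.mp hab
    exact truncate_le_of_lt h hi

/-- An overwritten smaller priority stays below `c` if `c' < c`, so the truncation does not notice.
If `c' = c`, or if a non-even entry is replaced by an even one, the entry grows. -/
theorem truncateRank_le_upd {c c' : Fin d} (hc : Even (c : ℕ)) (hcc : c' ≤ c) (r : Rank k d) :
    truncateRank c r ≤ truncateRank c (upd r c') := by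
  induction r using WithTop.recTopCoe with
  | top => exact le_rfl
  | coe b =>
    change _ ≤ truncateRank c (updTuple b c')
    by_cases ht : Even (c' : ℕ) ∧ ∀ i, (b.get i).IsEven
    · rw [updTuple_eq_top ht]
      exact le_top
    by_cases hs : ∃ i, IsSlot b.get c' i
    · obtain ⟨i, t, hi, htg, he⟩ := updTuple_slot ht hs
      rw [he]
      refine WithTop.coe_le_coe.mpr ?_
      beta_reduce
      rw [htg]
      have hag : ∀ j < i, b.get j = overwrite b.get c' i j := fun j hj =>
        (overwrite_of_lt hj).symm
      rcases hi.1 with h | ⟨he, hne, _⟩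
      · rcases hcc.eq_or_lt with rfl | hlt
        · refine truncate_le_of_lt hag ?_
          rw [overwrite_self, Entry.lt_iff_key, Entry.key_col_even hc]
          exact (Entry.key_of_isBelow h).2
        · have hb : (b.get i).IsBelow c := by
            rcases hx : b.get i with _ | x
            · rw [hx] at h
              exact h.elim
            · rw [hx] at h
              exact lt_trans h hlt
          refine (congrArg toLex (truncate_eq_of_isBelow hag hb ?_)).le
          rw [overwrite_self]
          exact hlt
      · refine truncate_le_of_lt hag ?_
        rw [overwrite_self, Entry.lt_iff_key, Entry.key_col_even he]
        have := Entry.key_neg hne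
        omega
    · rw [updTuple_no_slot ht hs]

/-- An even letter always finds a slot or leads to `⊤`. No entry before the slot is below `c`, so
the growth at the slot is visible in the truncation. -/
theorem truncateRank_lt_upd {c : Fin d} (hc : Even (c : ℕ)) {r : Rank k d} (hr : r ≠ ⊤) :
    truncateRank c r < truncateRank c (upd r c) := by
  induction r using WithTop.recTopCoe with
  | top => exact absurd rfl hr
  | coe b =>
    change _ < truncateRank c (updTuple b c)
    by_cases ht : Even (c : ℕ) ∧ ∀ i, (b.get i).IsEven
    · rw [updTuple_eq_top ht]
      exact WithTop.coe_lt_top _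
    · obtain ⟨i, t, hi, htg, he⟩ := updTuple_slot ht
        (exists_isSlot_of_even hc (by push Not at ht; exact ht hc))
      rw [he]
      refine WithTop.coe_lt_coe.mpr ?_
      beta_reduce
      rw [htg]
      refine truncate_lt_of_not_isBelow (i := i) (fun j hj => (overwrite_of_lt hj).symm)
        (fun j hj hb => hi.2 j hj (Or.inl hb)) ?_ ?_
      · rw [overwrite_self, Entry.lt_iff_key, Entry.key_col_even hc]
        rcases hi.1 with h | ⟨_, hne, _⟩
        · exact (Entry.key_of_isBelow h).2
        · have := Entry.key_neg hne
          omega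
      · rw [overwrite_self]
        exact lt_irrefl c

theorem truncateRank_le_lift {c c' : Fin d} (hc : Even (c : ℕ)) (hcc : c' ≤ c) (r : Rank k d) :
    truncateRank c r ≤ truncateRank c (lift r c') := by
  obtain ⟨q, hq, he⟩ := exists_lift_eq r c'
  exact he ▸ (truncateRank_mono c hq).trans (truncateRank_le_upd hc hcc q)

theorem truncateRank_lt_lift {c : Fin d} (hc : Even (c : ℕ)) {r : Rank k d} (hr : r ≠ ⊤) :
    truncateRank c r < truncateRank c (lift r c) := by
  obtain ⟨q, hq, he⟩ := exists_lift_eq r c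
  rw [he]
  by_cases hqt : q = ⊤
  · subst hqt
    lift r to Tuple k d using hr
    exact WithTop.coe_lt_top _
  · exact (truncateRank_mono c hq).trans_lt (truncateRank_lt_upd hc hqt)

/-! ### Words whose updates reach the greatest rank -/

/-- The rank after reading the first letters of the word `a`. -/
noncomputable def chain (k : ℕ) (a : ℕ → Fin d) : ℕ → Rank k d
  | 0 => ⊥
  | m + 1 => upd (chain k a m) (a m)

/-- The greatest letter of `a` at the positions `p, …, q - 1` is even. -/
def EvenGap (a : ℕ → Fin d) (p q : ℕ) : Prop :=
  ∃ t, p ≤ t ∧ t < q ∧ Even (a t : ℕ) ∧ ∀ s, p ≤ s → s < q → a s ≤ a t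

theorem EvenGap.trans {a : ℕ → Fin d} {p q r : ℕ} (h : EvenGap a p q) (h' : EvenGap a q r) :
    EvenGap a p r := by
  obtain ⟨t, hpt, htq, he, hm⟩ := h
  obtain ⟨t', hqt, htr, he', hm'⟩ := h'
  rcases le_total (a t) (a t') with hle | hle
  · refine ⟨t', by omega, htr, he', fun s hs hsr => ?_⟩
    by_cases hsq : s < q
    · exact (hm s hs hsq).trans hle
    · exact hm' s (by omega) hsr
  · refine ⟨t, hpt, by omega, he, fun s hs hsr => ?_⟩
    by_cases hsq : s < q
    · exact hm s hs hsq
    · exact (hm' s (by omega) hsr).trans hle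

/-- All gaps between positions of `X` are even. -/
def EvenGaps (a : ℕ → Fin d) (X : Finset ℕ) : Prop :=
  ∀ p ∈ X, ∀ q ∈ X, p < q → EvenGap a p q

/-- The positions `X`, with last position `l`, justify the entry `x` at the coordinate `i` after
reading `m` letters. The priority `x` is read at position `t`. -/
structure Justifies (k : ℕ) (a : ℕ → Fin d) (m i : ℕ) (x : Fin d) (X : Finset ℕ) (l t : ℕ) :
    Prop where
  card : X.card = 2 ^ (k - 1 - i)
  gaps : EvenGaps a X
  last_mem : l ∈ X
  le_last : ∀ p ∈ X, p ≤ l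
  last_le : l ≤ t
  lt : t < m
  letter : a t = x
  le_letter : ∀ s, l ≤ s → s < m → a s ≤ x

/-- Justifications of all entries of a tuple; those of more significant entries come first. -/
structure Witnesses (a : ℕ → Fin d) (m : ℕ) (b : Fin k → Entry d) (X : Fin k → Finset ℕ)
    (l t : Fin k → ℕ) : Prop where
  just : ∀ i x, b i = .col x → Justifies k a m i x (X i) (l i) (t i)
  order : ∀ i j, i < j → b i ≠ .blank → b j ≠ .blank → ∀ q ∈ X j, t i < q

theorem Entry.IsEven.exists_eq {x : Entry d} (h : x.IsEven) : ∃ c, x = col c ∧ Even (c : ℕ) := by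
  rcases x with _ | c
  · exact h.elim
  · exact ⟨c, rfl, h⟩

/-- If all entries from `lo` on are even, their justifications can be joined and extended by the
next position. -/
theorem Witnesses.join {a : ℕ → Fin d} {m : ℕ} {b : Fin k → Entry d} {X : Fin k → Finset ℕ}
    {l t : Fin k → ℕ} (h : Witnesses a m b X l t) (lo : ℕ) (hlo : lo ≤ k)
    (he : ∀ j : Fin k, lo ≤ j → (b j).IsEven) :
    ∃ U : Finset ℕ, U.card = 2 ^ (k - lo) ∧ EvenGaps a U ∧ m ∈ U ∧
      ∀ q ∈ U, q = m ∨ q < m ∧ ∃ j : Fin k, lo ≤ j ∧ b j ≠ .blank ∧ q ∈ X j := by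
  induction hlo using Nat.decreasingInduction with
  | self =>
    -- With no coordinate left only the new position `m` remains; it accounts for the `1` in `2 ^ (k
    -- - lo) = 1 + ∑ 2 ^ (k - 1 - i)`.
    refine ⟨{m}, by simp, ?_, by simp, by simp⟩
    intro p hp q hq hpq
    simp only [Finset.mem_singleton] at hp hq
    omega
  | of_succ i hi ih =>
    obtain ⟨U, hcard, hU, hm, hmem⟩ := ih fun j hj => he j (by omega)
    obtain ⟨x, hx, hxe⟩ := (he ⟨i, hi⟩ le_rfl).exists_eq
    have hJ := h.just _ x hx
    have hlt : ∀ q ∈ U, t ⟨i, hi⟩ < q := by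
      intro q hq
      rcases hmem q hq with rfl | ⟨_, j, hj, hb, hqj⟩
      · exact hJ.lt
      · exact h.order ⟨i, hi⟩ j (Fin.lt_def.mpr hj) (by simp [hx]) hb q hqj
    have hlt' : ∀ p ∈ X ⟨i, hi⟩, ∀ q ∈ U, p < q := fun p hp q hq =>
      ((hJ.le_last p hp).trans hJ.last_le).trans_lt (hlt q hq)
    have hqm : ∀ q ∈ U, q ≤ m := fun q hq => by
      rcases hmem q hq with rfl | ⟨h, _⟩
      · exact le_rfl
      · exact h.le
    -- The even entry itself, read at `t`, is the greatest letter from the last position of its own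
    -- justification up to any later position.
    have hlast : ∀ q ∈ U, EvenGap a (l ⟨i, hi⟩) q := fun q hq =>
      ⟨t ⟨i, hi⟩, hJ.last_le, hlt q hq, hJ.letter ▸ hxe, fun s hs hsq =>
        hJ.letter ▸ hJ.le_letter s hs (hsq.trans_le (hqm q hq))⟩
    refine ⟨X ⟨i, hi⟩ ∪ U, ?_, ?_, Finset.mem_union_right _ hm, ?_⟩
    · rw [Finset.card_union_of_disjoint, hJ.card, hcard]
      · have : k - i = (k - 1 - i) + 1 := by omega
        rw [this, pow_succ, show k - (i + 1) = k - 1 - i by omega, mul_two]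
      · rw [Finset.disjoint_left]
        exact fun p hp hq => lt_irrefl _ (hlt' p hp p hq)
    · intro p hp q hq hpq
      rcases Finset.mem_union.mp hp with hp | hp <;> rcases Finset.mem_union.mp hq with hq | hq
      · exact hJ.gaps p hp q hq hpq
      · rcases (hJ.le_last p hp).eq_or_lt with rfl | hpl
        · exact hlast q hq
        · exact (hJ.gaps p hp _ hJ.last_mem hpl).trans (hlast q hq)
      · exact absurd (hlt' q hq p hp) (by omega)
      · exact hU p hp q hq hpq
    · intro q hq
      rcases Finset.mem_union.mp hq with hq | hq
      · exact Or.inr ⟨((hJ.le_last q hq).trans hJ.last_le).trans_lt hJ.lt, ⟨i, hi⟩, le_rfl,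
          by simp [hx], hq⟩
      · rcases hmem q hq with h | ⟨h, j, hj, h'⟩
        · exact Or.inl h
        · exact Or.inr ⟨h, j, by omega, h'⟩

theorem Justifies.succ {a : ℕ → Fin d} {m i : ℕ} {x : Fin d} {X : Finset ℕ} {l t : ℕ}
    (h : Justifies k a m i x X l t) (hx : a m ≤ x) : Justifies k a (m + 1) i x X l t :=
  { h with
    lt := h.lt.trans (Nat.lt_succ_self m)
    le_letter := fun s hs hsm => by
      rcases (Nat.lt_succ_iff.mp hsm).eq_or_lt with rfl | hsm
      · exact hx
      · exact h.le_letter s hs hsm }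

theorem Entry.le_of_not_isBelow {c x : Fin d} (h : ¬ (col x).IsBelow c) : c ≤ x := not_lt.mp h

/-- If the slot held a smaller priority, its positions are reused and only the reading time of the
entry moves to `m`. Otherwise all later entries are even, and joining them with `m` yields just the
`2 ^ (k - 1 - i)` positions needed. Entries before the slot are at least `a m` if not blank, so
their justifications persist. -/
theorem Witnesses.overwrite {a : ℕ → Fin d} {m : ℕ} {b : Fin k → Entry d} {X : Fin k → Finset ℕ}
    {l t : Fin k → ℕ} (h : Witnesses a m b X l t) {i : Fin k} (hi : IsSlot b (a m) i) :
    ∃ X' l' t', Witnesses a (m + 1) (overwrite b (a m) i) X' l' t' := by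
  have hbelow : ∀ j < i, ∀ x, b j = .col x → a m ≤ x := fun j hj x hx =>
    Entry.le_of_not_isBelow fun hb => hi.2 j hj (Or.inl (hx ▸ hb))
  have key : ∃ X' l', Justifies k a (m + 1) i (a m) X' l' m ∧
      ∀ j < i, b j ≠ .blank → ∀ q ∈ X', t j < q := by
    rcases hi.1 with hb | ⟨hc, _, hall⟩
    · rcases hx : b i with _ | x
      · rw [hx] at hb
        exact hb.elim
      · rw [hx] at hb
        have hb : x < a m := hb
        have hJ := h.just i x hx
        refine ⟨X i, l i, { hJ with
          last_le := hJ.last_le.trans hJ.lt.le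
          lt := Nat.lt_succ_self m
          letter := rfl
          le_letter := fun s hs hsm => ?_ }, fun j hj hbj q hq =>
            h.order j i hj hbj (by simp [hx]) q hq⟩
        rcases (Nat.lt_succ_iff.mp hsm).eq_or_lt with rfl | hsm
        · exact le_rfl
        · exact (hJ.le_letter s hs hsm).trans hb.le
    · obtain ⟨U, hcard, hU, hm, hmem⟩ := h.join (i + 1) i.2 fun j hj => hall j (Fin.lt_def.mpr hj)
      refine ⟨U, m, ⟨?_, hU, hm, fun p hp => ?_, le_rfl, Nat.lt_succ_self m, rfl,
        fun s hs hsm => ?_⟩, fun j hj hbj q hq => ?_⟩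
      · rw [hcard]
        congr 1
        omega
      · rcases hmem p hp with rfl | ⟨h, _⟩
        · exact le_rfl
        · exact h.le
      · rw [show s = m by omega]
      · rcases hmem q hq with rfl | ⟨_, j', hj', hb', hq'⟩
        · rcases hx : b j with _ | x
          · exact absurd hx hbj
          · exact (h.just j x hx).lt
        · exact h.order j j' (hj.trans (Fin.lt_def.mpr hj')) hbj hb' q hq'
  obtain ⟨X', l', hJ, hord⟩ := key
  refine ⟨Function.update X i X', Function.update l i l', Function.update t i m,
    fun j x hx => ?_, fun p j hpj hp hj q hq => ?_⟩
  · rcases lt_trichotomy j i with hji | rfl | hji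
    · rw [overwrite_of_lt hji] at hx
      rw [Function.update_of_ne hji.ne, Function.update_of_ne hji.ne,
        Function.update_of_ne hji.ne]
      exact (h.just j x hx).succ (hbelow j hji x hx)
    · rw [overwrite_self] at hx
      cases hx
      simpa using hJ
    · rw [overwrite_of_gt hji] at hx
      cases hx
  · rcases lt_trichotomy j i with hji | rfl | hji
    · rw [overwrite_of_lt hji] at hj
      rw [overwrite_of_lt (hpj.trans hji)] at hp
      rw [Function.update_of_ne hji.ne] at hq
      rw [Function.update_of_ne (hpj.trans hji).ne]
      exact h.order p j hpj hp hj q hq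
    · rw [overwrite_of_lt hpj] at hp
      rw [Function.update_self] at hq
      rw [Function.update_of_ne hpj.ne]
      exact hord p hpj hp q hq
    · exact absurd (overwrite_of_gt hji) hj

/-- Induction on the number of letters. When there is no slot, no entry is below the new letter, and
all justifications carry over. -/
theorem exists_witnesses (a : ℕ → Fin d) (m : ℕ) (b : Tuple k d) (h : chain k a m = b) :
    ∃ X l t, Witnesses a m b.get X l t := by
  induction m generalizing b with
  | zero =>
    have hb : b = ⊥ := by
      have : ((⊥ : Tuple k d) : Rank k d) = b := h
      exact (WithTop.coe_injective this).symm
    subst hb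
    exact ⟨fun _ => ∅, fun _ => 0, fun _ => 0, fun i x hx => by simp [Tuple.get_bot] at hx,
      fun i j _ hi => absurd (Tuple.get_bot i) hi⟩
  | succ m ih =>
    rw [chain] at h
    induction hr : chain k a m using WithTop.recTopCoe with
    | top =>
      rw [hr] at h
      exact absurd h.symm (WithTop.coe_ne_top)
    | coe b' =>
      rw [hr] at h
      change updTuple b' (a m) = b at h
      obtain ⟨X, l, t, hw⟩ := ih b' hr
      by_cases ht : Even (a m : ℕ) ∧ ∀ i, (b'.get i).IsEven
      · rw [updTuple_eq_top ht] at h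
        exact absurd h.symm (WithTop.coe_ne_top)
      by_cases hs : ∃ i, IsSlot b'.get (a m) i
      · obtain ⟨i, b'', hi, hg, he⟩ := updTuple_slot ht hs
        rw [he] at h
        cases WithTop.coe_injective h
        rw [hg]
        exact hw.overwrite hi
      · rw [updTuple_no_slot ht hs] at h
        cases WithTop.coe_injective h
        refine ⟨X, l, t, fun i x hx => (hw.just i x hx).succ ?_, hw.order⟩
        exact Entry.le_of_not_isBelow fun hb => hs (exists_isSlot (Or.inl (hx ▸ hb)))

/-- If reading a word leads to the greatest rank, it has `2 ^ k` positions with even gaps. -/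
theorem exists_evenGaps (a : ℕ → Fin d) (m : ℕ) (h : chain k a m = ⊤) :
    ∃ U : Finset ℕ, U.card = 2 ^ k ∧ EvenGaps a U ∧ ∀ p ∈ U, p < m := by
  induction m with
  | zero => exact absurd h (WithTop.coe_ne_top)
  | succ m ih =>
    induction hr : chain k a m using WithTop.recTopCoe with
    | top =>
      obtain ⟨U, hc, hU, hm⟩ := ih hr
      exact ⟨U, hc, hU, fun p hp => (hm p hp).trans (Nat.lt_succ_self m)⟩
    | coe b =>
      rw [chain, hr] at h
      change updTuple b (a m) = ⊤ at h
      have ht : Even (a m : ℕ) ∧ ∀ i, (b.get i).IsEven := by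
        by_contra ht
        by_cases hs : ∃ i, IsSlot b.get (a m) i
        · obtain ⟨i, b', _, _, he⟩ := updTuple_slot ht hs
          rw [he] at h
          exact WithTop.coe_ne_top h
        · rw [updTuple_no_slot ht hs] at h
          exact WithTop.coe_ne_top h
      obtain ⟨X, l, t, hw⟩ := exists_witnesses a m b hr
      -- All `k` entries are even when `⊤` is reached, so joining from coordinate `0` gives `2 ^ k`
      -- positions.
      obtain ⟨U, hc, hU, _, hmem⟩ := hw.join 0 (Nat.zero_le k) fun j _ => ht.2 j
      refine ⟨U, hc, hU, fun p hp => ?_⟩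
      rcases hmem p hp with rfl | ⟨h, _⟩ <;> omega

theorem chain_congr {a a' : ℕ → Fin d} {m : ℕ} (h : ∀ t < m, a t = a' t) :
    chain k a m = chain k a' m := by
  induction m with
  | zero => rfl
  | succ m ih =>
    rw [chain, chain, ih fun t ht => h t (by omega), h m (Nat.lt_succ_self m)]

end Ranks

/-! ### The rank `⊤` and the winning set of `even`. -/

namespace ParityGame

variable {V : Type*} {d k : ℕ} {G : ParityGame V d}

/-- The vertices from which player `even` can force the next vertex to be in `S`. -/
def cpre (G : ParityGame V d) (S : Set V) : Set V :=
  {v | (G.owner v = .even ∧ ∃ w, G.edge v w ∧ w ∈ S) ∨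
    (G.owner v = .odd ∧ ∀ w, G.edge v w → w ∈ S)}

theorem owner_eq_odd_iff {v : V} : G.owner v = .odd ↔ G.owner v ≠ .even := by
  cases G.owner v <;> simp

/-- A play along which a ranking function with proper ranks is respected is not won by `even`. -/
theorem not_winsPlay_even {f : V → Rank k d} {ρ : ℕ → V} (ht : ∀ i, f (ρ i) ≠ ⊤)
    (hl : ∀ i, lift (f (ρ (i + 1))) (G.prio (ρ i)) ≤ f (ρ i)) : ¬ G.WinsPlay .even ρ := by
  rintro ⟨c, ⟨hc, hmax⟩, hce⟩
  obtain ⟨i₀, hi₀⟩ := hc.exists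
  obtain ⟨e, rfl⟩ : ∃ e : Fin d, (e : ℕ) = c := ⟨_, hi₀⟩
  have hce : Even (e : ℕ) := hce
  have hev : ∀ᶠ i in atTop, G.prio (ρ i) ≤ e := by
    have : ∀ x : Fin d, ∀ᶠ i in atTop, G.prio (ρ i) = x → x ≤ e := by
      intro x
      by_cases hx : ∃ᶠ i in atTop, (G.prio (ρ i) : ℕ) = x
      · exact Eventually.of_forall fun _ _ => hmax hx
      · rw [not_frequently] at hx
        exact hx.mono fun i hi h => absurd (congrArg Fin.val h) hi
    exact (eventually_all.mpr this).mono fun i hi => hi _ rfl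
  obtain ⟨N, hN⟩ := eventually_atTop.mp hev
  have hfin : (Set.range fun i => f (ρ (i + N))).Finite := Set.toFinite _
  -- Among the ranks met after `N` take one with least truncation. Later truncations never exceed
  -- it, yet the next occurrence of `e` forces a strictly smaller one.
  obtain ⟨_, ⟨i, rfl⟩, hmin⟩ := Set.exists_min_image _ (truncateRank e) hfin
    (Set.range_nonempty _)
  have hanti : ∀ j, truncateRank e (f (ρ (i + N + j))) ≤ truncateRank e (f (ρ (i + N))) := by
    intro j
    induction j with
    | zero => exact le_rfl
    | succ j ih =>
      refine le_trans (le_trans (truncateRank_le_lift hce (hN (i + N + j) (by omega)) _) ?_) ih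
      exact truncateRank_mono e (hl (i + N + j))
  obtain ⟨m, hm, hme⟩ := frequently_atTop.mp hc (i + N)
  obtain ⟨j, rfl⟩ := Nat.exists_eq_add_of_le hm
  have h1 : truncateRank e (f (ρ (i + N + j + 1))) < truncateRank e (f (ρ (i + N + j))) := by
    refine (truncateRank_lt_lift hce (ht _)).trans_le ?_
    have := hl (i + N + j)
    rw [Fin.ext hme] at this
    exact truncateRank_mono e this
  have h2 := hmin (f (ρ (i + j + 1 + N))) ⟨i + j + 1, rfl⟩
  rw [show i + j + 1 + N = i + N + j + 1 by omega] at h2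
  exact absurd (h2.trans_lt h1) (not_lt.mpr (hanti j))

/-- A closed walk whose greatest priority is even is won by `even` when it is repeated. -/
theorem exists_winning_loop {W : Set V} {σ : V → V} {u : ℕ → V} {p q : ℕ} (hpq : p < q)
    (hu : ∀ t, p ≤ t → t < q → u t ∈ W ∧ G.edge (u (t + 1)) (u t) ∧
      (G.owner (u (t + 1)) = .odd → u t = σ (u (t + 1)))) (huq : u p = u q)
    (hgap : EvenGap (fun t => G.prio (u t)) p q) :
    ∃ ρ : ℕ → V, (∀ i, ρ i ∈ W) ∧ G.Follows .odd σ ρ ∧ G.WinsPlay .even ρ := by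
  obtain ⟨L, hL, rfl⟩ : ∃ L, 0 < L ∧ q = p + L := ⟨q - p, by omega, by omega⟩
  have hpos : ∀ i, i % L < L := fun i => Nat.mod_lt i hL
  have hnext : ∀ i, ∃ t, p ≤ t ∧ t < p + L ∧ u (p + (L - 1 - i % L)) = u (t + 1) ∧
      u (p + (L - 1 - (i + 1) % L)) = u t := by
    intro i
    have := hpos i
    by_cases hi : i % L + 1 < L
    · refine ⟨p + (L - 1 - (i + 1) % L), by omega, by omega, ?_, rfl⟩
      rw [Nat.add_mod, Nat.mod_eq_of_lt (show 1 < L by omega), Nat.mod_eq_of_lt hi]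
      congr 1
      omega
    · have hi : i % L = L - 1 := by omega
      have h0 : (i + 1) % L = 0 := by
        rw [Nat.add_mod, hi]
        by_cases h1 : L = 1
        · subst h1
          simp
        · rw [Nat.mod_eq_of_lt (show 1 < L by omega), show L - 1 + 1 = L by omega, Nat.mod_self]
      refine ⟨p + (L - 1), by omega, by omega, ?_, by rw [h0]; rfl⟩
      rw [hi, show p + (L - 1 - (L - 1)) = p by omega, show p + (L - 1) + 1 = p + L by omega, huq]
  -- Edges lead from `u (t + 1)` to `u t`, so the loop runs through the indices downwards; after `p`
  -- it continues at `p + L - 1`, as `u p = u (p + L)`.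
  refine ⟨fun i => u (p + (L - 1 - i % L)), fun i => (hu _ (by omega) ?_).1,
    ⟨fun i => ?_, fun i hi => ?_⟩, ?_⟩
  · have := hpos i
    omega
  · obtain ⟨t, h1, h2, h3, h4⟩ := hnext i
    rw [h3, h4]
    exact (hu t h1 h2).2.1
  · obtain ⟨t, h1, h2, h3, h4⟩ := hnext i
    change G.owner (u (p + (L - 1 - i % L))) = .odd at hi
    rw [h3] at hi
    rw [h3, h4]
    exact (hu t h1 h2).2.2 hi
  · obtain ⟨t, hpt, htq, he, hm⟩ := hgap
    refine ⟨_, ⟨?_, fun c hc => ?_⟩, he⟩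
    -- The vertex `u t` sits at offset `L - 1 - (t - p)` of each round of length `L`; round `N` is
    -- late enough.
    · refine frequently_atTop.mpr fun N => ⟨L - 1 - (t - p) + L * N, ?_, ?_⟩
      · nlinarith
      · simp only [Nat.add_mul_mod_self_left]
        rw [Nat.mod_eq_of_lt (by omega), show p + (L - 1 - (L - 1 - (t - p))) = t by omega]
    · obtain ⟨i, hi⟩ := hc.exists
      have := hpos i
      exact hi ▸ hm (p + (L - 1 - i % L)) (by omega) (by omega)

section Best

variable [Fintype V]

theorem le_best_of_even {f : V → Rank k d} {v w : V} (ho : G.owner v = .even) (he : G.edge v w) :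
    f w ≤ G.best f v := by
  rw [best, if_pos ho]
  exact Finset.le_sup (by simpa using he)

theorem best_le_of_odd {f : V → Rank k d} {v w : V} (ho : G.owner v = .odd) (he : G.edge v w) :
    G.best f v ≤ f w := by
  rw [best, if_neg (owner_eq_odd_iff.mp ho)]
  exact Finset.inf_le (by simpa using he)

theorem exists_best_eq (G : ParityGame V d) (f : V → Rank k d) (v : V) :
    ∃ w, G.edge v w ∧ G.best f v = f w := by
  classical
  have hne : (Finset.univ.filter (G.edge v)).Nonempty := by
    obtain ⟨w, hw⟩ := G.total v
    exact ⟨w, by simpa using hw⟩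
  by_cases ho : G.owner v = .even
  · obtain ⟨w, hw, h⟩ := Finset.exists_mem_eq_sup _ hne f
    exact ⟨w, by simpa using hw, by rw [best, if_pos ho]; convert h⟩
  · obtain ⟨w, hw, h⟩ := Finset.exists_mem_eq_inf _ hne f
    exact ⟨w, by simpa using hw, by rw [best, if_neg ho]; convert h⟩

/-- This links the set-based view to the lift operators: controllable predecessors of the upper sets
determine `best`. -/
theorem mem_cpre_iff {f : V → Rank k d} {r : Rank k d} {v : V} :
    v ∈ G.cpre {w | r ≤ f w} ↔ r ≤ G.best f v := by
  constructor
  · rintro (⟨ho, w, he, hw⟩ | ⟨ho, h⟩)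
    · exact le_trans hw (le_best_of_even ho he)
    · obtain ⟨w, he, hw⟩ := G.exists_best_eq f v
      exact hw ▸ h w he
  · intro h
    by_cases ho : G.owner v = .even
    · obtain ⟨w, he, hw⟩ := G.exists_best_eq f v
      exact Or.inl ⟨ho, w, he, h.trans hw.le⟩
    · have ho := owner_eq_odd_iff.mpr ho
      exact Or.inr ⟨ho, fun w he => h.trans (best_le_of_odd ho he)⟩

theorem best_mono {f g : V → Rank k d} (h : f ≤ g) (v : V) : G.best f v ≤ G.best g v := by
  have : v ∈ G.cpre {w | G.best f v ≤ f w} := mem_cpre_iff.mpr le_rfl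
  refine mem_cpre_iff.mp ?_
  rcases this with ⟨ho, w, he, hw⟩ | ⟨ho, hall⟩
  · exact Or.inl ⟨ho, w, he, le_trans hw (h w)⟩
  · exact Or.inr ⟨ho, fun w he => le_trans (hall w he) (h w)⟩

/-- All operators `Lift(·, v)` do not increase the ranking function. -/
def IsPrefixed (G : ParityGame V d) (f : V → Rank k d) : Prop :=
  ∀ v, lift (G.best f v) (G.prio v) ≤ f v

theorem liftAt_eq_self_iff {f : V → Rank k d} {v : V} :
    G.liftAt f v = f ↔ lift (G.best f v) (G.prio v) = f v := by
  classical
  rw [liftAt, Function.update_eq_self_iff]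

/-- The Knaster–Tarski argument: lifting `f` everywhere at once gives again a prefixed function by
monotonicity, so leastness yields the missing inequality. -/
theorem isProgressMeasure_of_isLeast {f : V → Rank k d} (hf : G.IsPrefixed f)
    (hle : ∀ g : V → Rank k d, G.IsPrefixed g → f ≤ g) : G.IsProgressMeasure f := by
  constructor
  · intro v
    refine liftAt_eq_self_iff.mpr ((hf v).antisymm ?_)
    exact hle (fun v => lift (G.best f v) (G.prio v))
      (fun v => lift_mono (best_mono hf v) _) v
  · exact fun g hg => hle g fun v => (liftAt_eq_self_iff.mp (hg v)).le

theorem lift_top (c : Fin d) : lift (⊤ : Rank k d) c = ⊤ := by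
  obtain ⟨q, hq, h⟩ := exists_lift_eq (⊤ : Rank k d) c
  rw [h, top_le_iff.mp hq]
  rfl

/-- Let `odd` move to a successor that attains `best`. A play that starts below `⊤` stays there
since `⊤` lifts to `⊤`, so `not_winsPlay_even` applies to it. -/
theorem winningSet_subset_top {f : V → Rank k d} (hf : G.IsPrefixed f) :
    G.winningSet .even ⊆ {v | f v = ⊤} := by
  rintro s ⟨σ, hσ, hw⟩
  by_contra hs
  choose τ hτ hbest using G.exists_best_eq f
  refine not_winsPlay_even (f := f) ?_ ?_ (hw τ fun v _ => hτ v)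
  all_goals
    set ρ := G.play .even σ τ s
    have hstep : ∀ i, f (ρ (i + 1)) ≤ G.best f (ρ i) := by
      intro i
      have : ρ (i + 1) = G.next .even σ τ (ρ i) := Function.iterate_succ_apply' _ _ _
      rw [this]
      by_cases ho : G.owner (ρ i) = .even
      · rw [next, if_pos ho]
        exact le_best_of_even ho (hσ _ ho)
      · rw [next, if_neg ho]
        exact (hbest _).ge
  · intro i
    induction i with
    | zero => exact hs
    | succ i ih =>
      intro h
      have h1 := hf (ρ i)
      have h2 := hstep i
      rw [h] at h2
      rw [top_le_iff.mp h2, lift_top] at h1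
      exact ih (top_le_iff.mp h1)
  · exact fun i => (lift_mono (hstep i) _).trans (hf (ρ i))

/-- Paths backwards from a vertex of `W`, consistent with the strategy `σ` of `odd`: the vertices
are listed from the last one to the first one. -/
structure IsBackPath (G : ParityGame V d) (W : Set V) (σ : V → V) (u : ℕ → V) (m : ℕ) : Prop where
  mem : ∀ t ≤ m, u t ∈ W
  edge : ∀ t < m, G.edge (u (t + 1)) (u t)
  strat : ∀ t < m, G.owner (u (t + 1)) = .odd → u t = σ (u (t + 1))

/-- Pigeonhole: of `2 ^ k` positions with even gaps two carry the same vertex. The walk between them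
is a cycle that follows `σ` and, repeated, is won by `even`. -/
theorem IsBackPath.chain_ne_top {W : Set V} {σ : V → V} {u : ℕ → V} {m : ℕ}
    (hk : Fintype.card V < 2 ^ k) (hW : G.DominionWith .odd Set.univ W σ)
    (h : G.IsBackPath W σ u m) : chain k (fun t => G.prio (u t)) (m + 1) ≠ ⊤ := by
  intro htop
  obtain ⟨U, hcard, hgaps, hlt⟩ := exists_evenGaps _ _ htop
  obtain ⟨p, hp, q, hq, hne, he⟩ := Finset.exists_ne_map_eq_of_card_lt_of_maps_to
    (s := U) (t := (Finset.univ : Finset V)) (f := u) (by rw [hcard]; exact hk)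
    (fun _ _ => Finset.mem_coe.mpr (Finset.mem_univ _))
  wlog hpq : p < q generalizing p q
  · exact this q hq p hp hne.symm he.symm (by omega)
  have hqm := hlt q hq
  obtain ⟨ρ, hρ, hfol, hwin⟩ := exists_winning_loop (G := G) (W := W) (σ := σ) hpq
    (fun t _ ht => ⟨h.mem t (by omega), h.edge t (by omega), h.strat t (by omega)⟩) he
    (hgaps p hp q hq hpq)
  exact not_winsPlay_other hwin (hW.wins ρ hρ hfol)

-- Each vertex of `W` gets the greatest result of reading a path consistent with `σ` backwards.
-- Prolonging such a path by a preceding vertex is one basic update, which `lift` does not exceed;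
-- this is the prefixed inequality. The maximum is attained, hence below `⊤`.
open Classical in
theorem exists_isPrefixed {W : Set V} {σ : V → V} (hk : Fintype.card V < 2 ^ k)
    (hW : G.DominionWith .odd Set.univ W σ) :
    ∃ g : V → Rank k d, G.IsPrefixed g ∧ ∀ v ∈ W, g v ≠ ⊤ := by
  let R : V → Finset (Rank k d) := fun v => Finset.univ.filter fun r =>
    ∃ u m, G.IsBackPath W σ u m ∧ u m = v ∧ r = chain k (fun t => G.prio (u t)) (m + 1)
  have hR : ∀ v r, r ∈ R v ↔ ∃ u m, G.IsBackPath W σ u m ∧ u m = v ∧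
      r = chain k (fun t => G.prio (u t)) (m + 1) := fun v r => by simp [R]
  have hne : ∀ v ∈ W, (R v).Nonempty := fun v hv =>
    ⟨_, (hR v _).mpr ⟨fun _ => v, 0, ⟨fun _ _ => hv, by simp, by simp⟩, rfl, rfl⟩⟩
  have hstep : ∀ v ∈ W, ∀ w ∈ W, G.edge v w → (G.owner v = .odd → w = σ v) →
      lift ((R w).sup id) (G.prio v) ≤ (R v).sup id := by
    intro v hv w hw he ho
    obtain ⟨r, hr, hs⟩ := Finset.exists_mem_eq_sup _ (hne w hw) id
    rw [hs]
    refine (lift_le_upd _ _).trans (Finset.le_sup (f := id) ?_)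
    obtain ⟨u, m, hp, rfl, rfl⟩ := (hR _ r).mp hr
    have hu : ∀ t ≤ m, Function.update u (m + 1) v t = u t := fun t ht =>
      Function.update_of_ne (by omega) _ _
    refine (hR _ _).mpr ⟨Function.update u (m + 1) v, m + 1, ⟨fun t ht => ?_, fun t ht => ?_,
      fun t ht => ?_⟩, Function.update_self .., ?_⟩
    · rcases Nat.le_succ_iff.mp ht with ht | rfl
      · rw [hu t ht]
        exact hp.mem t ht
      · rwa [Function.update_self]
    · rcases (Nat.lt_succ_iff.mp ht).eq_or_lt with rfl | ht
      · rwa [Function.update_self, hu _ le_rfl]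
      · rw [hu _ ht, hu _ ht.le]
        exact hp.edge t ht
    · rcases (Nat.lt_succ_iff.mp ht).eq_or_lt with rfl | ht
      · rwa [Function.update_self, hu _ le_rfl]
      · rw [hu _ ht, hu _ ht.le]
        exact hp.strat t ht
    · change _ = upd (chain k _ (m + 1)) (G.prio (Function.update u (m + 1) v (m + 1)))
      rw [Function.update_self]
      congr 1
      exact chain_congr fun t ht => by rw [hu t (by omega)]
  let g : V → Rank k d := fun v => if v ∈ W then (R v).sup id else ⊤
  have hg : ∀ v ∈ W, g v = (R v).sup id := fun v hv => if_pos hv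
  refine ⟨g, fun v => ?_, fun v hv => ?_⟩
  · by_cases hv : v ∈ W
    · rw [hg v hv]
      by_cases ho : G.owner v = .even
      · obtain ⟨w, he, hw⟩ := G.exists_best_eq g v
        have hwW := hW.opp v hv (by simp [ho]) w trivial he
        rw [hw, hg w hwW]
        exact hstep v hv w hwW he (by simp [ho])
      · have ho := owner_eq_odd_iff.mpr ho
        obtain ⟨he, hwW⟩ := hW.own v hv ho
        refine (lift_mono (best_le_of_odd ho he) _).trans ?_
        rw [hg _ hwW]
        exact hstep v hv _ hwW he fun _ => rfl
    · rw [show g v = ⊤ from if_neg hv]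
      exact le_top
  · rw [hg v hv]
    obtain ⟨r, hr, hs⟩ := Finset.exists_mem_eq_sup _ (hne v hv) id
    rw [hs]
    obtain ⟨u, m, hp, rfl, rfl⟩ := (hR _ r).mp hr
    exact hp.chain_ne_top hk hW

/-- The least ranking function that no lift increases is `⊤` exactly on the winning set. -/
theorem top_eq_winningSet {f : V → Rank k d} (hk : Fintype.card V < 2 ^ k) (hf : G.IsPrefixed f)
    (hle : ∀ g : V → Rank k d, G.IsPrefixed g → f ≤ g) :
    {v | f v = ⊤} = G.winningSet .even := by
  obtain ⟨_, ⟨_, σ, hσ⟩, hcompl⟩ := G.winningSet_isDominion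
  refine Set.Subset.antisymm (fun v hv => ?_) (winningSet_subset_top hf)
  by_contra hne
  obtain ⟨g, hg, hgt⟩ := exists_isPrefixed hk hσ
  refine hgt v (hcompl ▸ hne) (top_le_iff.mp ?_)
  rw [← show f v = ⊤ from hv]
  exact hle g hg v

end Best

end ParityGame

/-! ## Runs of symbolic programs -/

section Runs

variable {V : Type*} {σ R : Type} [DecidableEq R] {Pre : Set V → Set V}

/-- The program terminates with at most `m` one-step operations and `B` basic set operations in a
configuration that satisfies `Q`. -/
def Runs (Pre : Set V → Set V) (p : Prog σ R) (s : σ) (M : R → Set V) (m B : ℕ)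
    (Q : σ → (R → Set V) → Prop) : Prop :=
  ∃ s' M' m' b', Exec Pre p (s, M) (s', M') m' b' ∧ m' ≤ m ∧ b' ≤ B ∧ Q s' M'

namespace Runs

variable {p q : Prog σ R} {ps : List (Prog σ R)} {s : σ} {M : R → Set V} {m m' B B' : ℕ}
  {Q Q' : σ → (R → Set V) → Prop}

theorem mono (h : Runs Pre p s M m B Q) (hm : m ≤ m') (hB : B ≤ B')
    (hQ : ∀ s' M', Q s' M' → Q' s' M') : Runs Pre p s M m' B' Q' := by
  obtain ⟨s', M', _, _, he, h1, h2, h3⟩ := h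
  exact ⟨s', M', _, _, he, h1.trans hm, h2.trans hB, hQ _ _ h3⟩

theorem weaken (h : Runs Pre p s M m B Q) (hm : m ≤ m') (hB : B ≤ B') :
    Runs Pre p s M m' B' Q := h.mono hm hB fun _ _ => id

theorem skip (h : Q s M) : Runs Pre .skip s M 0 0 Q := ⟨s, M, 0, 0, .skip _, le_rfl, le_rfl, h⟩

theorem seq (hp : Runs Pre p s M m B Q')
    (hq : ∀ s' M', Q' s' M' → Runs Pre q s' M' m' B' Q) :
    Runs Pre (.seq p q) s M (m + m') (B + B') Q := by
  obtain ⟨s', M', _, _, he, h1, h2, h3⟩ := hp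
  obtain ⟨s'', M'', _, _, he', h1', h2', h3'⟩ := hq s' M' h3
  exact ⟨s'', M'', _, _, .seq he he', Nat.add_le_add h1 h1', Nat.add_le_add h2 h2', h3'⟩

theorem nil (h : Q s M) : Runs Pre (.block []) s M 0 0 Q := skip h

theorem cons (hp : Runs Pre p s M m B Q')
    (hq : ∀ s' M', Q' s' M' → Runs Pre (.block ps) s' M' m' B' Q) :
    Runs Pre (.block (p :: ps)) s M (m + m') (B + B') Q := seq hp hq

theorem setOp {op : SetOp} {dst u v : σ → R}
    (h : Q s (Function.update M (dst s) (op.eval (M (u s)) (M (v s))))) :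
    Runs Pre (.setOp op dst u v) s M 0 1 Q := ⟨_, _, _, _, .setOp .., le_rfl, le_rfl, h⟩

theorem union {dst u v : R} (h : Q s (Function.update M dst (M u ∪ M v))) :
    Runs Pre (.union dst u v) s M 0 1 Q := setOp h

theorem diff {dst u v : R} (h : Q s (Function.update M dst (M u \ M v))) :
    Runs Pre (.diff dst u v) s M 0 1 Q := setOp h

theorem cond {c : σ → Bool} (hp : c s = true → Runs Pre p s M m B Q)
    (hq : c s = false → Runs Pre q s M m B Q) : Runs Pre (.cond c p q) s M m B Q := by
  cases hc : c s with
  | true =>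
    obtain ⟨s', M', _, _, he, h⟩ := hp hc
    exact ⟨s', M', _, _, .condTrue hc he, h⟩
  | false =>
    obtain ⟨s', M', _, _, he, h⟩ := hq hc
    exact ⟨s', M', _, _, .condFalse hc he, h⟩

theorem cons_setOp {op : SetOp} {dst u v : σ → R}
    (h : Runs Pre (.block ps) s (Function.update M (dst s) (op.eval (M (u s)) (M (v s)))) m B Q) :
    Runs Pre (.block (.setOp op dst u v :: ps)) s M m (B + 1) Q := by
  refine (cons (Q' := fun s' M' => s' = s ∧ M' = _) (setOp ⟨rfl, rfl⟩) ?_).weaken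
    (Nat.zero_add m).le (Nat.add_comm 1 B).le
  rintro _ _ ⟨rfl, rfl⟩
  exact h

theorem cons_union {dst u v : R}
    (h : Runs Pre (.block ps) s (Function.update M dst (M u ∪ M v)) m B Q) :
    Runs Pre (.block (.union dst u v :: ps)) s M m (B + 1) Q := cons_setOp h

theorem cons_inter {dst u v : R}
    (h : Runs Pre (.block ps) s (Function.update M dst (M u ∩ M v)) m B Q) :
    Runs Pre (.block (.inter dst u v :: ps)) s M m (B + 1) Q := cons_setOp h

theorem cons_diff {dst u v : R}
    (h : Runs Pre (.block ps) s (Function.update M dst (M u \ M v)) m B Q) :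
    Runs Pre (.block (.diff dst u v :: ps)) s M m (B + 1) Q := cons_setOp h

theorem cons_assign {f : σ → σ} (h : Runs Pre (.block ps) (f s) M m B Q) :
    Runs Pre (.block (.assign f :: ps)) s M m B Q := by
  refine (cons (Q' := fun s' M' => s' = f s ∧ M' = M)
    ⟨_, _, _, _, .assign .., le_rfl, le_rfl, rfl, rfl⟩ ?_).weaken
    (Nat.zero_add m).le (Nat.zero_add B).le
  rintro _ _ ⟨rfl, rfl⟩
  exact h

theorem cons_pre {dst u : σ → R}
    (h : Runs Pre (.block ps) s (Function.update M (dst s) (Pre (M (u s)))) m B Q) :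
    Runs Pre (.block (.pre dst u :: ps)) s M (m + 1) B Q := by
  refine (cons (Q' := fun s' M' => s' = s ∧ M' = _)
    ⟨_, _, _, _, .pre .., le_rfl, le_rfl, rfl, rfl⟩ ?_).weaken
    (Nat.add_comm 1 m).le (Nat.zero_add B).le
  rintro _ _ ⟨rfl, rfl⟩
  exact h

theorem cons_test {t : SetTest} {u v : σ → R} {f : σ → Bool → σ}
    (h : ∀ a : Bool, (a = true ↔ t.eval (M (u s)) (M (v s))) →
      Runs Pre (.block ps) (f s a) M m B Q) :
    Runs Pre (.block (.test t u v f :: ps)) s M m (B + 1) Q := by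
  classical
  refine (cons (Q' := fun s' M' => s' = f s (decide (t.eval (M (u s)) (M (v s)))) ∧ M' = M)
    ⟨_, _, _, _, .test .., le_rfl, le_rfl, by congr!, rfl⟩ ?_).weaken
    (Nat.zero_add m).le (Nat.add_comm 1 B).le
  rintro _ _ ⟨rfl, rfl⟩
  exact h _ decide_eq_true_iff

/-- The rule for `forEach`: the invariant refers to the elements of the list that remain. -/
theorem forEach {ι : Type} {p : ι → Prog σ R} {l : List ι} (hl : l.Nodup)
    (I : List ι → σ → (R → Set V) → Prop)
    (hstep : ∀ i l s M, i ∉ l → I (i :: l) s M → Runs Pre (p i) s M m B (I l)) (h : I l s M) :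
    Runs Pre (.forEach l p) s M (l.length * m) (l.length * B) (I []) := by
  induction l generalizing s M with
  | nil => exact (nil h).weaken (Nat.zero_le _) (Nat.zero_le _)
  | cons i l ih =>
    obtain ⟨hi, hl⟩ := List.nodup_cons.mp hl
    refine (cons (hstep i l s M hi h) fun s' M' h' => ih hl h').weaken ?_ ?_ <;>
      rw [List.length_cons, Nat.add_one_mul, Nat.add_comm]

/-- The rule for `forEach` over all indices: the invariant refers to the next index. -/
theorem forEach_finRange {k : ℕ} {p : Fin k → Prog σ R} (I : ℕ → σ → (R → Set V) → Prop)
    (hstep : ∀ (i : Fin k) s M, I i s M → Runs Pre (p i) s M m B (I (i + 1))) (h : I 0 s M) :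
    Runs Pre (.forEach (List.finRange k) p) s M (k * m) (k * B) (I k) := by
  have key : ∀ n ≤ k, ∀ s M, I n s M →
      Runs Pre (.forEach ((List.finRange k).drop n) p) s M ((k - n) * m) ((k - n) * B) (I k) := by
    intro n hn
    induction hn using Nat.decreasingInduction with
    | self =>
      intro s M h
      rw [List.drop_eq_nil_of_le (by simp)]
      exact (nil h).weaken (Nat.zero_le _) (Nat.zero_le _)
    | of_succ i hi ih =>
      intro s M h
      rw [List.drop_eq_getElem_cons (by simpa using hi)]
      refine (cons (Q' := I (i + 1)) (m := m) (B := B) ?_ ih).weaken ?_ ?_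
      · simpa using hstep ⟨i, hi⟩ s M h
      · rw [show k - i = k - (i + 1) + 1 by omega, Nat.add_one_mul, Nat.add_comm]
      · rw [show k - i = k - (i + 1) + 1 by omega, Nat.add_one_mul, Nat.add_comm]
  simpa using key 0 (Nat.zero_le k) s M h

theorem loop_done {c : σ → Bool} (hc : c s = false) (h : Q s M) :
    Runs Pre (.loop c p) s M 0 0 Q := ⟨_, _, _, _, .loopDone hc, le_rfl, le_rfl, h⟩

theorem loop_step {c : σ → Bool} (hc : c s = true) (hp : Runs Pre p s M m B Q')
    (hq : ∀ s' M', Q' s' M' → Runs Pre (.loop c p) s' M' m' B' Q) :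
    Runs Pre (.loop c p) s M (m + m') (B + B') Q := by
  obtain ⟨s', M', _, _, he, h1, h2, h3⟩ := hp
  obtain ⟨s'', M'', _, _, he', h1', h2', h3'⟩ := hq s' M' h3
  exact ⟨s'', M'', _, _, .loopStep hc he he', Nat.add_le_add h1 h1', Nat.add_le_add h2 h2', h3'⟩

end Runs

end Runs

/-! ## The operations of the data structure -/

section DataStructure

variable {V : Type*} {k d : ℕ} {Pre : Set V → Set V}

theorem Entry.nodup_all (d : ℕ) : (Entry.all d).Nodup := by
  refine List.nodup_cons.mpr ⟨by simp, (List.nodup_finRange d).map fun a b h => ?_⟩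
  cases h
  rfl

theorem Entry.length_all (d : ℕ) : (Entry.all d).length = d + 1 := by simp [Entry.all]

theorem Entry.mem_all (x : Entry d) : x ∈ Entry.all d := by
  rcases x with _ | c <;> simp [Entry.all]

/-- The vertices of rank at least `r`. -/
def atLeast (f : V → Rank k d) (r : Rank k d) : Set V := {v | r ≤ f v}

/-- The registers outside of the list have the same contents. -/
def AgreeOff (L : List (Reg k d)) (M M' : Reg k d → Set V) : Prop := ∀ R ∉ L, M' R = M R

/-- The registers that hold neither the input nor the encoding. -/
def Reg.IsAux : Reg k d → Prop
  | .vert | .vEven | .vOdd | .vPrio _ | .C _ _ | .Ctop => False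
  | _ => True

theorem Encodes.congr {M M' : Reg k d → Set V} {f : V → Rank k d} (h : Encodes M f)
    (hM : ∀ R : Reg k d, ¬ R.IsAux → M' R = M R) : Encodes M' f :=
  ⟨fun i x => (hM (.C i x) id).trans (h.coord i x), (hM .Ctop id).trans h.top⟩

theorem lt_iff_exists_coord {b : Tuple k d} {r : Rank k d} :
    (b : Rank k d) < r ↔ r = ⊤ ∨ ∃ i : Fin k, ∃ c : Tuple k d, r = c ∧
      (∀ j < i, c.get j = b.get j) ∧ b.get i < c.get i := by
  induction r using WithTop.recTopCoe with
  | top => simp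
  | coe c =>
    rw [WithTop.coe_lt_coe, Tuple.lt_iff]
    constructor
    · rintro ⟨i, h, hi⟩
      exact Or.inr ⟨i, c, rfl, fun j hj => (h j hj).symm, hi⟩
    · rintro (h | ⟨i, c', hc, h, hi⟩)
      · exact absurd h WithTop.coe_ne_top
      · cases WithTop.coe_injective hc
        exact ⟨i, fun j hj => (h j hj).symm, hi⟩

/-- The sets of the encoding determine `S_{⪰ b}`. -/
theorem Encodes.atLeast_coe {M : Reg k d → Set V} {f : V → Rank k d} (h : Encodes M f)
    (hk : 0 < k) (b : Tuple k d) :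
    atLeast f b = (M .Ctop ∪ {v | ∃ i : Fin k, (∀ j < i, v ∈ M (.C j (b.get j))) ∧
      ∃ x, b.get i < x ∧ v ∈ M (.C i x)}) ∪ {v | ∀ j : Fin k, v ∈ M (.C j (b.get j))} := by
  ext v
  simp only [atLeast, Set.mem_ofPred_eq, Set.mem_union, h.coord, h.top]
  rw [le_iff_lt_or_eq, lt_iff_exists_coord]
  refine or_congr (or_congr_right (exists_congr fun i => ?_)) ?_
  · constructor
    · rintro ⟨c, hc, hj, hi⟩
      exact ⟨fun j hji => ⟨c, hc, hj j hji⟩, _, hi, c, hc, rfl⟩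
    · rintro ⟨hj, x, hx, c, hc, rfl⟩
      refine ⟨c, hc, fun j hji => ?_, hx⟩
      obtain ⟨c', hc', h'⟩ := hj j hji
      rw [hc] at hc'
      cases WithTop.coe_injective hc'
      exact h'
  · constructor
    · exact fun hb j => ⟨b, hb.symm, rfl⟩
    · intro hall
      obtain ⟨c, hc, _⟩ := hall ⟨0, hk⟩
      rw [hc]
      congr 1
      refine Tuple.ext_get fun j => ?_
      obtain ⟨c', hc', h'⟩ := hall j
      rw [hc] at hc'
      cases WithTop.coe_injective hc'
      exact h'.symm

/-- The number of basic set operations that `getSet` may use. -/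
def getSetCost (k d : ℕ) : ℕ := k * (d + 5) + 3

theorem runs_getSet {M : Reg k d → Set V} {f : V → Rank k d} {s : Store k d} {dst : Reg k d}
    (e : Store k d → Rank k d) (hk : 0 < k) (hvert : M .vert = Set.univ) (hM : Encodes M f)
    (hd : dst.IsAux) (hdT : dst ≠ .T) (hdU : dst ≠ .U) :
    Runs Pre (getSet dst e) s M 0 (getSetCost k d) fun s' M' =>
      s' = s ∧ M' dst = atLeast f (e s) ∧ AgreeOff [dst, .T, .U] M M' := by
  have hdC : ∀ i x, Reg.C i x ≠ dst := by rintro i x rfl; exact hd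
  have hdtop : Reg.Ctop ≠ dst := by rintro rfl; exact hd
  have hdvert : Reg.vert ≠ dst := by rintro rfl; exact hd
  unfold getSetCost
  refine .cond (fun hc => ?_) fun hc => ?_
  · rw [decide_eq_true_iff] at hc
    refine (Runs.union ⟨rfl, ?_, ?_⟩).weaken le_rfl (by omega)
    · rw [Function.update_self, Set.union_self, hM.top, hc]
      ext v
      simp [atLeast]
    · intro R hR
      simp only [List.mem_cons, not_or] at hR
      exact Function.update_of_ne hR.1 _ _
  · rw [decide_eq_false_iff_not] at hc
    obtain ⟨b, hb⟩ := WithTop.ne_top_iff_exists.mp hc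
    have hcoord : ∀ i, (e s).coord i = b.get i := fun i => by rw [← hb]; rfl
    -- After `m` coordinates, `dst` holds the vertices of rank `⊤` and those that first deviate from
    -- `b` upwards at one of these coordinates; `T` holds those that agree with `b` so far.
    let I : ℕ → Store k d → (Reg k d → Set V) → Prop := fun m s' M' =>
      s' = s ∧ AgreeOff [dst, .T, .U] M M' ∧
      M' dst = M .Ctop ∪ {v | ∃ i : Fin k, (i : ℕ) < m ∧ (∀ j < i, v ∈ M (.C j (b.get j))) ∧
        ∃ x, b.get i < x ∧ v ∈ M (.C i x)} ∧
      M' .T = {v | ∀ j : Fin k, (j : ℕ) < m → v ∈ M (.C j (b.get j))}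
    refine (Runs.cons_union (Runs.cons_union (Runs.cons (Runs.forEach_finRange I (m := 0)
      (B := d + 5) ?_ ?_) ?_))).weaken (m := 0 + 0) le_rfl (B := k * (d + 5) + 1 + 1 + 1) le_rfl
    · rintro i s' M' ⟨rfl, hoff, hdst, hT⟩
      have hMC : ∀ j x, M' (.C j x) = M (.C j x) := fun j x => hoff _ (by simp [hdC])
      let J : List (Entry d) → Store k d → (Reg k d → Set V) → Prop := fun l s'' M'' =>
        s'' = s' ∧ AgreeOff [.U] M' M'' ∧
        M'' .U = {v | ∃ x, x ∉ l ∧ b.get i < x ∧ v ∈ M (.C i x)}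
      refine (Runs.cons_diff (Runs.cons (Runs.forEach (Entry.nodup_all d) J (m := 0) (B := 1)
        ?_ ?_) ?_)).weaken (m := (Entry.all d).length * 0 + 0) (by simp)
        (B := (Entry.all d).length * 1 + 3 + 1) (by rw [Entry.length_all]; omega)
      · rintro x l s'' M'' hxl ⟨rfl, hoff', hU⟩
        refine .cond (fun hc => .union ⟨rfl, fun R hR => ?_, ?_⟩)
          fun hc => (Runs.skip ⟨rfl, hoff', ?_⟩).weaken le_rfl (by omega)
        · simp only [List.mem_singleton] at hR
          rw [Function.update_of_ne hR]
          exact hoff' R (by simpa using hR)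
        · rw [decide_eq_true_iff, hcoord] at hc
          rw [Function.update_self, hU, hoff' (.C i x) (by simp), hMC]
          ext v
          simp only [Set.mem_union, Set.mem_ofPred_eq, List.mem_cons, not_or]
          constructor
          · rintro (⟨y, hy, h⟩ | h)
            · exact ⟨y, hy.2, h⟩
            · exact ⟨x, hxl, hc, h⟩
          · rintro ⟨y, hy, h⟩
            by_cases hyx : y = x
            · exact Or.inr (hyx ▸ h.2)
            · exact Or.inl ⟨y, ⟨hyx, hy⟩, h⟩
        · rw [decide_eq_false_iff_not, hcoord] at hc
          rw [hU]
          ext v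
          refine exists_congr fun y => ?_
          simp only [List.mem_cons, not_or]
          constructor
          · rintro ⟨⟨_, hy⟩, h⟩
            exact ⟨hy, h⟩
          · rintro ⟨hy, h⟩
            exact ⟨⟨fun hyx => hc (hyx ▸ h.1), hy⟩, h⟩
      · refine ⟨rfl, fun R hR => ?_, ?_⟩
        · simp only [List.mem_singleton] at hR
          exact Function.update_of_ne hR _ _
        · rw [Function.update_self]
          simp [Entry.mem_all]
      · rintro s'' M'' ⟨rfl, hoff', hU⟩
        refine Runs.cons_inter (Runs.cons_union (Runs.cons_setOp (Runs.nil ⟨rfl, ?_, ?_, ?_⟩)))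
        · intro R hR
          have hR' := hR
          simp only [List.mem_cons, List.not_mem_nil, or_false, not_or] at hR'
          rw [Function.update_of_ne hR'.2.1, Function.update_of_ne hR'.1,
            Function.update_of_ne hR'.2.2, hoff' R (by simpa using hR'.2.2)]
          exact hoff R hR
        · have h1 : M'' .T = M' .T := hoff' _ (by simp)
          have h2 : M'' dst = M' dst := hoff' _ (by simpa using hdU)
          rw [Function.update_of_ne hdT, Function.update_self, Function.update_of_ne hdU,
            Function.update_self, h1, h2, hdst, hT, hU, Set.union_assoc]
          congr 1
          ext v
          simp only [Set.mem_union, Set.mem_inter_iff, Set.mem_ofPred_eq, List.not_mem_nil,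
            not_false_iff, true_and]
          constructor
          · rintro (⟨j, hj, h⟩ | ⟨h, h'⟩)
            · exact ⟨j, by omega, h⟩
            · exact ⟨i, by omega, fun j hj => h j hj, h'⟩
          · rintro ⟨j, hj, h, h'⟩
            rcases (Nat.lt_succ_iff.mp hj).eq_or_lt with hji | hji
            · rw [Fin.ext hji] at h h'
              exact Or.inr ⟨fun j hj => h j hj, h'⟩
            · exact Or.inl ⟨j, hji, h, h'⟩
        · have h1 : M'' .T = M' .T := hoff' _ (by simp)
          have h2 : M'' (.C i (b.get i)) = M (.C i (b.get i)) :=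
            (hoff' _ (by simp)).trans (hMC _ _)
          rw [Function.update_self, Function.update_of_ne hdT.symm,
            Function.update_of_ne (by simp), h1, hcoord, Function.update_of_ne (hdC _ _),
            Function.update_of_ne (by simp), h2, hT]
          ext v
          change (_ ∧ _) ↔ _
          simp only [Set.mem_ofPred_eq]
          constructor
          · rintro ⟨h, h'⟩ j hj
            rcases (Nat.lt_succ_iff.mp hj).eq_or_lt with hji | hji
            · rwa [Fin.ext hji]
            · exact h j hji
          · exact fun h => ⟨fun j hj => h j (by omega), h i (by omega)⟩
    · refine ⟨rfl, fun R hR => ?_, ?_, ?_⟩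
      · simp only [List.mem_cons, List.not_mem_nil, or_false, not_or] at hR
        rw [Function.update_of_ne hR.2.1, Function.update_of_ne hR.1]
      · rw [Function.update_of_ne hdT, Function.update_self]
        simp
      · rw [Function.update_self, Function.update_of_ne hdvert, hvert]
        simp
    · rintro s' M' ⟨rfl, hoff, hdst, hT⟩
      refine Runs.cons_union (Runs.nil ⟨rfl, ?_, fun R hR => ?_⟩)
      · rw [Function.update_self, hdst, hT, ← hb, hM.atLeast_coe hk b]
        simp
      · have hR' := hR
        simp only [List.mem_cons, not_or] at hR'
        rw [Function.update_of_ne hR'.1]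
        exact hoff R hR

open Classical in
/-- The ranks of the vertices in `X` are raised to at least `r`. -/
noncomputable def raise (f : V → Rank k d) (r : Rank k d) (X : Set V) (v : V) : Rank k d :=
  if v ∈ X then max r (f v) else f v

theorem raise_of_mem {f : V → Rank k d} {r : Rank k d} {X : Set V} {v : V} (h : v ∈ X) :
    raise f r X v = max r (f v) := if_pos h

theorem raise_of_notMem {f : V → Rank k d} {r : Rank k d} {X : Set V} {v : V} (h : v ∉ X) :
    raise f r X v = f v := if_neg h

theorem le_raise (f : V → Rank k d) (r : Rank k d) (X : Set V) : f ≤ raise f r X := fun v => by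
  by_cases h : v ∈ X
  · rw [raise_of_mem h]
    exact le_max_right _ _
  · rw [raise_of_notMem h]

/-- The number of basic set operations that `updateSet` may use. -/
def updateSetCost (k d : ℕ) : ℕ := getSetCost k d + k * (d + 2) + 2

/-- Only vertices of `src` whose rank is not yet at least `e s` enter the difference set, so the
effect is a pointwise maximum and no rank is ever lowered. -/
theorem runs_updateSet {M : Reg k d → Set V} {f : V → Rank k d} {s : Store k d} {src : Reg k d}
    (e : Store k d → Rank k d) (hk : 0 < k) (hvert : M .vert = Set.univ) (hM : Encodes M f)
    (hdA : src ≠ .A) (hdT : src ≠ .T) (hdU : src ≠ .U) :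
    Runs Pre (updateSet src e) s M 0 (updateSetCost k d) fun s' M' =>
      s' = s ∧ Encodes M' (raise f (e s) (M src)) ∧
        ∀ R : Reg k d, (∀ i x, R ≠ .C i x) → R ∉ [.Ctop, .A, .D, .T, .U] → M' R = M R := by
  classical
  unfold updateSetCost
  refine (Runs.cons (B' := k * (d + 2) + 2) (m' := 0)
    (runs_getSet (dst := .A) e hk hvert hM trivial (by simp) (by simp)) ?_).weaken le_rfl
    (by omega)
  rintro s M₁ ⟨rfl, hA, hoff₁⟩
  refine (Runs.cons_diff (B := k * (d + 2) + 1) ?_).weaken le_rfl le_rfl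
  generalize hM₂ : Function.update M₁ .D (M₁ src \ M₁ .A) = M₂
  have hsrc : M₁ src = M src := hoff₁ _ (by simp [hdA, hdT, hdU])
  have hD₂ : M₂ .D = M src \ atLeast f (e s) := by
    rw [← hM₂, Function.update_self, hsrc, hA]
  have hoff₂ : AgreeOff [.A, .T, .U, .D] M M₂ := fun R hR => by
    simp only [List.mem_cons, List.not_mem_nil, or_false, not_or] at hR
    rw [← hM₂, Function.update_of_ne hR.2.2.2]
    exact hoff₁ R (by simp [hR])
  clear hM₂ hoff₁ hA hsrc M₁
  obtain ⟨D, hDdef⟩ : ∃ D, D = M src \ atLeast f (e s) := ⟨_, rfl⟩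
  have hDmem : ∀ v, v ∈ D ↔ v ∈ M src ∧ ¬ e s ≤ f v := fun v => hDdef ▸ Iff.rfl
  rw [← hDdef] at hD₂
  clear hDdef
  let I : ℕ → Store k d → (Reg k d → Set V) → Prop := fun m s' M' =>
    s' = s ∧ (∀ R : Reg k d, (∀ i x, R ≠ .C i x) → M' R = M₂ R) ∧
      ∀ (i : Fin k) x, M' (.C i x) = if (i : ℕ) < m then M (.C i x) \ D else M (.C i x)
  refine (Runs.cons (Runs.forEach_finRange I (m := 0) (B := d + 1) ?_ ?_)
    (m' := 0) (B' := k + 1) ?_).weaken (by simp) (by nlinarith)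
  · rintro i s' M' ⟨rfl, hoff, hC⟩
    let J : List (Entry d) → Store k d → (Reg k d → Set V) → Prop := fun l s'' M'' =>
      s'' = s' ∧ (∀ R, (∀ x, R ≠ .C i x) → M'' R = M' R) ∧
        ∀ x, M'' (.C i x) = if x ∈ l then M (.C i x) else M (.C i x) \ D
    refine (Runs.forEach (Entry.nodup_all d) J (m := 0) (B := 1) ?_ ?_).mono (by simp)
      (by rw [Entry.length_all]; omega) ?_
    · rintro x l s'' M'' hxl ⟨rfl, hoff', hC'⟩
      refine .diff ⟨rfl, fun R hR => ?_, fun y => ?_⟩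
      · rw [Function.update_of_ne (hR x), hoff' R hR]
      · by_cases hyx : y = x
        · subst hyx
          rw [Function.update_self, hC', hoff' .D (by simp), hoff .D (by simp), hD₂]
          simp [hxl]
        · rw [Function.update_of_ne (by simpa using hyx), hC']
          simp [hyx]
    · exact ⟨rfl, fun _ _ => rfl, fun x => by rw [hC]; simp [Entry.mem_all]⟩
    · rintro s'' M'' ⟨rfl, hoff', hC'⟩
      refine ⟨rfl, fun R hR => (hoff' R fun x => hR i x).trans (hoff R hR), fun j x => ?_⟩
      by_cases hji : j = i
      · subst hji
        rw [hC']
        simp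
      · rw [hoff' _ (by simp [hji]), hC]
        have : (j : ℕ) < i + 1 ↔ (j : ℕ) < i := by
          have : (j : ℕ) ≠ i := fun h => hji (Fin.ext h)
          omega
        simp [this]
  · exact ⟨rfl, fun _ _ => rfl, fun i x => by simpa using hoff₂ (.C i x) (by simp)⟩
  rintro s' M₃ ⟨rfl, hoff₃, hC₃⟩
  have hD₃ : M₃ .D = D := (hoff₃ _ (by simp)).trans hD₂
  have hfr : ∀ R : Reg k d, (∀ i x, R ≠ .C i x) → R ∉ [.A, .D, .T, .U] → M₃ R = M R := by
    intro R hR hR'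
    simp only [List.mem_cons, List.not_mem_nil, or_false, not_or] at hR'
    rw [hoff₃ R hR, hoff₂ R (by simp [hR'])]
  have hraise : ∀ v, raise f (e s') (M src) v = if v ∈ D then e s' else f v := by
    intro v
    by_cases hv : v ∈ M src
    · rw [raise_of_mem hv]
      by_cases hle : e s' ≤ f v
      · rw [max_eq_right hle, if_neg fun h => ((hDmem v).mp h).2 hle]
      · rw [max_eq_left (not_le.mp hle).le, if_pos ((hDmem v).mpr ⟨hv, hle⟩)]
    · rw [raise_of_notMem hv, if_neg fun h => hv ((hDmem v).mp h).1]
  refine (Runs.cons (m' := 0) (B' := 0) (m := 0) (B := k + 1) (.cond (fun hc => ?_) fun hc => ?_)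
    fun s' M' h => .nil h)
  · rw [decide_eq_true_iff] at hc
    refine (Runs.union ⟨rfl, ⟨fun i x => ?_, ?_⟩, fun R hR hR' => ?_⟩).weaken le_rfl (by omega)
    · rw [Function.update_of_ne (by simp), hC₃, if_pos i.2, hM.coord]
      ext v
      simp only [hraise, Set.mem_sdiff, Set.mem_ofPred_eq]
      by_cases hv : v ∈ D <;> simp [hv, hc]
    · rw [Function.update_self, hfr _ (by simp) (by simp), hD₃, hM.top]
      ext v
      simp only [hraise, Set.mem_union, Set.mem_ofPred_eq]
      by_cases hv : v ∈ D <;> simp [hv, hc]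
    · simp only [List.mem_cons, List.not_mem_nil, or_false, not_or] at hR'
      rw [Function.update_of_ne hR'.1]
      exact hfr R hR (by simp [hR'])
  · rw [decide_eq_false_iff_not] at hc
    obtain ⟨b, hb⟩ := WithTop.ne_top_iff_exists.mp hc
    have hcoord : ∀ i, (e s').coord i = b.get i := fun i => by rw [← hb]; rfl
    let I' : ℕ → Store k d → (Reg k d → Set V) → Prop := fun m s'' M' =>
      s'' = s' ∧ (∀ R : Reg k d, (∀ i x, R ≠ .C i x) → M' R = M₃ R) ∧
        ∀ (i : Fin k) x, M' (.C i x) =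
          if (i : ℕ) < m ∧ x = b.get i then M₃ (.C i x) ∪ D else M₃ (.C i x)
    refine (Runs.forEach_finRange I' (m := 0) (B := 1) ?_ ?_).mono (by simp) (by omega) ?_
    · rintro i s'' M' ⟨rfl, hoff, hC⟩
      refine .setOp ⟨rfl, fun R hR => ?_, fun j x => ?_⟩
      · rw [Function.update_of_ne (hR _ _), hoff R hR]
      · rw [hcoord, hoff .D (by simp), hD₃]
        by_cases hji : j = i
        · subst hji
          by_cases hx : x = b.get j
          · subst hx
            rw [Function.update_self, hC]
            simp [SetOp.eval]
          · rw [Function.update_of_ne (by simp [hx]), hC]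
            simp [hx]
        · rw [Function.update_of_ne (by simp [hji]), hC]
          have : (j : ℕ) < i + 1 ↔ (j : ℕ) < i := by
            have : (j : ℕ) ≠ i := fun h => hji (Fin.ext h)
            omega
          simp [this]
    · exact ⟨rfl, fun _ _ => rfl, fun i x => by simp⟩
    · rintro s'' M' ⟨rfl, hoff, hC⟩
      refine ⟨rfl, ⟨fun i x => ?_, ?_⟩, fun R hR hR' => ?_⟩
      · rw [hC, hC₃, if_pos i.2, hM.coord]
        ext v
        simp only [hraise, Set.mem_ofPred_eq]
        rw [← hb]
        by_cases hv : v ∈ D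
        · by_cases hx : x = b.get i
          · subst hx
            simp [hv]
          · simp only [hx, and_false, if_false, hv, if_true, Set.mem_sdiff, not_true_eq_false,
              false_iff]
            rintro ⟨c, hc, rfl⟩
            cases WithTop.coe_injective hc
            exact hx rfl
        · by_cases hx : x = b.get i <;> simp [hv, hx]
      · rw [hoff _ (by simp), hfr _ (by simp) (by simp), hM.top]
        ext v
        simp only [hraise, Set.mem_ofPred_eq]
        by_cases hv : v ∈ D
        · have h1 : f v ≠ ⊤ := fun h => ((hDmem v).mp hv).2 (le_top.trans_eq h.symm)
          simp [hv, hc, h1]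
        · simp [hv]
      · simp only [List.mem_cons, List.not_mem_nil, or_false, not_or] at hR'
        rw [hoff R hR, hfr R hR (by simp [hR'])]

/-- All successors lie in `S` iff none lies in its complement; this is the second `Pre` operation.
-/
theorem runs_controllablePre {G : ParityGame V d} {M : Reg k d → Set V} {s : Store k d}
    (hM : HoldsInput G M) :
    Runs G.pre (controllablePre (k := k)) s M 2 4 fun s' M' =>
      s' = s ∧ M' .P = G.cpre (M .S) ∧ AgreeOff [.P, .A] M M' := by
  refine Runs.cons_pre (Runs.cons_inter (Runs.cons_diff (Runs.cons_pre (Runs.cons_diff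
    (Runs.cons_union (Runs.nil ⟨rfl, ?_, fun R hR => ?_⟩))))))
  · simp only [Function.update_self, ne_eq, reduceCtorEq, not_false_eq_true,
      Function.update_of_ne, hM.vert, hM.vEven, hM.vOdd]
    ext v
    simp only [ParityGame.cpre, ParityGame.pre, Set.mem_union, Set.mem_inter_iff, Set.mem_sdiff,
      Set.mem_ofPred_eq, Set.mem_univ, true_and, not_exists, not_and, not_not]
  · simp only [List.mem_cons, List.not_mem_nil, or_false, not_or] at hR
    simp [Function.update_of_ne, hR]

end DataStructure

/-! ### One iteration of the inner loop and its invariant. -/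

section Walk

variable {V : Type*} {k d : ℕ}

namespace Store

theorem le_rep (s : Store k d) (r : Rank k d) : r ≤ s.rep r :=
  Finset.le_inf fun _ hq => (Finset.mem_filter.mp hq).2

theorem rep_of_mem {s : Store k d} {r : Rank k d} (h : r ∈ s.tree) : s.rep r = r :=
  le_antisymm (Finset.inf_le (f := id) (Finset.mem_filter.mpr ⟨h, le_rfl⟩)) (s.le_rep r)

theorem le_getNext (s : Store k d) (r : Rank k d) : r ≤ s.getNext r :=
  Finset.le_inf fun _ hq => (s.le_rep r).trans (Finset.mem_filter.mp hq).2.le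

theorem getPrevious_lt {s : Store k d} {r : Rank k d} (h : r ∈ s.tree) (hr : r ≠ ⊥) :
    s.getPrevious r < r := by
  rw [getPrevious, rep_of_mem h, Finset.sup_lt_iff (bot_lt_iff_ne_bot.mpr hr)]
  exact fun q hq => (Finset.mem_filter.mp hq).2

theorem le_getPrevious {s : Store k d} {r q : Rank k d} (h : r ∈ s.tree) (hq : q ∈ s.tree)
    (hqr : q < r) : q ≤ s.getPrevious r := by
  rw [getPrevious, rep_of_mem h]
  exact Finset.le_sup (f := id) (Finset.mem_filter.mpr ⟨hq, hqr⟩)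

end Store

/-- The effect of one iteration of the inner loop on the store, where the ranking function is `f`
and `X` is the set of the vertices whose rank is to be raised. -/
structure WalkStep (f : V → Rank k d) (X : Set V) (s s' : Store k d) : Prop where
  cur : s'.cur = s.cur
  old : s'.old = s.old
  tgt_lt : s'.tgt < s.tgt
  mem_tree : s.tgt ∈ s'.tree
  mem_active : s.tgt ∈ s'.active
  tree_new : ∀ q ∈ s'.tree, q = s.tgt ∨ q ∈ s.tree
  tree_old : ∀ q ∈ s.tree, q ∈ s'.tree ∨ (q < s.tgt ∧ atLeast f s.tgt ∪ X = atLeast f q ∪ X)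
  active_old : ∀ q ∈ s'.tree, q ∈ s.active → q ∈ s'.active
  le_tgt : ∀ q ∈ s'.tree, q < s.tgt → q ≤ s'.tgt
  length_le : s'.active.length ≤ s.active.length + 1

/-- Pure bookkeeping on the store: insert and activate the target, possibly remove its predecessor,
and move on to the predecessor in the resulting tree. The intermediate stores are described by
equations because the recorded test answers also change. -/
theorem walkStep_activate {f : V → Rank k d} {X : Set V} {s s₁ s₂ : Store k d}
    (hcur : s₁.cur = s.cur) (hold : s₁.old = s.old) (htgt : s₁.tgt = s.tgt)
    (htree : s₁.tree = s.tree) (hact : s₁.active = s.active) (hne : s.tgt ≠ ⊥)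
    {a a' : Bool} (h₂ : s₂ = { s₁.activate s₁.tgt with eq := a' })
    (ha : a = true → atLeast f s.tgt ∪ X = atLeast f (s₂.getPrevious s.tgt) ∪ X)
    {s₃ s' : Store k d} (h₃ : s₃ = if a = true then s₂.removeSet (s₂.getPrevious s₂.tgt) else s₂)
    (hcur' : s'.cur = s₃.cur) (hold' : s'.old = s₃.old) (htgt' : s'.tgt = s₃.getPrevious s₃.tgt)
    (htree' : s'.tree = s₃.tree) (hact' : s'.active = s₃.active) : WalkStep f X s s' := by
  have ht₂ : s₂.tree = insert s.tgt s.tree := by rw [h₂, ← htgt, ← htree]; rfl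
  have ha₂ : s₂.active = if s.tgt ∈ s.active then s.active else s.active ++ [s.tgt] := by
    rw [h₂, ← htgt, ← hact]; rfl
  have htg₂ : s₂.tgt = s.tgt := by rw [h₂, ← htgt]; rfl
  have hm₂ : s.tgt ∈ s₂.tree := by simp [ht₂]
  have hma₂ : s.tgt ∈ s₂.active := by rw [ha₂]; split_ifs with h <;> simp [h]
  have hao₂ : ∀ q ∈ s.active, q ∈ s₂.active := fun q hq => by rw [ha₂]; split_ifs <;> simp [hq]
  have hl₂ : s₂.active.length ≤ s.active.length + 1 := by rw [ha₂]; split_ifs <;> simp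
  have hp := Store.getPrevious_lt hm₂ hne
  rw [htg₂] at h₃
  have htg₃ : s₃.tgt = s.tgt := by rw [h₃, ← htg₂]; split_ifs <;> rfl
  have hm₃ : s.tgt ∈ s₃.tree := by
    rw [h₃]
    split_ifs
    · exact Finset.mem_erase.mpr ⟨hp.ne', hm₂⟩
    · exact hm₂
  have hsub : ∀ q ∈ s₃.tree, q ∈ s₂.tree := fun q hq => by
    rw [h₃] at hq
    split_ifs at hq
    · exact Finset.mem_of_mem_erase hq
    · exact hq
  rw [htg₃] at htgt'
  refine ⟨?_, ?_, ?_, ?_, ?_, ?_, ?_, ?_, ?_, ?_⟩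
  · rw [hcur', h₃, ← hcur, h₂]; split_ifs <;> rfl
  · rw [hold', h₃, ← hold, h₂]; split_ifs <;> rfl
  · rw [htgt']
    exact Store.getPrevious_lt hm₃ hne
  · rwa [htree']
  · rw [hact', h₃]
    split_ifs
    · exact List.mem_filter.mpr ⟨hma₂, by simpa using hp.ne'⟩
    · exact hma₂
  · intro q hq
    rw [htree'] at hq
    have := hsub q hq
    rwa [ht₂, Finset.mem_insert] at this
  · intro q hq
    have hq₂ : q ∈ s₂.tree := by rw [ht₂]; exact Finset.mem_insert_of_mem hq
    rw [htree', h₃]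
    split_ifs with h
    · by_cases hqp : q = s₂.getPrevious s.tgt
      · exact Or.inr (hqp ▸ ⟨hp, ha h⟩)
      · exact Or.inl (Finset.mem_erase.mpr ⟨hqp, hq₂⟩)
    · exact Or.inl hq₂
  · intro q hq hqa
    rw [htree', h₃] at hq
    rw [hact', h₃]
    split_ifs at hq ⊢
    · exact List.mem_filter.mpr ⟨hao₂ q hqa, by simpa using (Finset.mem_erase.mp hq).1⟩
    · exact hao₂ q hqa
  · intro q hq hlt
    rw [htree'] at hq
    rw [htgt']
    exact Store.le_getPrevious hm₃ hq hlt
  · rw [hact', h₃]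
    split_ifs
    · exact (List.length_filter_le _ _).trans hl₂
    · exact hl₂

theorem atLeast_anti (f : V → Rank k d) {r r' : Rank k d} (h : r ≤ r') :
    atLeast f r' ⊆ atLeast f r := fun _ hv => le_trans h hv

theorem atLeast_bot (f : V → Rank k d) : atLeast f ⊥ = Set.univ :=
  Set.eq_univ_of_forall fun v => (bot_le : ⊥ ≤ f v)

open Classical in
/-- The number of ranks up to `r` that are not reached by all vertices of `X`. -/
noncomputable def missing (f : V → Rank k d) (X : Set V) (r : Rank k d) : ℕ :=
  (Finset.univ.filter fun q : Rank k d => q ≤ r ∧ ¬ X ⊆ atLeast f q).card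

/-- The rank `r` itself is counted on the right but not on the left. This drives both termination
and the amortised bounds. -/
theorem missing_lt {f : V → Rank k d} {X : Set V} {r r' : Rank k d} (h : r' < r)
    (hr : ¬ X ⊆ atLeast f r) : missing f X r' < missing f X r := by
  classical
  refine Finset.card_lt_card ⟨fun q hq => ?_, fun hsub => ?_⟩
  · simp only [Finset.mem_filter, Finset.mem_univ, true_and] at hq ⊢
    exact ⟨hq.1.trans h.le, hq.2⟩
  · have := hsub (Finset.mem_filter.mpr ⟨Finset.mem_univ r, le_rfl, hr⟩)
    exact absurd (Finset.mem_filter.mp this).2.1 (not_le.mpr h)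

/-- The invariant of the inner loop, which starts with the store `s₀`. -/
structure WalkInv (f : V → Rank k d) (X : Set V) (s₀ s : Store k d) : Prop where
  cur : s.cur = s₀.cur
  old : s.old = s₀.old
  tgt_le : s.tgt ≤ s.old
  active_of_lt : ∀ q ∈ s.tree, s.tgt < q → q ≤ s.old → q ∈ s.active
  mem_or : ∀ q ∈ s.tree, q ∈ s₀.tree ∨ q ∈ s.active
  active_old : ∀ q ∈ s.tree, q ∈ s₀.active → q ∈ s.active
  range : ∀ v, raise f s.old X v ∈ s.tree ∨ 
    (raise f s.old X v = s.old ∧ s.tgt = s.old ∧ s.tree = s₀.tree)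
  length_le : s.active.length + missing f X s.tgt ≤ s₀.active.length + missing f X s.old

theorem WalkInv.init {f : V → Rank k d} {X : Set V} {s : Store k d} (h : s.tgt = s.old)
    (hf : ∀ v, f v ∈ s.tree) : WalkInv f X s s where
  cur := rfl
  old := rfl
  tgt_le := h.le
  active_of_lt q _ h1 h2 := absurd (h1.trans_le h2) (by simp [h])
  mem_or _ hq := Or.inl hq
  active_old _ _ hq := hq
  range v := by
    by_cases hv : v ∈ X
    · rw [raise_of_mem hv]
      rcases le_total s.old (f v) with hle | hle
      · rw [max_eq_right hle]
        exact Or.inl (hf v)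
      · exact Or.inr ⟨max_eq_left hle, h, rfl⟩
    · rw [raise_of_notMem hv]
      exact Or.inl (hf v)
  length_le := by rw [h]

theorem WalkInv.step {f : V → Rank k d} {X : Set V} {s₀ s s' : Store k d}
    (h : WalkInv f X s₀ s) (hX : ¬ X ⊆ atLeast f s.tgt) (hs : WalkStep f X s s') :
    WalkInv f X s₀ s' where
  cur := hs.cur.trans h.cur
  old := hs.old.trans h.old
  tgt_le := hs.old ▸ hs.tgt_lt.le.trans h.tgt_le
  active_of_lt q hq h1 h2 := by
    rcases hs.tree_new q hq with rfl | hq'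
    · exact hs.mem_active
    · rcases lt_trichotomy q s.tgt with hlt | rfl | hlt
      · exact absurd (hs.le_tgt q hq hlt) (not_le.mpr h1)
      · exact hs.mem_active
      · exact hs.active_old q hq (h.active_of_lt q hq' hlt (hs.old ▸ h2))
  mem_or q hq := by
    rcases hs.tree_new q hq with rfl | hq'
    · exact Or.inr hs.mem_active
    · exact (h.mem_or q hq').imp_right (hs.active_old q hq)
  active_old q hq hqa := by
    rcases hs.tree_new q hq with rfl | hq'
    · exact hs.mem_active
    · exact hs.active_old q hq (h.active_old q hq' hqa)
  range v := by
    rw [hs.old]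
    left
    rcases h.range v with hv | ⟨hv, ht, _⟩
    · rcases hs.tree_old _ hv with hv' | ⟨hlt, he⟩
      · exact hv'
      -- A vertex of `X` is raised to at least `old`, which is not below the target. Any other
      -- vertex whose rank is the deleted key would distinguish the two upper sets that were tested
      -- equal.
      · exfalso
        have hvX : v ∉ X := fun hvX => by
          rw [raise_of_mem hvX] at hlt
          exact absurd (hlt.trans_le h.tgt_le) (not_lt.mpr (le_max_left _ _))
        rw [raise_of_notMem hvX] at hlt he
        have : v ∈ atLeast f s.tgt ∪ X := he ▸ Or.inl (le_refl (f v))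
        exact absurd (this.resolve_right hvX) (not_le.mpr hlt)
    · rw [hv, ← ht]
      exact hs.mem_tree
  length_le := by
    have h1 := hs.length_le
    have h2 := missing_lt hs.tgt_lt hX
    have h3 := h.length_le
    rw [hs.old]
    omega

theorem AgreeOff.trans {L L' : List (Reg k d)} {M M' M'' : Reg k d → Set V} (h : AgreeOff L M M')
    (h' : AgreeOff L' M' M'') : AgreeOff (L ++ L') M M'' := fun R hR => by
  rw [List.mem_append, not_or] at hR
  exact (h' R hR.2).trans (h R hR.1)

theorem AgreeOff.mono {L L' : List (Reg k d)} {M M' : Reg k d → Set V} (h : AgreeOff L M M')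
    (hL : ∀ R ∈ L, R ∈ L') : AgreeOff L' M M' := fun R hR => h R fun hR' => hR (hL R hR')

theorem agreeOff_update (M : Reg k d → Set V) (R : Reg k d) (S : Set V) :
    AgreeOff [R] M (Function.update M R S) := fun R' hR' =>
  Function.update_of_ne (by simpa using hR') _ _

theorem AgreeOff.encodes {L : List (Reg k d)} {M M' : Reg k d → Set V} {f : V → Rank k d}
    (h : AgreeOff L M M') (hL : ∀ R ∈ L, R.IsAux) (hM : Encodes M f) : Encodes M' f :=
  hM.congr fun R hR => h R fun hR' => hR (hL R hR')

theorem AgreeOff.holdsInput {G : ParityGame V d} {L : List (Reg k d)} {M M' : Reg k d → Set V}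
    (h : AgreeOff L M M') (hL : ∀ R ∈ L, R.IsAux) (hM : HoldsInput G M) : HoldsInput G M' :=
  ⟨(h .vert (hL .vert)).trans hM.vert, (h .vEven (hL .vEven)).trans hM.vEven,
    (h .vOdd (hL .vOdd)).trans hM.vOdd, fun c => (h (.vPrio c) (hL (.vPrio c))).trans (hM.vPrio c)⟩

theorem Runs.cons_assign_eq {R σ : Type} [DecidableEq R] {Pre : Set V → Set V}
    {ps : List (Prog σ R)} {s s' : σ} {M : R → Set V} {m B : ℕ} {Q : σ → (R → Set V) → Prop}
    {f : σ → σ} (hf : f s = s') (h : Runs Pre (.block ps) s' M m B Q) :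
    Runs Pre (.block (.assign f :: ps)) s M m B Q := Runs.cons_assign (hf ▸ h)

/-- The registers changed by the inner loop. -/
abbrev walkRegs (k d : ℕ) : List (Reg k d) := [.S, .Snext, .Sprev, .A, .T, .U]

/-- The number of basic set operations that `innerStep` may use. -/
def innerCost (k d : ℕ) : ℕ := 3 * getSetCost k d + 6

/-- Since some vertex of `Pc` is not yet above the target, the enlarged `S` is strictly larger than
the upper set of the next key. So the activation condition always holds here, and every target
passed by the loop becomes active. -/
theorem runs_innerStep {Pre : Set V → Set V} {M : Reg k d → Set V} {f : V → Rank k d}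
    {s : Store k d} (hk : 0 < k) (hvert : M .vert = Set.univ) (hM : Encodes M f)
    (hS : M .S = atLeast f s.tgt) (hX : ¬ M .Pc ⊆ atLeast f s.tgt) :
    Runs Pre innerStep s M 0 (innerCost k d) fun s' M' =>
      WalkStep f (M .Pc) s s' ∧ AgreeOff (walkRegs k d) M M' ∧ M' .S = atLeast f s'.tgt ∧
        (s'.sub = true ↔ M .Pc ⊆ atLeast f s'.tgt) := by
  unfold innerCost
  -- Every vertex has rank at least `⊥`, so the loop body is never entered there and the predecessor
  -- is strictly smaller.
  have hne : s.tgt ≠ ⊥ := fun h => hX (by rw [h, atLeast_bot]; exact Set.subset_univ _)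
  refine (Runs.cons_union (Runs.cons (m' := 0) (B' := 2 * getSetCost k d + 5)
    (runs_getSet (dst := .Snext) _ hk ?_ ((agreeOff_update M .S _).encodes ?_ hM) trivial
      (by simp) (by simp)) ?_)).weaken le_rfl (by omega)
  · simpa using hvert
  · simp [Reg.IsAux]
  rintro s M₁ ⟨rfl, hSn, hoff₁⟩
  have hoff₁ := (agreeOff_update M .S _).trans hoff₁
  have hS₁ : M₁ .S = atLeast f s.tgt ∪ M .Pc := by
    rw [← hS]
    exact (‹AgreeOff [Reg.Snext, .T, .U] _ M₁› _ (by simp)).trans (Function.update_self ..)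
  have hsub : M₁ .Snext ⊆ M₁ .S := by
    rw [hSn, hS₁]
    exact (atLeast_anti f (s.le_getNext s.tgt)).trans Set.subset_union_left
  have hneq : M₁ .Snext ≠ M₁ .S := fun he => hX (by
    refine Set.Subset.trans ?_ (atLeast_anti f (s.le_getNext s.tgt))
    rw [← hSn, he, hS₁]
    exact Set.subset_union_right)
  refine (Runs.cons_test fun a ha => Runs.cons_test fun b hb => ?_).weaken
    (B := 2 * getSetCost k d + 3 + 1 + 1) le_rfl le_rfl
  rw [ha.mpr hsub]
  rw [show b = false from Bool.eq_false_iff.mpr fun h => hneq (hb.mp h)]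
  clear ha hb a b
  refine Runs.cons_assign_eq (if_pos (Or.inr ⟨rfl, rfl⟩)) ?_
  generalize hs₂ : Store.activate _ _ = s₂
  have htg₂ : s₂.tgt = s.tgt := by rw [← hs₂]; rfl
  refine (Runs.cons (m' := 0) (B' := getSetCost k d + 3)
    (runs_getSet (dst := .Sprev) _ hk ?_ (hoff₁.encodes ?_ hM) trivial (by simp) (by simp))
      ?_).weaken (m := 0 + 0) le_rfl (by omega)
  · rw [hoff₁ _ (by simp), hvert]
  · simp [Reg.IsAux]
  rintro s₂' M₂ ⟨rfl, hSp, hoff₂⟩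
  have hoff₂' := hoff₁.trans hoff₂
  refine Runs.cons_union (B := getSetCost k d + 2) ?_
  have hoff₃ := hoff₂'.trans (agreeOff_update M₂ .A (M₂ .Sprev ∪ M₂ .Pc))
  have hA : (Function.update M₂ .A (M₂ .Sprev ∪ M₂ .Pc)) .A =
      atLeast f (s₂'.getPrevious s.tgt) ∪ M .Pc := by
    rw [Function.update_self, hSp, hoff₂' .Pc (by simp), htg₂]
  have hS₃ : (Function.update M₂ .A (M₂ .Sprev ∪ M₂ .Pc)) .S = atLeast f s.tgt ∪ M .Pc := by
    rw [Function.update_of_ne (by simp), hoff₂ _ (by simp), hS₁]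
  generalize Function.update M₂ .A (M₂ .Sprev ∪ M₂ .Pc) = M₃ at hoff₃ hA hS₃ ⊢
  refine Runs.cons_test (B := getSetCost k d + 1) fun a ha => ?_
  refine Runs.cons_assign (Runs.cons_assign ?_)
  refine (Runs.cons (m' := 0) (B' := 1)
    (runs_getSet (dst := .S) _ hk ?_ (hoff₃.encodes ?_ hM) trivial (by simp) (by simp))
      ?_).weaken (m := 0 + 0) le_rfl le_rfl
  · rw [hoff₃ _ (by simp), hvert]
  · simp [Reg.IsAux]
  rintro s₄ M₄ ⟨rfl, hS₄, hoff₄⟩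
  have hoff := hoff₃.trans hoff₄
  refine Runs.cons_test (B := 0) fun b hb => Runs.nil ⟨?_, ?_, hS₄, ?_⟩
  · refine walkStep_activate (s := s) (s₁ := { { s with sub := true } with eq := false })
      (s₂ := { s₂' with eq := a }) (a := a) (a' := a) rfl rfl rfl rfl rfl hne ?_ (fun h => ?_) rfl
      rfl rfl rfl rfl rfl
    · rw [← hs₂]
    · have := ha.mp h
      change M₃ .S = M₃ .A at this
      rw [hS₃, hA] at this
      exact this
  · refine hoff.mono fun R hR => ?_
    simp only [List.mem_append, List.mem_cons, List.not_mem_nil, or_false] at hR ⊢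
    tauto
  · rw [hb]
    change M₄ .Pc ⊆ M₄ .S ↔ _
    rw [hS₄, hoff .Pc (by simp)]

end Walk

/-! ### The inner loop as a whole and its effect on the keys. -/

section Walk

variable {V : Type*} {k d : ℕ}

theorem runs_innerLoop {Pre : Set V → Set V} {f : V → Rank k d} {X : Set V} {s₀ : Store k d}
    {M₀ : Reg k d → Set V} (hk : 0 < k) (hvert : M₀ .vert = Set.univ) (hM₀ : Encodes M₀ f)
    (hX : M₀ .Pc = X) (s : Store k d) (M : Reg k d → Set V) (hw : WalkInv f X s₀ s)
    (hoff : AgreeOff (walkRegs k d) M₀ M) (hS : M .S = atLeast f s.tgt)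
    (hsub : s.sub = true ↔ X ⊆ atLeast f s.tgt) :
    Runs Pre (.loop (fun s => !s.sub) innerStep) s M 0 (missing f X s.tgt * innerCost k d)
      fun s' M' => WalkInv f X s₀ s' ∧ AgreeOff (walkRegs k d) M₀ M' ∧
        X ⊆ atLeast f s'.tgt := by
  induction hN : missing f X s.tgt using Nat.strong_induction_on generalizing s M with
  | _ N ih =>
    by_cases hc : X ⊆ atLeast f s.tgt
    · exact (Runs.loop_done (by simp [hsub.mpr hc]) ⟨hw, hoff, hc⟩).weaken (Nat.zero_le _)
        (Nat.zero_le _)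
    · have hPc : M .Pc = X := (hoff _ (by simp)).trans hX
      have hstep := runs_innerStep (Pre := Pre) hk ((hoff .vert (by simp)).trans hvert)
        (hoff.encodes (by simp [Reg.IsAux]) hM₀) hS (hPc ▸ hc)
      refine (Runs.loop_step (m' := 0) (B' := (N - 1) * innerCost k d) (by
        simp [Bool.eq_false_iff.mpr (mt hsub.mp hc)]) hstep fun s' M' h => ?_).weaken le_rfl ?_
      · rw [hPc] at h
        obtain ⟨hs, hoff', hS', hsub'⟩ := h
        have hlt : missing f X s'.tgt < N := hN ▸ missing_lt hs.tgt_lt hc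
        refine (ih _ hlt s' M' (hw.step hc hs) ?_ hS' hsub' rfl).weaken le_rfl
          (Nat.mul_le_mul_right _ (by omega))
        exact (hoff.trans hoff').mono (by simp)
      · have : 0 < N := hN ▸ (Nat.zero_le _).trans_lt
          (missing_lt (bot_lt_iff_ne_bot.mpr fun h => hc (by
            rw [h, atLeast_bot]; exact Set.subset_univ _)) hc)
        rw [Nat.add_comm, ← Nat.add_one_mul, Nat.sub_add_cancel this]

theorem raise_union_atLeast (f : V → Rank k d) (r : Rank k d) (X : Set V) :
    raise f r (atLeast f r ∪ X) = raise f r X := by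
  funext v
  by_cases hX : v ∈ X
  · rw [raise_of_mem hX, raise_of_mem (Set.mem_union_right _ hX)]
  · rw [raise_of_notMem hX]
    by_cases hv : v ∈ atLeast f r
    · rw [raise_of_mem (Set.mem_union_left _ hv), max_eq_right hv]
    · exact raise_of_notMem fun h => h.elim hv hX

/-- The effect of processing a priority, where the vertices in `X` get at least the rank `r`. -/
structure PriorityStep (f : V → Rank k d) (r : Rank k d) (X : Set V) (s s' : Store k d) :
    Prop where
  cur : s'.cur = s.cur
  range : ∀ v, raise f r X v ∈ s'.tree
  mem_or : ∀ q ∈ s'.tree, q ∈ s'.active ∨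
    (q ∈ s.tree ∧ q ∉ s.active ∧ atLeast (raise f r X) q = atLeast f q)
  length_le : s'.active.length ≤ s.active.length + missing f X r

/-- A key left inactive has an unchanged upper set: above `old` the raise has no effect, up to the
final target all of `X` was included before, and every key in between is active. -/
theorem WalkInv.priorityStep {f : V → Rank k d} {X : Set V} {s₀ s : Store k d}
    (h : WalkInv f X s₀ s) (hX : X ⊆ atLeast f s.tgt) (h₀ : ∀ v, f v ∈ s₀.tree) :
    PriorityStep f s.old X s₀ s where
  cur := h.cur
  range v := by
    rcases h.range v with hv | ⟨hv, ht, he⟩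
    · exact hv
    · have : raise f s.old X v = f v := by
        by_cases hvX : v ∈ X
        · rw [raise_of_mem hvX]
          exact max_eq_right (ht ▸ hX hvX)
        · exact raise_of_notMem hvX
      rw [this, he]
      exact h₀ v
  mem_or q hq := by
    by_cases hqa : q ∈ s.active
    · exact Or.inl hqa
    · refine Or.inr ⟨(h.mem_or q hq).resolve_right hqa,
        fun hq₀ => hqa (h.active_old q hq hq₀), ?_⟩
      refine Set.Subset.antisymm (fun v hv => ?_) fun v hv => le_trans hv (le_raise f _ _ v)
      by_cases hvX : v ∈ X
      · have hv : q ≤ raise f s.old X v := hv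
        rw [raise_of_mem hvX] at hv
        rcases le_max_iff.mp hv with hle | hle
        · by_cases hqt : q ≤ s.tgt
          · exact hqt.trans (hX hvX)
          · exact absurd (h.active_of_lt q hq (not_le.mp hqt) hle) hqa
        · exact hle
      · have hv : q ≤ raise f s.old X v := hv
        rwa [raise_of_notMem hvX] at hv
  length_le := by
    have := h.length_le
    omega

end Walk

/-! ### The outer loop: partial correctness and amortised costs. -/

section Main

variable {V : Type*} {k d : ℕ} {G : ParityGame V d}

/-- The number of basic set operations of `processPriority` outside of the inner loop. -/
def priorityCost (k d : ℕ) : ℕ := getSetCost k d + 3 + updateSetCost k d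

/-- The encoding keeps representing `f` during the inner loop; all ranks change in the single final
update. That `Sold` also contains the old upper set does not matter, by `raise_union_atLeast`. -/
theorem runs_processPriority {M : Reg k d → Set V} {f : V → Rank k d} {s : Store k d} (c : Fin d)
    (hk : 0 < k) (hI : HoldsInput G M) (hM : Encodes M f) (hf : ∀ v, f v ∈ s.tree) {X : Set V}
    (hX : M .P ∩ {v | G.prio v = c} = X) :
    Runs G.pre (processPriority c) s M 0
      (priorityCost k d + missing f X (lift s.cur c) * innerCost k d) fun s' M' =>
        PriorityStep f (lift s.cur c) X s s' ∧ HoldsInput G M' ∧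
          Encodes M' (raise f (lift s.cur c) X) ∧ M' .P = M .P := by
  unfold priorityCost
  refine (Runs.cons_assign (Runs.cons (m' := 0) (B' := 3 + updateSetCost k d +
    missing f X (lift s.cur c) * innerCost k d) (runs_getSet (dst := .S) _ hk hI.vert hM trivial
      (by simp) (by simp)) ?_)).weaken le_rfl (by omega)
  rintro s₁ M₁ ⟨rfl, hS, hoff₁⟩
  refine (Runs.cons_assign (Runs.cons_inter (Runs.cons_union (Runs.cons_test
    (B := updateSetCost k d + missing f X (lift s.cur c) * innerCost k d)
    fun a ha => ?_)))).weaken le_rfl (by omega)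
  have hoff₂ := (hoff₁.trans (agreeOff_update M₁ .Pc (M₁ .P ∩ M₁ (.vPrio c)))).trans
    (agreeOff_update _ .Sold (Function.update M₁ .Pc (M₁ .P ∩ M₁ (.vPrio c)) .S ∪
      Function.update M₁ .Pc (M₁ .P ∩ M₁ (.vPrio c)) .Pc))
  have hPc : M₁ .P ∩ M₁ (.vPrio c) = X := by
    rw [hoff₁ _ (by simp), hoff₁ _ (by simp), hI.vPrio, hX]
  have hSold : (Function.update (Function.update M₁ .Pc (M₁ .P ∩ M₁ (.vPrio c))) .Sold
      (Function.update M₁ .Pc (M₁ .P ∩ M₁ (.vPrio c)) .S ∪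
      Function.update M₁ .Pc (M₁ .P ∩ M₁ (.vPrio c)) .Pc)) .Sold =
        atLeast f (lift s.cur c) ∪ X := by
    rw [Function.update_self, Function.update_self, Function.update_of_ne (by simp), hS, hPc]
  have hPc₂ : (Function.update (Function.update M₁ .Pc (M₁ .P ∩ M₁ (.vPrio c))) .Sold
      (Function.update M₁ .Pc (M₁ .P ∩ M₁ (.vPrio c)) .S ∪
      Function.update M₁ .Pc (M₁ .P ∩ M₁ (.vPrio c)) .Pc)) .Pc = X := by
    rw [Function.update_of_ne (by simp), Function.update_self, hPc]
  have hS₂ : (Function.update (Function.update M₁ .Pc (M₁ .P ∩ M₁ (.vPrio c))) .Sold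
      (Function.update M₁ .Pc (M₁ .P ∩ M₁ (.vPrio c)) .S ∪
      Function.update M₁ .Pc (M₁ .P ∩ M₁ (.vPrio c)) .Pc)) .S = atLeast f (lift s.cur c) := by
    rw [Function.update_of_ne (by simp), Function.update_of_ne (by simp), hS]
  generalize Function.update (Function.update M₁ .Pc (M₁ .P ∩ M₁ (.vPrio c))) .Sold
      (Function.update M₁ .Pc (M₁ .P ∩ M₁ (.vPrio c)) .S ∪
      Function.update M₁ .Pc (M₁ .P ∩ M₁ (.vPrio c)) .Pc) = M₂ at hoff₂ hSold hPc₂ hS₂ ha ⊢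
  have hI₂ : HoldsInput G M₂ := hoff₂.holdsInput (by simp [Reg.IsAux]) hI
  have hM₂ : Encodes M₂ f := hoff₂.encodes (by simp [Reg.IsAux]) hM
  have ha : a = true ↔ X ⊆ atLeast f (lift s.cur c) := by
    rw [ha, ← hPc₂, ← hS₂]
    rfl
  obtain ⟨s₀, hs₀⟩ : ∃ s₀ : Store k d,
      s₀ = { s with tgt := lift s.cur c, old := lift s.cur c, sub := a } := ⟨_, rfl⟩
  change Runs G.pre _ { s with tgt := lift s.cur c, old := lift s.cur c, sub := a } _ _ _ _
  rw [← hs₀]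
  have h1 : s₀.tgt = lift s.cur c := by rw [hs₀]
  have h2 : s₀.old = lift s.cur c := by rw [hs₀]
  have h3 : s₀.tree = s.tree := by rw [hs₀]
  have h4 : s₀.active = s.active := by rw [hs₀]
  have h5 : s₀.cur = s.cur := by rw [hs₀]
  have h6 : s₀.sub = a := by rw [hs₀]
  clear hs₀
  have hf₀ : ∀ v, f v ∈ s₀.tree := fun v => h3 ▸ hf v
  refine (Runs.cons (m' := 0) (B' := updateSetCost k d) (runs_innerLoop (Pre := G.pre) hk
    hI₂.vert hM₂ hPc₂ s₀ M₂ (WalkInv.init (h1.trans h2.symm) hf₀) (fun _ _ => rfl)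
    (by rw [hS₂, h1]) (by rw [h6, ha, h1])) ?_).weaken le_rfl
    (by rw [h1]; exact (Nat.add_comm _ _).le)
  rintro s' M₃ ⟨hw, hoff₃, hsub⟩
  have hstep := hw.priorityStep hsub hf₀
  have hold : s'.old = lift s.cur c := hw.old.trans h2
  rw [hold] at hstep
  have hI₃ : HoldsInput G M₃ := hoff₃.holdsInput (by simp [Reg.IsAux]) hI₂
  have hM₃ : Encodes M₃ f := hoff₃.encodes (by simp [Reg.IsAux]) hM₂
  refine (Runs.cons (m' := 0) (B' := 0) (runs_updateSet (Pre := G.pre) (src := .Sold) _ hk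
    hI₃.vert hM₃ (by simp) (by simp) (by simp)) ?_).weaken le_rfl le_rfl
  rintro s' M₄ ⟨rfl, hM₄, hfr⟩
  refine Runs.nil ⟨⟨hstep.cur.trans h5, hstep.range, fun q hq => ?_, ?_⟩, ?_, ?_, ?_⟩
  · have := hstep.mem_or q hq
    rwa [h3, h4] at this
  · rw [← h4]
    exact hstep.length_le
  · exact ⟨(hfr _ (by simp) (by simp)).trans hI₃.vert, (hfr _ (by simp) (by simp)).trans hI₃.vEven,
      (hfr _ (by simp) (by simp)).trans hI₃.vOdd,
      fun c => (hfr _ (by simp) (by simp)).trans (hI₃.vPrio c)⟩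
  · rwa [hold, hoff₃ _ (by simp), hSold, raise_union_atLeast] at hM₄
  · rw [hfr _ (by simp) (by simp), hoff₃ _ (by simp), hoff₂ _ (by simp)]

section Potential

variable [Fintype V]

open Classical in
/-- The sum of the heights of the ranks of all vertices. -/
noncomputable def potential (f : V → Rank k d) : ℕ :=
  (Finset.univ.filter fun p : V × Rank k d => p.2 ≤ f p.1).card

theorem potential_le (f : V → Rank k d) :
    potential f ≤ Fintype.card V * Fintype.card (Rank k d) := by
  classical
  rw [← Fintype.card_prod]
  exact Finset.card_le_univ _

/-- For each missing rank `q` some vertex of `X` is not above `q` before the raise but is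
afterwards. The resulting new pairs have different second components. -/
theorem potential_add_missing_le (f : V → Rank k d) (X : Set V) (r : Rank k d) :
    potential f + missing f X r ≤ potential (raise f r X) := by
  classical
  rcases isEmpty_or_nonempty V with hV | ⟨⟨v₀⟩⟩
  · have : missing f X r = 0 := by
      rw [missing, Finset.card_eq_zero, Finset.filter_eq_empty_iff]
      exact fun q _ h => h.2 fun v => hV.elim v
    rw [this, Nat.add_zero, Subsingleton.elim (raise f r X) f]
  have hch : ∀ q, ∃ v : V, ¬ X ⊆ atLeast f q → v ∈ X ∧ ¬ q ≤ f v := fun q => by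
    by_cases h : X ⊆ atLeast f q
    · exact ⟨v₀, fun h' => absurd h h'⟩
    · obtain ⟨v, hv, hq⟩ := Set.not_subset.mp h
      exact ⟨v, fun _ => ⟨hv, hq⟩⟩
  choose u hu using hch
  rw [missing, ← Finset.card_image_of_injective (f := fun q => (u q, q)) _
    fun a b h => (Prod.mk.inj h).2, potential, potential, ← Finset.card_union_of_disjoint]
  · refine Finset.card_le_card fun p hp => ?_
    rcases Finset.mem_union.mp hp with hp | hp
    · simp only [Finset.mem_filter, Finset.mem_univ, true_and] at hp ⊢
      exact hp.trans (le_raise f r X p.1)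
    · obtain ⟨q, hq, rfl⟩ := Finset.mem_image.mp hp
      simp only [Finset.mem_filter, Finset.mem_univ, true_and] at hq ⊢
      rw [raise_of_mem (hu q hq.2).1]
      exact hq.1.trans (le_max_left _ _)
  · rw [Finset.disjoint_left]
    rintro p hp hp'
    obtain ⟨q, hq, rfl⟩ := Finset.mem_image.mp hp'
    simp only [Finset.mem_filter, Finset.mem_univ, true_and] at hp hq
    exact (hu q hq.2).2 hp

end Potential

/-- All vertices that `even` can force into `S_{⪰ r}` have a rank that reflects it. -/
def IsClosedRank (G : ParityGame V d) (f : V → Rank k d) (r : Rank k d) : Prop :=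
  ∀ v ∈ G.cpre (atLeast f r), lift r (G.prio v) ≤ f v

variable [Fintype V]

/-- The invariant of the outer loop. -/
structure OuterInv (G : ParityGame V d) (f : V → Rank k d) (s : Store k d)
    (M : Reg k d → Set V) : Prop where
  input : HoldsInput G M
  encodes : Encodes M f
  range : ∀ v, f v ∈ s.tree
  least : ∀ g : V → Rank k d, G.IsPrefixed g → f ≤ g
  closed : ∀ q ∈ s.tree, q ∈ s.active ∨ IsClosedRank G f q

/-- The invariant of the loop over the priorities, where the rank `r` is processed, `P` is the set
of its controllable predecessors, and `l` lists the remaining priorities. -/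
structure PriorityInv (G : ParityGame V d) (r : Rank k d) (P : Set V) (l : List (Fin d))
    (f : V → Rank k d) (s : Store k d) (M : Reg k d → Set V) : Prop where
  input : HoldsInput G M
  encodes : Encodes M f
  range : ∀ v, f v ∈ s.tree
  least : ∀ g : V → Rank k d, G.IsPrefixed g → f ≤ g
  cpre : M .P = P
  cur : s.cur = r
  bound : ∀ g : V → Rank k d, G.IsPrefixed g → ∀ v ∈ P, lift r (G.prio v) ≤ g v
  closed : ∀ q ∈ s.tree, q ∈ s.active ∨ IsClosedRank G f q ∨
    (q = r ∧ P = G.cpre (atLeast f r) ∧ ∀ v ∈ P, G.prio v ∉ l → lift r (G.prio v) ≤ f v)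

/-- The set `P` is computed only once although `f` changes. Validity of the raise rests on `bound`,
which does not mention `f`; and if the upper set of `r` changes, `r` becomes active again or is no
longer a key, so no claim about it is needed. -/
theorem PriorityInv.step {r : Rank k d} {P : Set V} {c : Fin d} {l : List (Fin d)}
    {f : V → Rank k d} {s s' : Store k d} {M M' : Reg k d → Set V}
    (h : PriorityInv G r P (c :: l) f s M) {X : Set V} (hX : P ∩ {v | G.prio v = c} = X)
    (hs : PriorityStep f (lift r c) X s s') (hI : HoldsInput G M')
    (hM : Encodes M' (raise f (lift r c) X)) (hP : M' .P = M .P) :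
    PriorityInv G r P l (raise f (lift r c) X) s' M' where
  input := hI
  encodes := hM
  range := hs.range
  least g hg v := by
    by_cases hv : v ∈ X
    · rw [raise_of_mem hv]
      rw [← hX] at hv
      exact max_le (hv.2 ▸ h.bound g hg v hv.1) (h.least g hg v)
    · rw [raise_of_notMem hv]
      exact h.least g hg v
  cpre := hP.trans h.cpre
  cur := hs.cur.trans h.cur
  bound := h.bound
  closed q hq := by
    rcases hs.mem_or q hq with hq | ⟨hq, hqa, he⟩
    · exact Or.inl hq
    · rcases (h.closed q hq).resolve_left hqa with hc | ⟨rfl, hPc, hc⟩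
      · refine Or.inr (Or.inl fun v hv => ?_)
        rw [he] at hv
        exact (hc v hv).trans (le_raise _ _ _ v)
      · refine Or.inr (Or.inr ⟨rfl, by rwa [he], fun v hv hvl => ?_⟩)
        by_cases hvc : G.prio v = c
        · rw [raise_of_mem (hX ▸ ⟨hv, hvc⟩), hvc]
          exact le_max_left _ _
        · exact (hc v hv (by simp [hvc, hvl])).trans (le_raise _ _ _ v)

/-- Costs and list lengths are compared together with the potentials before and after, so that the
estimates telescope along the list. -/
theorem exists_exec_priorities (hk : 0 < k) {r : Rank k d} {P : Set V} (l : List (Fin d))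
    {f : V → Rank k d} {s : Store k d} {M : Reg k d → Set V} (h : PriorityInv G r P l f s M) :
    ∃ s' M' f' b, Exec G.pre (Prog.forEach l processPriority) (s, M) (s', M') 0 b ∧
      b + innerCost k d * potential f ≤
        l.length * priorityCost k d + innerCost k d * potential f' ∧
      s'.active.length + potential f ≤ s.active.length + potential f' ∧
      PriorityInv G r P [] f' s' M' := by
  induction l generalizing f s M with
  | nil => exact ⟨s, M, f, 0, .skip _, by simp, le_rfl, h⟩
  | cons c l ih =>
    have hX : M .P ∩ {v | G.prio v = c} = P ∩ {v | G.prio v = c} := by rw [h.cpre]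
    obtain ⟨s₁, M₁, m₁, b₁, he₁, hm₁, hb₁, hs, hI, hM, hP⟩ :=
      runs_processPriority c hk h.input h.encodes h.range hX
    rw [h.cur] at hb₁ hs hM
    obtain ⟨s₂, M₂, f₂, b₂, he₂, hb₂, hl₂, h₂⟩ := ih (h.step rfl hs hI hM hP)
    have hm₁ : m₁ = 0 := Nat.le_zero.mp hm₁
    subst hm₁
    have hpot := potential_add_missing_le f (P ∩ {v | G.prio v = c}) (lift r c)
    have hl := hs.length_le
    refine ⟨s₂, M₂, f₂, b₁ + b₂, .seq he₁ he₂, ?_, by omega, h₂⟩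
    have := Nat.mul_le_mul_left (innerCost k d) hpot
    rw [Nat.mul_add, Nat.mul_comm _ (missing _ _ _)] at this
    rw [List.length_cons, Nat.add_one_mul]
    omega

/-- The body of the outer loop. -/
noncomputable def outerStep (k d : ℕ) : OPMProg k d :=
  Prog.block [
    .assign Store.popActive,
    getSet .S Store.cur,
    .assign (fun s => s.deactivate s.cur),
    controllablePre,
    .forEach (List.finRange d) processPriority]

/-- The number of basic set operations of `outerStep` outside of the inner loops. -/
def outerCost (k d : ℕ) : ℕ := getSetCost k d + 4 + d * priorityCost k d

theorem exists_exec_outerStep (hk : 0 < k) {f : V → Rank k d} {s : Store k d}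
    {M : Reg k d → Set V} (h : OuterInv G f s M) (hact : s.active ≠ []) :
    ∃ s' M' f' m b, Exec G.pre (outerStep k d) (s, M) (s', M') m b ∧ m ≤ 2 ∧
      b + innerCost k d * potential f ≤ outerCost k d + innerCost k d * potential f' ∧
      s'.active.length + 1 + potential f ≤ s.active.length + potential f' ∧
      OuterInv G f' s' M' := by
  obtain ⟨r, rs, hrs⟩ := List.exists_cons_of_ne_nil hact
  have hpop : s.popActive = { s with cur := r, active := rs } := by
    rw [Store.popActive, hrs]
  obtain ⟨_, M₁, m₁, b₁, he₁, hm₁, hb₁, rfl, hS, hoff₁⟩ := runs_getSet (Pre := G.pre) (dst := .S)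
    (s := s.popActive) Store.cur hk h.input.vert h.encodes trivial (by simp) (by simp)
  have hI₁ : HoldsInput G M₁ := hoff₁.holdsInput (by simp [Reg.IsAux]) h.input
  obtain ⟨_, M₂, m₂, b₂, he₂, hm₂, hb₂, rfl, hP, hoff₂⟩ := runs_controllablePre
    (s := s.popActive.deactivate s.popActive.cur) hI₁
  have hcur : s.popActive.cur = r := by rw [hpop]
  have hactive : (s.popActive.deactivate s.popActive.cur).active = rs.filter fun q => q ≠ r := by
    rw [hpop]
    rfl
  have htree : (s.popActive.deactivate s.popActive.cur).tree = s.tree := by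
    rw [hpop]
    rfl
  rw [hS, hcur] at hP
  obtain ⟨s₃, M₃, f₃, b₃, he₃, hb₃, hl₃, h₃⟩ := exists_exec_priorities (G := G) hk (r := r)
    (P := G.cpre (atLeast f r)) (List.finRange d) (f := f)
    (s := s.popActive.deactivate s.popActive.cur) (M := M₂)
    { input := hoff₂.holdsInput (by simp [Reg.IsAux]) hI₁
      encodes := (hoff₁.trans hoff₂).encodes (by simp [Reg.IsAux]) h.encodes
      range := fun v => htree ▸ h.range v
      least := h.least
      cpre := hP
      cur := hcur
      bound := fun g hg v hv => (lift_mono ((ParityGame.mem_cpre_iff.mp hv).trans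
        (ParityGame.best_mono (h.least g hg) v)) _).trans (hg v)
      closed := fun q hq => by
        rw [htree] at hq
        rcases h.closed q hq with hq | hq
        · by_cases hqr : q = r
          -- The rank just taken off the list is the one being processed; with all priorities still
          -- to come, nothing is claimed about its consequences yet.
          · exact Or.inr (Or.inr ⟨hqr, rfl, fun v _ hv => absurd (List.mem_finRange _) hv⟩)
          · rw [hrs] at hq
            rw [hactive]
            exact Or.inl (List.mem_filter.mpr
              ⟨(List.mem_cons.mp hq).resolve_left hqr, by simpa using hqr⟩)
        · exact Or.inr (Or.inl hq) }
  refine ⟨s₃, M₃, f₃, _, _, .seq (.assign ..) (.seq he₁ (.seq (.assign ..) (.seq he₂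
    (.seq he₃ (.skip _))))), by omega, ?_, ?_, h₃.input, h₃.encodes, h₃.range, h₃.least,
    fun q hq => ?_⟩
  · rw [List.length_finRange] at hb₃
    unfold outerCost
    omega
  · rw [hactive] at hl₃
    have := List.length_filter_le (fun q => decide (q ≠ r)) rs
    rw [hrs, List.length_cons]
    omega
  · rcases h₃.closed q hq with hq | hq | ⟨rfl, hPc, hc⟩
    · exact Or.inl hq
    · exact Or.inr hq
    · exact Or.inr fun v hv => hc v (hPc ▸ hv) (by simp)

/-- Every iteration lowers the number of active ranks plus the remaining potential `Z - potential
f`, which bounds the number of iterations. The inner loops are charged separately to the growth of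
the potential. -/
theorem exists_exec_outerLoop (hk : 0 < k) {Z : ℕ} (hZ : ∀ f : V → Rank k d, potential f ≤ Z)
    {f : V → Rank k d} {s : Store k d} {M : Reg k d → Set V} (h : OuterInv G f s M) :
    ∃ s' M' f' m b, Exec G.pre (.loop (fun s => !s.active.isEmpty) (outerStep k d))
        (s, M) (s', M') m b ∧ m ≤ 2 * (s.active.length + (Z - potential f)) ∧
      b ≤ outerCost k d * (s.active.length + (Z - potential f)) +
        innerCost k d * (Z - potential f) ∧
      OuterInv G f' s' M' ∧ s'.active = [] := by
  induction hμ : s.active.length + (Z - potential f) using Nat.strong_induction_on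
    generalizing f s M with
  | _ μ ih =>
    by_cases hact : s.active = []
    · exact ⟨s, M, f, 0, 0, .loopDone (by simp [hact]), Nat.zero_le _, Nat.zero_le _, h, hact⟩
    · obtain ⟨s₁, M₁, f₁, m₁, b₁, he₁, hm₁, hb₁, hl₁, h₁⟩ := exists_exec_outerStep hk h hact
      have hZf := hZ f
      have hZf₁ := hZ f₁
      have hlen : 0 < s.active.length := List.length_pos_iff.mpr hact
      obtain ⟨s₂, M₂, f₂, m₂, b₂, he₂, hm₂, hb₂, h₂, hact₂⟩ :=
        ih (s₁.active.length + (Z - potential f₁)) (by omega) h₁ rfl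
      refine ⟨s₂, M₂, f₂, _, _, .loopStep (by simpa using hact) he₁ he₂, by omega, ?_, h₂, hact₂⟩
      have e1 : outerCost k d * (s₁.active.length + (Z - potential f₁)) + outerCost k d ≤
          outerCost k d * μ := by
        rw [← Nat.mul_add_one]
        exact Nat.mul_le_mul_left _ (by omega)
      have e2 : innerCost k d * (Z - potential f₁) + innerCost k d * potential f₁ =
          innerCost k d * (Z - potential f) + innerCost k d * potential f := by
        rw [← Nat.mul_add, ← Nat.mul_add, Nat.sub_add_cancel hZf, Nat.sub_add_cancel hZf₁]
      omega

theorem runs_setupRanks {M : Reg k d → Set V} {s : Store k d} (hI : HoldsInput G M) :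
    Runs G.pre setupRanks s M 0 (k * (d + 1) + 1) fun s' M' =>
      s'.active.length = 1 ∧ OuterInv G (fun _ => (⊥ : Rank k d)) s' M' := by
  let I : ℕ → Store k d → (Reg k d → Set V) → Prop := fun m s' M' =>
    s' = s ∧ (∀ R : Reg k d, (∀ i x, R ≠ .C i x) → M' R = M R) ∧
      ∀ (i : Fin k) x, (i : ℕ) < m → M' (.C i x) = {_v | x = .blank}
  refine (Runs.cons (m' := 0) (B' := 1) (Runs.forEach_finRange I (m := 0) (B := d + 1) ?_ ?_)
    ?_).weaken (by simp) le_rfl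
  · rintro i s' M₁ ⟨rfl, hoff, hC⟩
    let J : List (Entry d) → Store k d → (Reg k d → Set V) → Prop := fun l s'' M'' =>
      s'' = s' ∧ (∀ R, (∀ x, R ≠ .C i x) → M'' R = M₁ R) ∧
        ∀ x, x ∉ l → M'' (.C i x) = {_v | x = .blank}
    refine (Runs.forEach (Entry.nodup_all d) J (m := 0) (B := 1) ?_ ?_).mono (by simp)
      (by rw [Entry.length_all]; omega) ?_
    · rintro x l s'' M'' hxl ⟨rfl, hoff', hC'⟩
      have hv : M'' .vert = Set.univ := by
        rw [hoff' _ (by simp), hoff _ (by simp), hI.vert]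
      have key : ∀ S : Set V, S = {_v | x = .blank} →
          J l s'' (Function.update M'' (.C i x) S) := by
        rintro _ rfl
        refine ⟨rfl, fun R hR => ?_, fun y hy => ?_⟩
        · rw [Function.update_of_ne (hR x), hoff' R hR]
        · by_cases hyx : y = x
          · subst hyx
            rw [Function.update_self]
          · rw [Function.update_of_ne (by simpa using hyx), hC' y (by simp [hyx, hy])]
      by_cases hx : x = .blank
      · simp only [hx, if_true]
        refine .union ?_
        rw [← hx]
        exact key _ (by simp [hv, hx])
      · simp only [hx, if_false]
        exact .diff (key _ (by simp [hx]))
    · exact ⟨rfl, fun _ _ => rfl, fun x hx => absurd (Entry.mem_all x) hx⟩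
    · rintro s'' M'' ⟨rfl, hoff', hC'⟩
      refine ⟨rfl, fun R hR => (hoff' R fun x => hR i x).trans (hoff R hR), fun j x hj => ?_⟩
      by_cases hji : j = i
      · subst hji
        exact hC' x (by simp)
      · have : (j : ℕ) ≠ i := fun h => hji (Fin.ext h)
        rw [hoff' _ (by simp [hji]), hC j x (by omega)]
  · exact ⟨rfl, fun _ _ => rfl, fun i x hi => absurd hi (Nat.not_lt_zero _)⟩
  rintro s₁ M₁ ⟨rfl, hoff, hC⟩
  have hne : (⊤ : Rank k d) ≠ ⊥ := 
    (WithTop.coe_ne_top : ((⊥ : Tuple k d) : Rank k d) ≠ ⊤).symm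
  have hfr : ∀ R : Reg k d, (∀ i x, R ≠ .C i x) → R ≠ .Ctop →
      Function.update M₁ .Ctop (M₁ .vert \ M₁ .vert) R = M R := fun R hR hR' => by
    rw [Function.update_of_ne hR', hoff R hR]
  refine Runs.cons_diff (Runs.cons_assign (Runs.nil ⟨rfl, ⟨?_, ?_, ?_, fun g _ v => bot_le, ?_⟩⟩))
  · exact ⟨(hfr _ (by simp) (by simp)).trans hI.vert, (hfr _ (by simp) (by simp)).trans hI.vEven,
      (hfr _ (by simp) (by simp)).trans hI.vOdd,
      fun c => (hfr _ (by simp) (by simp)).trans (hI.vPrio c)⟩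
  · refine ⟨fun i x => ?_, ?_⟩
    · rw [Function.update_of_ne (by simp), hC i x i.2]
      ext v
      constructor
      · intro h
        exact ⟨⊥, rfl, h.symm⟩
      · rintro ⟨b, hb, rfl⟩
        cases WithTop.coe_injective (hb : ((⊥ : Tuple k d) : Rank k d) = b)
        rfl
    · rw [Function.update_self]
      ext v
      simp [hne.symm]
  · intro v
    exact Finset.mem_insert_self _ _
  · intro q hq
    rcases Finset.mem_insert.mp hq with rfl | hq
    · exact Or.inl (List.mem_singleton.mpr rfl)
    · rw [Finset.mem_singleton] at hq
      subst hq
      -- The key `⊤` need not be active: all ranks are `⊥`, so its upper set has no controllable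
      -- predecessors.
      refine Or.inr fun v hv => ?_
      obtain ⟨w, _, hw⟩ := G.exists_best_eq (fun _ => (⊥ : Rank k d)) v
      have := ParityGame.mem_cpre_iff.mp hv
      rw [hw] at this
      exact absurd (top_le_iff.mp this) hne.symm

/-- The value `best f v` is the rank of a successor, hence a key, hence closed when nothing is
active; and `v` is a controllable predecessor of its upper set. -/
theorem OuterInv.isPrefixed {f : V → Rank k d} {s : Store k d} {M : Reg k d → Set V}
    (h : OuterInv G f s M) (hact : s.active = []) : G.IsPrefixed f := fun v => by
  obtain ⟨w, _, hw⟩ := G.exists_best_eq f v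
  have := (h.closed (G.best f v) (hw ▸ h.range w)).resolve_left (by simp [hact])
  exact this v (ParityGame.mem_cpre_iff.mpr le_rfl)

/-- The result of the algorithm with the precise bounds for the numbers of operations. -/
theorem exists_exec_reducedSpaceOPM (hk : Fintype.card V < 2 ^ k) (hk₀ : 0 < k) {Z : ℕ}
    (hZ : Z = Fintype.card V * Fintype.card (Rank k d)) (s₀ : Store k d) {M₀ : Reg k d → Set V}
    (hI : HoldsInput G M₀) :
    ∃ s M m b, Exec G.pre (reducedSpaceOPM k d) (s₀, M₀) (s, M) m b ∧
      M .S = G.winningSet .even ∧ (∃ f : V → Rank k d, G.IsProgressMeasure f ∧ Encodes M f) ∧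
      m ≤ 2 * (1 + Z) ∧ b ≤ k * (d + 1) + 1 + outerCost k d * (1 + Z) + innerCost k d * Z +
        getSetCost k d := by
  obtain ⟨s₁, M₁, m₁, b₁, he₁, hm₁, hb₁, hl, h₁⟩ := runs_setupRanks (s := s₀) hI
  obtain ⟨s₂, M₂, f, m₂, b₂, he₂, hm₂, hb₂, h₂, hact⟩ :=
    exists_exec_outerLoop hk₀ (fun f => hZ ▸ potential_le f) h₁
  obtain ⟨_, M₃, m₃, b₃, he₃, hm₃, hb₃, rfl, hS, hoff⟩ := runs_getSet (Pre := G.pre) (dst := .S)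
    (s := s₂) (fun _ => ⊤) hk₀ h₂.input.vert h₂.encodes trivial (by simp) (by simp)
  have hpre := h₂.isPrefixed hact
  rw [hl] at hm₂ hb₂
  have hsub : ∀ p : ℕ, Z - p ≤ Z := fun p => Nat.sub_le Z p
  refine ⟨_, M₃, _, _, .seq he₁ (.seq he₂ (.seq he₃ (.skip _))), ?_, ⟨f,
    ParityGame.isProgressMeasure_of_isLeast hpre h₂.least,
    hoff.encodes (by simp [Reg.IsAux]) h₂.encodes⟩, by omega, ?_⟩
  · rw [hS, ← ParityGame.top_eq_winningSet hk hpre h₂.least]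
    ext v
    exact top_le_iff (a := f v)
  · refine Nat.le_trans (Nat.add_le_add hb₁ (Nat.add_le_add (hb₂.trans (Nat.add_le_add
      (Nat.mul_le_mul_left _ (Nat.add_le_add_left (hsub _) 1))
      (Nat.mul_le_mul_left _ (hsub _)))) (Nat.add_le_add_right hb₃ 0))) (by omega)

end Main

/-! ### Constants and the final bounds. -/

theorem costs_le {k d : ℕ} (hk : 0 < k) (hd : 0 < d) :
    getSetCost k d ≤ 9 * (k * d) ∧ innerCost k d ≤ 33 * (k * d) ∧
      outerCost k d ≤ 40 * (k * d * d) := by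
  have h1 : k ≤ k * d := Nat.le_mul_of_pos_right k hd
  have h2 : 1 ≤ k * d := Nat.mul_pos hk hd
  have hg : getSetCost k d ≤ 9 * (k * d) := by
    unfold getSetCost
    rw [Nat.mul_add]
    omega
  have hu : updateSetCost k d ≤ 14 * (k * d) := by
    unfold updateSetCost
    rw [Nat.mul_add k d 2]
    omega
  have hp : priorityCost k d ≤ 26 * (k * d) := by
    unfold priorityCost
    omega
  refine ⟨hg, by unfold innerCost; omega, ?_⟩
  have h3 : d * priorityCost k d ≤ 26 * (k * d * d) := by
    have := Nat.mul_le_mul_left d hp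
    linarith [Nat.mul_comm d (k * d)]
  have h4 : k * d ≤ k * d * d := Nat.le_mul_of_pos_right _ hd
  unfold outerCost
  omega

end SymbolicParity

open SymbolicParity in
theorem mainTheorem3 :
    ∃ K : ℝ, ∀ (d : ℕ) (V : Type*) [Fintype V] [Nonempty V] (G : ParityGame V d)
      (k n w : ℕ), n = Fintype.card V → k = width n → w = Fintype.card (Rank k d) →
      ∀ (s₀ : Store k d) (M₀ : Reg k d → Set V), HoldsInput G M₀ →
      ∃ (s : Store k d) (M : Reg k d → Set V) (oneStep basic : ℕ),
        Exec G.pre (reducedSpaceOPM k d) (s₀, M₀) (s, M) oneStep basic ∧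
        M .S = G.winningSet .even ∧
        (M .S)ᶜ = G.winningSet .odd ∧
        (∃ f : V → Rank k d, G.IsProgressMeasure f ∧ Encodes M f) ∧
        (oneStep : ℝ) ≤ K * (n * w) ∧
        (2 ≤ n → (basic : ℝ) ≤ K * (d ^ 2 * n * w * Real.logb 2 n)) ∧
        (2 ≤ n → (Fintype.card (Reg k d) : ℝ) ≤ K * (d * Real.logb 2 n)) := by
  -- The basic operations decide: `125 * k * d ^ 2 * n * w`, with `k ≤ 2 * logb 2 n` for `n ≥ 2`.
  refine ⟨250, ?_⟩
  intro d V _ _ G k n w hn hk hw s₀ M₀ hI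
  have hk₀ : 0 < k := hk ▸ Nat.succ_pos _
  have hnk : Fintype.card V < 2 ^ k := by
    rw [hk, ← hn]
    exact Nat.lt_pow_succ_log_self one_lt_two n
  have hd : 0 < d := (Nat.zero_le _).trans_lt (G.prio (Classical.arbitrary V)).2
  have hnw : 1 ≤ n * w := by
    rw [hn, hw]
    exact Nat.mul_pos Fintype.card_pos Fintype.card_pos
  obtain ⟨s, M, m, b, he, hS, hf, hm, hb⟩ :=
    exists_exec_reducedSpaceOPM (Z := n * w) hnk hk₀ (by rw [hn, hw]) s₀ hI
  obtain ⟨hg, hi, ho⟩ := costs_le hk₀ hd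
  have hlog : 2 ≤ n → (1 : ℝ) ≤ Real.logb 2 n ∧ (k : ℝ) ≤ 2 * Real.logb 2 n := by
    intro h2
    have h1 : (1 : ℝ) ≤ Real.logb 2 n := by
      rw [Real.le_logb_iff_rpow_le one_lt_two (by positivity)]
      simpa using (by exact_mod_cast h2 : (2 : ℝ) ≤ n)
    have h3 : ((Nat.log 2 n : ℕ) : ℝ) ≤ Real.logb 2 n := by
      simpa using Real.natLog_le_logb n 2
    refine ⟨h1, ?_⟩
    rw [hk, width]
    push_cast
    linarith
  refine ⟨s, M, m, b, he, hS, ?_, hf, ?_, fun h2 => ?_, fun h2 => ?_⟩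
  · rw [hS]
    exact G.winningSet_isDominion.2.2
  · have : m ≤ 250 * (n * w) := by omega
    exact_mod_cast this
  · obtain ⟨h1, h3⟩ := hlog h2
    -- The shares are 80 for the outer loop, 33 for the inner loops, 9 for the final `getSet` and 3
    -- for the setup.
    have e : b ≤ 125 * (k * d * d * (n * w)) := by
      have h4 : k * d ≤ k * d * d := Nat.le_mul_of_pos_right _ hd
      have h5 : k * d * d ≤ k * d * d * (n * w) := Nat.le_mul_of_pos_right _ hnw
      have h6 : k ≤ k * d := Nat.le_mul_of_pos_right _ hd
      have h7 : outerCost k d * (1 + n * w) ≤ 80 * (k * d * d * (n * w)) := by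
        calc outerCost k d * (1 + n * w) ≤ 40 * (k * d * d) * (2 * (n * w)) :=
              Nat.mul_le_mul ho (by omega)
          _ = 80 * (k * d * d * (n * w)) := by ring
      have h8 : innerCost k d * (n * w) ≤ 33 * (k * d * d * (n * w)) := by
        rw [← Nat.mul_assoc 33]
        exact Nat.mul_le_mul_right _ (hi.trans (Nat.mul_le_mul_left _ h4))
      have h9 : k * (d + 1) = k * d + k := by ring
      omega
    have e' : (b : ℝ) ≤ 125 * (k * d * d * (n * w)) := by exact_mod_cast e
    refine e'.trans ?_
    have h4 : (0 : ℝ) ≤ d * d * (n * w) := by positivity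
    nlinarith [mul_le_mul_of_nonneg_right h3 h4]
  · obtain ⟨h1, h3⟩ := hlog h2
    have e : Fintype.card (Reg k d) = 14 + (d + k * (d + 1)) := by
      rw [Fintype.card_congr (Reg.equivSum k d)]
      have : Fintype.card (Entry d) = d + 1 := by
        rw [← Entry.length_all d, ← List.toFinset_card_of_nodup (Entry.nodup_all d)]
        rfl
      simp [this]
    rw [e]
    push_cast
    have hd' : (1 : ℝ) ≤ d := by exact_mod_cast hd
    have h4 : (1 : ℝ) ≤ d * Real.logb 2 n := one_le_mul_of_one_le_of_one_le hd' h1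
    have h5 : (d : ℝ) ≤ d * Real.logb 2 n := le_mul_of_one_le_right (by linarith) h1
    have h6 : (k : ℝ) * d ≤ 2 * Real.logb 2 n * d := mul_le_mul_of_nonneg_right h3 (by linarith)
    have h7 : (k : ℝ) ≤ k * d := le_mul_of_one_le_right (Nat.cast_nonneg _) hd'
    nlinarith
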